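/- Let $k$ be an arbitrary field, $P=k[[x_1,\dots,x_n]]$, $r\ge 1$ and $\widetilde R=k[[t_1]]\oplus\dots\oplus k[[t_r]]$. Let $\varphi:P\to\widetilde R$ be a morphism of $k$-algebras with components $\varphi_j:P\to k[[t_j]]$, such that $\varphi_j(x_i)\in t_jk[[t_j]]$ for all $i,j$, such that for each $j$ there is an $i$ with $\varphi_j(x_i)\ne 0$, and such that the branches are pairwise distinct, i.e. $\ker\varphi_j\neq\ker\varphi_{j'}$ for $j\ne j'$ (a parameterization of a curve singularity with $r$ branches). Put $R:=P/\ker\varphi\cong\varphi(P)$. Call $\varphi_j$ primitive if, whenever $\tilde\varphi:P\to k[[t_j]]$ is a morphism of local $k$-algebras and $\tau\in t_jk[[t_j]]$ is a power series with $\varphi_j(x_i)=\tilde\varphi(x_i)(\tau(t_j))$ for all $i$, the order of $\tau$ is $1$; call $\varphi$ primitive if all $\varphi_j$ are. Put $\delta_\varphi:=\dim_k\widetilde R/\varphi(P)$, $\mathcal C_\varphi:=\mathrm{Ann}_{\varphi(P)}(\widetilde R/\varphi(P))$ and $c_\varphi:=\dim_k\widetilde R/\mathcal C_\varphi$. For a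 reduced local $k$-algebra $R$ let $\overline R$ be its integral closure in its total quotient ring, $\mathcal C:=\mathrm{Ann}_R(\overline R/R)$, $\delta_k(R):=\dim_k\overline R/R$ and $c_k(R):=\dim_k\overline R/\mathcal C$. A morphism $A\to B$ of Noetherian rings is birational if it induces a bijection from the minimal primes of $B$ to those of $A$ and, for each minimal prime $\mathfrak p$ of $B$ with preimage $\mathfrak q$ in $A$, an isomorphism $A_{\mathfrak q}\to B_{\mathfrak p}$. Then $\varphi$ is a finite morphism and $R\cong\varphi(P)$ is a Noetherian, reduced, complete local ring of dimension $1$. Moreover, the following are equivalent: (i) $\varphi$ is primitive; (ii) $\delta_\varphi<\infty$; (iii) $c_\varphi<\infty$; (iv) $\varphi(P)\hookrightarrow\widetilde R$ is birational; (v) $\varphi(P)\hookrightarrow\widetilde R$ is the normalization of $\varphi(P)$. If any of these conditions holds, then $\delta_k(R)=\delta_\varphi$ and $c_k(R)=c_\varphi$. Moreover $\delta_k(R)\le c_k(R)\le 2\delta_k(R)$, and $c_k(R)=2\delta_k(R)$ if and only if $R$ is Gorenstein. -/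

import Mathlib

universe u v w

noncomputable section

/-- The dimension of a vector space, as an element of `ℕ∞` (all infinite dimensions are `⊤`). -/
def dimENat (k : Type u) (V : Type v) [Field k] [AddCommGroup V] [Module k V] : ℕ∞ :=
  Cardinal.toENat (Module.rank k V)

section Extensions

variable (k : Type u) (A : Type v) (B : Type w) [Field k] [CommRing A] [CommRing B]
  [Algebra k A] [Algebra k B] [Algebra A B] [IsScalarTower k A B]

/-- The image of `A` in an `A`-algebra `B`, as an `A`-submodule of `B`. -/
def imageIn (A : Type v) (B : Type w) [CommRing A] [CommRing B] [Algebra A B] :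
    Submodule A B :=
  LinearMap.range (Algebra.linearMap A B)

/-- The conductor ideal `Ann_A (B / A)` of a ring extension `A → B`. -/
def conductorIdeal (A : Type v) (B : Type w) [CommRing A] [CommRing B] [Algebra A B] :
    Ideal A :=
  Module.annihilator A (B ⧸ imageIn A B)

/-- `dim_k (B / A)`. -/
def deltaOf : ℕ∞ :=
  dimENat k (B ⧸ imageIn A B)

/-- `dim_k (B / C)`, where `C = Ann_A (B / A)` is the conductor ideal, viewed inside `B`. -/
def conductorOf : ℕ∞ :=
  dimENat k (B ⧸ Submodule.map (Algebra.linearMap A B) (conductorIdeal A B))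

/-- `A → B` is birational: contraction is a bijection from the minimal primes of `B` onto those
of `A`, and for each minimal prime `p` of `B` the local homomorphism `A_{p ∩ A} → B_p` is an
isomorphism. -/
def IsBirationalExt (A : Type v) (B : Type w) [CommRing A] [CommRing B] [Algebra A B] : Prop :=
  Set.BijOn (Ideal.comap (algebraMap A B)) (minimalPrimes B) (minimalPrimes A) ∧
    ∀ (p : Ideal B) [p.IsPrime], p ∈ minimalPrimes B →
      Function.Bijective
        (Localization.localRingHom (p.comap (algebraMap A B)) p (algebraMap A B) rfl)

end Extensions

section Invariants

variable (k : Type u) (R : Type v) [Field k] [CommRing R] [Algebra k R]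

/-- The integral closure of `R` in its total quotient ring. -/
abbrev NormalizationRing (R : Type v) [CommRing R] : Type v :=
  integralClosure R (FractionRing R)

/-- `A → B` is (isomorphic to) the normalization of `A`. -/
def IsNormalizationExt (A : Type v) (B : Type w) [CommRing A] [CommRing B] [Algebra A B] : Prop :=
  Nonempty (B ≃ₐ[A] NormalizationRing A)

/-- The delta invariant `δ_k(R)`. -/
def deltaInvariant : ℕ∞ := deltaOf k R (NormalizationRing R)

/-- The multiplicity `c_k(R)` of the conductor. -/
def conductorInvariant : ℕ∞ := conductorOf k R (NormalizationRing R)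

/-- `R` is a complete local ring (complete and separated for the topology of its maximal ideal). -/
def IsCompleteLocal (R : Type v) [CommRing R] : Prop :=
  ∃ _ : IsLocalRing R, IsAdicComplete (IsLocalRing.maximalIdeal R) R

/-- A Gorenstein local ring: Noetherian, local, and of finite injective dimension as a module over
itself. -/
def IsGorensteinLocal (R : Type v) [CommRing R] : Prop :=
  IsNoetherianRing R ∧ IsLocalRing R ∧
    ∃ d : ℕ, CategoryTheory.HasInjectiveDimensionLE (ModuleCat.of R R) d

end Invariants

section Parameterizations

variable {k : Type u} [Field k] {n r : ℕ}

/-- A parameterization `ψ : k[[x₁, …, xₙ]] → k[[t]]` of a uni-branch curve singularity. -/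
def IsBranchParameterization (ψ : MvPowerSeries (Fin n) k →ₐ[k] PowerSeries k) : Prop :=
  (∀ i, PowerSeries.constantCoeff (ψ (MvPowerSeries.X i)) = 0) ∧
    ∃ i, ψ (MvPowerSeries.X i) ≠ 0

/-- `ψ` is primitive: whenever `ψ(xᵢ) = ψ'(xᵢ)(τ(t))` for all `i`, with a morphism `ψ'` and a
power series `τ` without constant term, the order of `τ` is `1`. (Every `k`-algebra homomorphism
`k[[x]] → k[[t]]` is automatically local.) -/
def IsPrimitiveBranch (ψ : MvPowerSeries (Fin n) k →ₐ[k] PowerSeries k) : Prop :=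
  ∀ (ψ' : MvPowerSeries (Fin n) k →ₐ[k] PowerSeries k) (τ : PowerSeries k),
    PowerSeries.constantCoeff τ = 0 →
    (∀ i, ψ (MvPowerSeries.X i) = (ψ' (MvPowerSeries.X i)).subst τ) →
    τ.order = 1

/-- The component `φ_j = π_j ∘ φ` of `φ : k[[x₁, …, xₙ]] → k[[t₁]] ⊕ … ⊕ k[[t_r]]`. -/
def branch (φ : MvPowerSeries (Fin n) k →ₐ[k] (Fin r → PowerSeries k)) (j : Fin r) :
    MvPowerSeries (Fin n) k →ₐ[k] PowerSeries k :=
  (Pi.evalAlgHom k (fun _ : Fin r => PowerSeries k) j).comp φ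

/-- `φ` is a parameterization of a curve singularity with `r ≥ 1` branches: each `φ_j` is a
parameterization of a branch, and the branches are pairwise distinct. The `j`-th branch is the
closed subscheme of `Spec k[[x]]` defined by `Ker φ_j`, so two branches are distinct iff these
kernels are. -/
structure IsParameterization
    (φ : MvPowerSeries (Fin n) k →ₐ[k] (Fin r → PowerSeries k)) : Prop where
  pos : 0 < r
  isBranch : ∀ j, IsBranchParameterization (branch φ j)
  distinct : ∀ j j', j ≠ j' → RingHom.ker (branch φ j) ≠ RingHom.ker (branch φ j')

/-- `φ` is primitive: each `φ_j` is. -/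
def IsPrimitiveParameterization
    (φ : MvPowerSeries (Fin n) k →ₐ[k] (Fin r → PowerSeries k)) : Prop :=
  ∀ j, IsPrimitiveBranch (branch φ j)

/-- The ring `R = k[[x]] / Ker φ`. -/
abbrev curveRing (φ : MvPowerSeries (Fin n) k →ₐ[k] (Fin r → PowerSeries k)) : Type u :=
  MvPowerSeries (Fin n) k ⧸ RingHom.ker φ

/-- `δ_φ = dim_k (k[[t₁]] ⊕ … ⊕ k[[t_r]]) / φ(P)`. -/
def deltaParam (φ : MvPowerSeries (Fin n) k →ₐ[k] (Fin r → PowerSeries k)) : ℕ∞ :=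
  deltaOf k φ.range (Fin r → PowerSeries k)

/-- `c_φ = dim_k (k[[t₁]] ⊕ … ⊕ k[[t_r]]) / C_φ`, with `C_φ` the conductor ideal of `φ`. -/
def conductorParam (φ : MvPowerSeries (Fin n) k →ₐ[k] (Fin r → PowerSeries k)) : ℕ∞ :=
  conductorOf k φ.range (Fin r → PowerSeries k)

end Parameterizations

end

/-! Write `A` for `φ(P)` or the isomorphic ring `R`, `B` for the product of the `k⟦t_j⟧`, `L` for
its total quotient ring, and `C` for the conductor.

An element `z` of the maximal ideal of `P` that is nonzero on every branch exists by prime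
avoidance. It makes `B` finite over a complete ring `k⟦X⟧`, where `X` acts as `z`. So `φ` is finite
and `A` is Noetherian; completeness comes from `P`, and the dimension is read off from the integral
extension `A → B`.

The five conditions are all equivalent to one: `A` contains every element of `B` of sufficiently
high order (`IsCurveOrder`). Distinct branch kernels are incomparable, so `A` has nonzero elements
supported on any given branch, and the condition can be tested branchwise: `φ_j(P)` contains `f
k⟦t⟧` for some `f ≠ 0`. Finite `δ` gives it by Cayley-Hamilton; birationality and normality give it
by clearing denominators in the finite module `B`. For primitivity, the quotients of elements of
`φ_j(P)` that are power series form a ring with a uniformizer `s`, and each of them is a power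
series in `s`. Primitivity forces `s` to have order one; by approximation and Nakayama the ring is
then `k⟦t⟧`. Conversely, `f` and `f t` in `φ_j(P)` have consecutive orders, both multiples of the
order of `τ`.

For `c ≤ 2δ`, the conductor consists of the elements of order at least some exponent vector `γ`. If
`γ = α + δ + e_j`, then `A` cannot contain both an element of order at least `α` with nonzero `t_j ^
α_j` coefficient and one of the same kind for `δ`: their product would enlarge the conductor.
Counting along a path from `0` to `γ` gives `2 ℓ(A/C) ≤ c`, while `c = ℓ(A/C) + δ`. So `c = 2δ`
means `ℓ(A/C) = δ`.

For the Gorenstein criterion, `L` is an injective `A`-module; put `E = L/A`. If `A` has finite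
injective dimension, `Hom(-, E)` preserves the length of modules of finite length, and the dual of
`A/C` is `B/A`, so `ℓ(A/C) = δ`. Conversely, that equality makes the count above exact, which bounds
the socle of `E` by length one. A length comparison then shows `E` injective, and `0 → A → L → E →
0` is an injective resolution. -/

noncomputable section

set_option linter.unusedSectionVars false

/-! ### Vanishing of `Ext¹` from modules of finite length into a divisible module -/

section ExtOverLocalRings

open CategoryTheory CategoryTheory.Abelian

variable {A : Type u} [CommRing A] (E : Type u) [AddCommGroup E] [Module A E]

section

variable {M N Q : Type u} [AddCommGroup M] [Module A M] [AddCommGroup N] [Module A N]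
  [AddCommGroup Q] [Module A Q]

/-- `Ext` vanishes on an extension of modules on which it vanishes. -/
lemma ext_subsingleton_of_quotient (P : Submodule A M) (e : ℕ)
    (h₁ : Subsingleton (Ext (ModuleCat.of A P) (ModuleCat.of A E) e))
    (h₃ : Subsingleton (Ext (ModuleCat.of A (M ⧸ P)) (ModuleCat.of A E) e)) :
    Subsingleton (Ext (ModuleCat.of A M) (ModuleCat.of A E) e) := by
  let S := ModuleCat.shortComplexOfCompEqZero P.subtype P.mkQ
    (LinearMap.exact_subtype_mkQ P).linearMap_comp_eq_zero
  have hS : S.ShortExact := ModuleCat.shortComplex_shortExact S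
    (LinearMap.exact_subtype_mkQ P) P.injective_subtype P.mkQ_surjective
  refine subsingleton_of_forall_eq 0 fun x ↦ ?_
  obtain ⟨y, rfl⟩ := Ext.contravariant_sequence_exact₂ hS (ModuleCat.of A E) x
    (Subsingleton.elim (α := Ext (ModuleCat.of A P) (ModuleCat.of A E) e) _ _)
  rw [Subsingleton.elim (α := Ext (ModuleCat.of A (M ⧸ P)) (ModuleCat.of A E) e) y 0, Ext.comp_zero]

/-- A monomorphism induces a surjection on `Ext` in top degree. -/
lemma ext_subsingleton_of_injective (f : N →ₗ[A] M) (hf : Function.Injective f) (e : ℕ)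
    (h₂ : Subsingleton (Ext (ModuleCat.of A M) (ModuleCat.of A E) e))
    (h₃ : Subsingleton (Ext (ModuleCat.of A (M ⧸ LinearMap.range f)) (ModuleCat.of A E) (e + 1))) :
    Subsingleton (Ext (ModuleCat.of A N) (ModuleCat.of A E) e) := by
  let S := ModuleCat.shortComplexOfCompEqZero f (LinearMap.range f).mkQ
    f.exact_map_mkQ_range.linearMap_comp_eq_zero
  have hS : S.ShortExact := ModuleCat.shortComplex_shortExact S
    f.exact_map_mkQ_range hf (Submodule.mkQ_surjective _)
  refine subsingleton_of_forall_eq 0 fun x ↦ ?_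
  obtain ⟨y, rfl⟩ := Ext.contravariant_sequence_exact₁ hS (ModuleCat.of A E) x (add_comm 1 e)
    (Subsingleton.elim (α := Ext (ModuleCat.of A (M ⧸ LinearMap.range f))
      (ModuleCat.of A E) (e + 1)) _ _)
  rw [Subsingleton.elim (α := Ext (ModuleCat.of A M) (ModuleCat.of A E) e) y 0, Ext.comp_zero]

/-- Multiplication by `x` on `A` is a free resolution of `A / x`: higher `Ext` vanishes, and `Ext¹`
is `E / xE`, which is zero by divisibility. -/
lemma ext_quotient_span_singleton_subsingleton {x : A} (hx : IsSMulRegular A x)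
    (hE : Function.Surjective fun y : E ↦ x • y) (e : ℕ) :
    Subsingleton (Ext (ModuleCat.of A (A ⧸ LinearMap.range (LinearMap.lsmul A A x)))
      (ModuleCat.of A E) (e + 1)) := by
  let f := LinearMap.lsmul A A x
  let S := ModuleCat.shortComplexOfCompEqZero f (LinearMap.range f).mkQ
    f.exact_map_mkQ_range.linearMap_comp_eq_zero
  have hS : S.ShortExact := ModuleCat.shortComplex_shortExact S
    f.exact_map_mkQ_range hx (Submodule.mkQ_surjective _)
  refine subsingleton_of_forall_eq 0 fun y ↦ ?_
  obtain ⟨z, rfl⟩ := Ext.contravariant_sequence_exact₃ hS (ModuleCat.of A E) y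
    (Ext.eq_zero_of_projective (P := ModuleCat.of A A) _) (add_comm 1 e)
  obtain _ | e := e
  · obtain ⟨g, rfl⟩ := Ext.homEquiv₀.symm.surjective z
    obtain ⟨w, hw⟩ := hE (g.hom (1 : A))
    have : g = S.f ≫ ModuleCat.ofHom (LinearMap.toSpanSingleton A E w) := by
      ext
      change g.hom (1 : A) = (x • (1 : A)) • w
      rw [← hw]
      simp
    rw [this, Ext.homEquiv₀_symm_apply, ← Ext.mk₀_comp_mk₀]
    exact hS.extClass_comp_assoc _
  · rw [Ext.eq_zero_of_projective (P := ModuleCat.of A A) z]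
    exact Ext.comp_zero ..

/-- The obstruction to extending `g` is a class in `Ext¹(M / P, E)`. -/
lemma exists_extension_of_ext_one_subsingleton (P : Submodule A M)
    (h : Subsingleton (Ext (ModuleCat.of A (M ⧸ P)) (ModuleCat.of A E) 1)) (g : P →ₗ[A] E) :
    ∃ g' : M →ₗ[A] E, g' ∘ₗ P.subtype = g := by
  let S := ModuleCat.shortComplexOfCompEqZero P.subtype P.mkQ
    (LinearMap.exact_subtype_mkQ P).linearMap_comp_eq_zero
  have hS : S.ShortExact := ModuleCat.shortComplex_shortExact S
    (LinearMap.exact_subtype_mkQ P) P.injective_subtype P.mkQ_surjective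
  obtain ⟨y, hy⟩ := Ext.contravariant_sequence_exact₁ hS (ModuleCat.of A E)
    (Ext.mk₀ (ModuleCat.ofHom g)) (add_zero 1)
    (Subsingleton.elim (α := Ext (ModuleCat.of A (M ⧸ P)) (ModuleCat.of A E) 1) _ _)
  obtain ⟨φ, rfl⟩ := Ext.homEquiv₀.symm.surjective y
  have : S.f ≫ φ = ModuleCat.ofHom g := Ext.homEquiv₀.symm.injective (by simpa using hy)
  exact ⟨φ.hom, congrArg ModuleCat.Hom.hom this⟩

end

variable [IsLocalRing A] {x : A}

/-- A nonzero module of finite length has a simple submodule, and a local ring has only one simple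
module up to isomorphism. -/
lemma isSimpleModule_exists_injective {x : A}
    (hx : IsFiniteLength A (A ⧸ LinearMap.range (LinearMap.lsmul A A x)))
    (hm : ¬ IsUnit x) (S : Type u) [AddCommGroup S] [Module A S] [IsSimpleModule A S] :
    ∃ f : S →ₗ[A] A ⧸ LinearMap.range (LinearMap.lsmul A A x), Function.Injective f := by
  set Q := A ⧸ LinearMap.range (LinearMap.lsmul A A x)
  have : IsArtinian A Q := (isFiniteLength_iff_isNoetherian_isArtinian.mp hx).2
  have : Nontrivial Q := by
    refine Submodule.Quotient.nontrivial_iff.mpr fun h ↦ hm ?_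
    obtain ⟨y, hy⟩ : (1 : A) ∈ LinearMap.range (LinearMap.lsmul A A x) := h ▸ trivial
    exact IsUnit.of_mul_eq_one y hy
  obtain ⟨T, hT, -⟩ := (eq_bot_or_exists_atom_le (⊤ : Submodule A Q)).resolve_left top_ne_bot
  have hT' : IsSimpleModule A T := isSimpleModule_iff_isAtom.mpr hT
  obtain ⟨I, hI, ⟨e⟩⟩ := isSimpleModule_iff_quot_maximal.mp ‹IsSimpleModule A S›
  obtain ⟨J, hJ, ⟨e'⟩⟩ := isSimpleModule_iff_quot_maximal.mp hT'
  obtain rfl : I = J :=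
    (IsLocalRing.eq_maximalIdeal hI).trans (IsLocalRing.eq_maximalIdeal hJ).symm
  exact ⟨T.subtype ∘ₗ (e.trans e'.symm).toLinearMap,
    T.injective_subtype.comp (e.trans e'.symm).injective⟩

/-- If a divisible module over a local ring of depth one has finite injective dimension, then
`Ext¹(M, E) = 0` for every module `M` of finite length. -/
lemma ext_one_subsingleton_of_hasInjectiveDimensionLT (hx : IsSMulRegular A x) (hm : ¬ IsUnit x)
    (hE : Function.Surjective fun y : E ↦ x • y)
    (hfin : IsFiniteLength A (A ⧸ LinearMap.range (LinearMap.lsmul A A x))) (d : ℕ)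
    [HasInjectiveDimensionLT (ModuleCat.of A E) d] (M : Type u) [AddCommGroup M] [Module A M]
    (hM : IsFiniteLength A M) :
    Subsingleton (Ext (ModuleCat.of A M) (ModuleCat.of A E) 1) := by
  -- Descending induction on the degree: `j` bounds the distance to the range where the injective
  -- dimension kills everything.
  suffices H : ∀ j e : ℕ, d ≤ e + 1 + j → ∀ (M : Type u) [AddCommGroup M] [Module A M],
      IsFiniteLength A M → Subsingleton (Ext (ModuleCat.of A M) (ModuleCat.of A E) (e + 1)) from
    H d 0 (by lia) M hM
  intro j
  induction j with
  | zero =>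
    intro e he M _ _ _
    exact HasInjectiveDimensionLT.subsingleton _ d _ he _
  | succ j ih =>
    intro e he M _ _ hM
    induction hM with
    | of_subsingleton =>
      refine subsingleton_of_forall_eq 0 fun y ↦ ?_
      exact Ext.eq_zero_of_projective (P := ModuleCat.of A _) _
    | @of_simple_quotient M _ _ N _ _ ihN =>
      refine ext_subsingleton_of_quotient E N _ ihN ?_
      -- The simple quotient embeds in `A / x`, on which `Ext` vanishes in positive degrees. The
      -- cokernel has finite length, so its `Ext` one degree higher vanishes by induction.
      obtain ⟨f, hf⟩ := isSimpleModule_exists_injective hfin hm (M ⧸ N)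
      exact ext_subsingleton_of_injective E f hf _
        (ext_quotient_span_singleton_subsingleton E hx hE e)
        (ih (e + 1) (by lia) _ (hfin.of_surjective (Submodule.mkQ_surjective _)))

end ExtOverLocalRings

/-! ### Length of the dual of a module of finite length -/

section LengthOfHom

variable {A : Type u} [CommRing A] (E : Type u) [AddCommGroup E] [Module A E]

section

variable {M : Type u} [AddCommGroup M] [Module A M] (N : Submodule A M)

lemma exact_lcomp_mkQ_lcomp_subtype :
    Function.Exact (LinearMap.lcomp A E N.mkQ) (LinearMap.lcomp A E N.subtype) :=
  LinearMap.exact_lcomp_of_exact_of_surjective _ (LinearMap.exact_subtype_mkQ N) N.mkQ_surjective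

lemma length_hom_eq_add_range :
    Module.length A (M →ₗ[A] E) = Module.length A (M ⧸ N →ₗ[A] E) +
      Module.length A (LinearMap.range (LinearMap.lcomp A E N.subtype)) := by
  refine Module.length_eq_add_of_exact (LinearMap.lcomp A E N.mkQ)
    (LinearMap.lcomp A E N.subtype).rangeRestrict (LinearMap.lcomp_injective_of_surjective _ N.mkQ_surjective)
    (LinearMap.surjective_rangeRestrict _) ?_
  intro f
  rw [← exact_lcomp_mkQ_lcomp_subtype E N f]
  simp [Subtype.ext_iff]

lemma length_hom_le_add :
    Module.length A (M →ₗ[A] E) ≤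
      Module.length A (M ⧸ N →ₗ[A] E) + Module.length A (N →ₗ[A] E) := by
  rw [length_hom_eq_add_range E N]
  gcongr
  exact Module.length_le_of_injective _ (Submodule.injective_subtype _)

lemma length_eq_quotient_add :
    Module.length A M = Module.length A (M ⧸ N) + Module.length A N := by
  rw [Module.length_eq_add_of_exact N.subtype N.mkQ N.injective_subtype N.mkQ_surjective
    (LinearMap.exact_subtype_mkQ N), add_comm]

end

variable [IsLocalRing A]

lemma length_hom_of_isSimpleModule (S : Type u) [AddCommGroup S] [Module A S]
    [IsSimpleModule A S] : Module.length A (S →ₗ[A] E) =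
      Module.length A (A ⧸ IsLocalRing.maximalIdeal A →ₗ[A] E) := by
  obtain ⟨I, hI, ⟨e⟩⟩ := isSimpleModule_iff_quot_maximal.mp ‹IsSimpleModule A S›
  obtain rfl := IsLocalRing.eq_maximalIdeal hI
  exact (LinearEquiv.arrowCongr e (LinearEquiv.refl A E)).length_eq

variable {E}

/-- `Hom(-, E)` is left exact, so each simple factor contributes at most the length of the socle of
`E`. -/
lemma length_hom_le_length
    (h : Module.length A (A ⧸ IsLocalRing.maximalIdeal A →ₗ[A] E) ≤ 1)
    {M : Type u} [AddCommGroup M] [Module A M] (hM : IsFiniteLength A M) :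
    Module.length A (M →ₗ[A] E) ≤ Module.length A M := by
  induction hM with
  | of_subsingleton => simp [Module.length_eq_zero]
  | @of_simple_quotient M _ _ N _ _ ih =>
    refine (length_hom_le_add E N).trans ?_
    rw [length_eq_quotient_add N, length_hom_of_isSimpleModule E (M ⧸ N), Module.length_eq_one A (M ⧸ N)]
    gcongr

/-- Extendability of maps makes `Hom(-, E)` exact on modules of finite length, so each simple factor
contributes exactly the length of the socle. -/
lemma length_hom_eq_mul_length
    (h : ∀ (M : Type u) [AddCommGroup M] [Module A M], IsFiniteLength A M →
      ∀ (N : Submodule A M) (g : N →ₗ[A] E), ∃ g' : M →ₗ[A] E, g' ∘ₗ N.subtype = g)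
    {M : Type u} [AddCommGroup M] [Module A M] (hM : IsFiniteLength A M) :
    Module.length A (M →ₗ[A] E) =
      Module.length A (A ⧸ IsLocalRing.maximalIdeal A →ₗ[A] E) * Module.length A M := by
  induction hM with
  | of_subsingleton => simp [Module.length_eq_zero]
  | @of_simple_quotient M _ _ N _ hN ih =>
    have hM : IsFiniteLength A M := .of_simple_quotient hN
    rw [Module.length_eq_add_of_exact _ (LinearMap.lcomp A E N.subtype)
      (LinearMap.lcomp_injective_of_surjective _ N.mkQ_surjective) (h M hM N)
      (exact_lcomp_mkQ_lcomp_subtype E N), ih, length_eq_quotient_add N,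
      length_hom_of_isSimpleModule E (M ⧸ N), Module.length_eq_one A (M ⧸ N), mul_add, mul_one]

/-- If the socle of `E` has length at most one, then maps to `E` extend along
submodules of a module `M` of finite length whose dual has the same length as `M`. -/
lemma exists_extension_of_length_hom_eq
    (h : Module.length A (A ⧸ IsLocalRing.maximalIdeal A →ₗ[A] E) ≤ 1)
    {M : Type u} [AddCommGroup M] [Module A M] (hM : IsFiniteLength A M)
    (hlen : Module.length A (M →ₗ[A] E) = Module.length A M)
    (N : Submodule A M) (g : N →ₗ[A] E) : ∃ g' : M →ₗ[A] E, g' ∘ₗ N.subtype = g := by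
  have hN : IsFiniteLength A N := hM.of_injective N.injective_subtype
  have hQ : IsFiniteLength A (M ⧸ N) := hM.of_surjective N.mkQ_surjective
  set W := LinearMap.range (LinearMap.lcomp A E N.subtype)
  -- `Hom(M / N, E)` is no longer than `M / N`, so the restrictions `W` must have at least the
  -- length of `N`, hence at least that of `Hom(N, E)`.
  have h1 : Module.length A (M ⧸ N) + Module.length A N ≤
      Module.length A (M ⧸ N) + Module.length A W := by
    rw [← length_eq_quotient_add N, ← hlen, length_hom_eq_add_range E N]
    gcongr
    exact length_hom_le_length h hQ
  have h2 : Module.length A N ≤ Module.length A W :=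
    (ENat.add_le_add_iff_left (Module.length_ne_top_iff.mpr hQ)).mp h1
  have h3 := length_hom_le_length h hN
  have h4 : IsFiniteLength A (N →ₗ[A] E) := Module.length_ne_top_iff.mp
    (ne_top_of_le_ne_top (Module.length_ne_top_iff.mpr hN) h3)
  obtain ⟨_, _⟩ := isFiniteLength_iff_isNoetherian_isArtinian.mp h4
  have : W = ⊤ := by
    by_contra hW
    exact absurd (h3.trans h2) (Submodule.length_lt hW).not_ge
  obtain ⟨g', hg'⟩ : g ∈ W := this ▸ trivial
  exact ⟨g', hg'⟩

end LengthOfHom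

/-! ### The quotient `L / A` as a dualizing module -/

section QuotientOfOverring

open CategoryTheory

variable {A L : Type u} [CommRing A] [CommRing L] [Algebra A L]

lemma surjective_smul_quotient_imageIn {x : A} (hx : IsUnit (algebraMap A L x)) :
    Function.Surjective fun y : L ⧸ imageIn A L ↦ x • y := by
  intro y
  obtain ⟨y, rfl⟩ := Submodule.mkQ_surjective _ y
  obtain ⟨u, hu⟩ := hx
  refine ⟨Submodule.mkQ _ (↑u⁻¹ * y), ?_⟩
  simp only [← map_smul, Algebra.smul_def, ← hu, Units.mul_inv_cancel_left]

/-- Homomorphisms `A / I → E` correspond to the elements of `E` annihilated by `I`. -/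
def homQuotientEquivTorsionBySet (E : Type u) [AddCommGroup E] [Module A E] (I : Submodule A A) :
    (A ⧸ I →ₗ[A] E) ≃ₗ[A] Submodule.torsionBySet A E (I : Set A) where
  toFun f := ⟨f (I.mkQ 1), by
    rw [Submodule.mem_torsionBySet_iff]
    rintro ⟨a, ha⟩
    change a • f (I.mkQ 1) = 0
    rw [← map_smul, ← map_smul, smul_eq_mul, mul_one, Submodule.mkQ_apply,
      (Submodule.Quotient.mk_eq_zero I).mpr ha, map_zero]⟩
  map_add' f g := rfl
  map_smul' a f := rfl
  invFun y := I.liftQ (LinearMap.toSpanSingleton A E y) fun a ha ↦ by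
    simpa using (Submodule.mem_torsionBySet_iff _ _).mp y.2 ⟨a, ha⟩
  left_inv f := by
    refine Submodule.linearMap_qext _ (LinearMap.ext_ring ?_)
    simp
  right_inv y := by
    ext
    change (I.liftQ _ _) (I.mkQ 1) = _
    rw [Submodule.mkQ_apply, Submodule.liftQ_apply, LinearMap.toSpanSingleton_apply, one_smul]

variable (L) in
-- The `x`-torsion of `L / A` is `x⁻¹A / A`, and `a ↦ a / x` identifies it with `A / x`.
lemma length_hom_quotient_lsmul {x : A} (hx : IsUnit (algebraMap A L x))
    (hinj : Function.Injective (algebraMap A L)) :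
    Module.length A (A ⧸ LinearMap.range (LinearMap.lsmul A A x) →ₗ[A] L ⧸ imageIn A L) =
      Module.length A (A ⧸ LinearMap.range (LinearMap.lsmul A A x)) := by
  rw [(homQuotientEquivTorsionBySet _ _).length_eq]
  obtain ⟨u, hu⟩ := hx
  have hxu : algebraMap A L x * ↑u⁻¹ = 1 := by rw [← hu, Units.mul_inv]
  let f : A →ₗ[A] L ⧸ imageIn A L :=
    LinearMap.toSpanSingleton A _ ((imageIn A L).mkQ (↑u⁻¹ : L))
  have hf (a : A) : f a = (imageIn A L).mkQ (a • (↑u⁻¹ : L)) := by simp [f]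
  have hker : LinearMap.ker f = LinearMap.range (LinearMap.lsmul A A x) := by
    ext a
    rw [LinearMap.mem_ker, hf, Submodule.mkQ_apply, Submodule.Quotient.mk_eq_zero]
    constructor
    · rintro ⟨b, hb⟩
      refine ⟨b, hinj ?_⟩
      rw [Algebra.linearMap_apply, Algebra.smul_def] at hb
      rw [LinearMap.lsmul_apply, smul_eq_mul, map_mul, hb, mul_left_comm, hxu, mul_one]
    · rintro ⟨b, rfl⟩
      refine ⟨b, ?_⟩
      rw [Algebra.linearMap_apply, LinearMap.lsmul_apply, smul_eq_mul, Algebra.smul_def, map_mul,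
        mul_right_comm, hxu, one_mul]
  have hrange : LinearMap.range f =
      Submodule.torsionBySet A _ (LinearMap.range (LinearMap.lsmul A A x) : Set A) := by
    ext y
    rw [Submodule.mem_torsionBySet_iff]
    constructor
    · rintro ⟨a, rfl⟩ ⟨_, ⟨b, rfl⟩⟩
      change (x * b) • f a = 0
      rw [hf, ← map_smul, Submodule.mkQ_apply, Submodule.Quotient.mk_eq_zero]
      refine ⟨b * a, ?_⟩
      rw [Algebra.linearMap_apply, Algebra.smul_def, Algebra.smul_def, map_mul, map_mul,
        mul_left_comm, mul_right_comm, hxu, one_mul, mul_comm]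
    · intro h
      obtain ⟨y, rfl⟩ := Submodule.mkQ_surjective _ y
      have := h ⟨x, ⟨1, by simp⟩⟩
      change x • (imageIn A L).mkQ y = 0 at this
      rw [← map_smul, Submodule.mkQ_apply, Submodule.Quotient.mk_eq_zero] at this
      obtain ⟨a, ha⟩ := this
      refine ⟨a, ?_⟩
      rw [hf]
      rw [Algebra.linearMap_apply, Algebra.smul_def] at ha
      rw [Algebra.smul_def, ha, mul_right_comm, hxu, one_mul]
  rw [← hrange, ← hker]
  exact f.quotKerEquivRange.symm.length_eq

variable [IsLocalRing A]

/-- If `A` has finite injective dimension, then dualizing into `L / A` preserves length. -/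
lemma length_hom_eq_of_hasInjectiveDimensionLE (hinj : Function.Injective (algebraMap A L))
    (hL : Module.Baer A L) {x : A} (hx : IsUnit (algebraMap A L x)) (hm : ¬ IsUnit x)
    (hfin : IsFiniteLength A (A ⧸ LinearMap.range (LinearMap.lsmul A A x)))
    (d : ℕ) [HasInjectiveDimensionLE (ModuleCat.of A A) d]
    {M : Type u} [AddCommGroup M] [Module A M] (hM : IsFiniteLength A M) :
    Module.length A (M →ₗ[A] L ⧸ imageIn A L) = Module.length A M := by
  have : Module.Injective A L := hL.injective
  have : Injective (ModuleCat.of A L) := Module.injective_object_of_injective_module A L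
  let f := Algebra.linearMap A L
  let S := ModuleCat.shortComplexOfCompEqZero f (LinearMap.range f).mkQ
    f.exact_map_mkQ_range.linearMap_comp_eq_zero
  have hS : S.ShortExact := ModuleCat.shortComplex_shortExact S
    f.exact_map_mkQ_range hinj (Submodule.mkQ_surjective _)
  have : HasInjectiveDimensionLT (ModuleCat.of A (L ⧸ imageIn A L)) (d + 1) :=
    (hS.hasInjectiveDimensionLT_X₃_iff d ‹_›).mpr
      (hasInjectiveDimensionLT_of_ge (ModuleCat.of A A) (d + 1) (d + 2) (by lia))
  have hreg : IsSMulRegular A x := by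
    intro a b hab
    apply hinj
    have := congrArg (algebraMap A L) hab
    simpa [hx.mul_right_inj] using this
  have key {M : Type u} [AddCommGroup M] [Module A M] (hM : IsFiniteLength A M) :
      Module.length A (M →ₗ[A] L ⧸ imageIn A L) = _ :=
    length_hom_eq_mul_length (fun M _ _ hM N g ↦ exists_extension_of_ext_one_subsingleton _ N
      (ext_one_subsingleton_of_hasInjectiveDimensionLT _ hreg hm
        (surjective_smul_quotient_imageIn hx) hfin (d + 1) _
        (hM.of_surjective N.mkQ_surjective)) g) hM
  -- `A / x` has the same length as its dual, and this length is finite and nonzero; so the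
  -- multiplier, the length of the socle of `L / A`, is one.
  have h1 := key hfin
  rw [length_hom_quotient_lsmul L hx hinj] at h1
  have hpos : Module.length A (A ⧸ LinearMap.range (LinearMap.lsmul A A x)) ≠ 0 := by
    rw [Ne, Module.length_eq_zero_iff, Submodule.Quotient.subsingleton_iff]
    intro h
    obtain ⟨y, hy⟩ : (1 : A) ∈ LinearMap.range (LinearMap.lsmul A A x) := h ▸ trivial
    exact hm (IsUnit.of_mul_eq_one y hy)
  have h2 : Module.length A (A ⧸ IsLocalRing.maximalIdeal A →ₗ[A] L ⧸ imageIn A L) = 1 := by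
    have hne := Module.length_ne_top_iff.mpr hfin
    generalize Module.length A (A ⧸ IsLocalRing.maximalIdeal A →ₗ[A] L ⧸ imageIn A L) = s at *
    generalize Module.length A (A ⧸ LinearMap.range (LinearMap.lsmul A A x)) = l at *
    lift l to ℕ using hne
    cases s with
    | top => simp [ENat.top_mul hpos] at h1
    | coe s =>
      norm_cast at *
      exact (Nat.eq_of_mul_eq_mul_right (Nat.pos_of_ne_zero hpos) (by lia : 1 * l = s * l)).symm
  rw [key hM, h2, one_mul]

/-- If the socle of `L / A` is simple, then `L / A` is an injective `A`-module. -/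
lemma baer_quotient_imageIn [IsNoetherianRing A] (hinj : Function.Injective (algebraMap A L))
    (hfin : ∀ x : A, IsUnit (algebraMap A L x) →
      IsFiniteLength A (A ⧸ LinearMap.range (LinearMap.lsmul A A x)))
    (htors : ∀ y : L, ∃ x : A, IsUnit (algebraMap A L x) ∧ x • y ∈ imageIn A L)
    (hideal : ∀ I : Ideal A, ∃ J : Ideal A, Disjoint I J ∧
      ∃ x ∈ I ⊔ J, IsUnit (algebraMap A L x))
    (hsocle : Module.length A (A ⧸ IsLocalRing.maximalIdeal A →ₗ[A] L ⧸ imageIn A L) ≤ 1) :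
    Module.Baer A (L ⧸ imageIn A L) := by
  set E := L ⧸ imageIn A L
  have htorsE (y : E) : ∃ x : A, IsUnit (algebraMap A L x) ∧ x • y = 0 := by
    obtain ⟨y, rfl⟩ := Submodule.mkQ_surjective _ y
    obtain ⟨x, hx, hxy⟩ := htors y
    exact ⟨x, hx, by rwa [← map_smul, Submodule.mkQ_apply, Submodule.Quotient.mk_eq_zero]⟩
  have hfg (N : Submodule A E) (hN : N.FG) :
      ∃ x : A, IsUnit (algebraMap A L x) ∧ ∀ y ∈ N, x • y = 0 := by
    induction N, hN using Submodule.fg_induction with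
    | singleton y =>
      obtain ⟨x, hx, hxy⟩ := htorsE y
      refine ⟨x, hx, fun w hw ↦ ?_⟩
      obtain ⟨a, rfl⟩ := Submodule.mem_span_singleton.mp hw
      rw [smul_comm, hxy, smul_zero]
    | sup N₁ N₂ _ _ h₁ h₂ =>
      obtain ⟨x₁, hx₁, h₁⟩ := h₁
      obtain ⟨x₂, hx₂, h₂⟩ := h₂
      refine ⟨x₁ * x₂, by simpa using ⟨hx₁, hx₂⟩, fun w hw ↦ ?_⟩
      obtain ⟨a, ha, b, hb, rfl⟩ := Submodule.mem_sup.mp hw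
      rw [smul_add, mul_smul, mul_smul, h₂ b hb, smul_comm, h₁ a ha]
      simp
  have hreg (K : Ideal A) (z : A) (hz : z ∈ K) (hzu : IsUnit (algebraMap A L z)) (f : K →ₗ[A] E) :
      ∃ g : A →ₗ[A] E, ∀ a (ha : a ∈ K), g a = f ⟨a, ha⟩ := by
    obtain ⟨d, hd, hdf⟩ := hfg (LinearMap.range f) (by
      rw [LinearMap.range_eq_map]; exact (IsNoetherian.noetherian _).map f)
    have hdz : IsUnit (algebraMap A L (d * z)) := by simpa using ⟨hd, hzu⟩
    set W := LinearMap.range (LinearMap.lsmul A A (d * z))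
    let p : K →ₗ[A] Submodule.map W.mkQ K :=
      (W.mkQ ∘ₗ K.subtype).codRestrict _ fun a ↦ Submodule.mem_map_of_mem a.2
    have hp : Function.Surjective p := by
      rintro ⟨_, ⟨a, ha, rfl⟩⟩
      exact ⟨⟨a, ha⟩, rfl⟩
    -- Since `d` kills the image of `f`, one has `f (b d z) = b d f z = 0`. So `f` descends to the
    -- image of `K` in `A / dz`, which has finite length and the same length as its dual, and there
    -- it extends.
    have hpf : LinearMap.ker p ≤ LinearMap.ker f := by
      rintro ⟨a, ha⟩ h
      have h' : W.mkQ a = 0 := congrArg Subtype.val h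
      rw [Submodule.mkQ_apply, Submodule.Quotient.mk_eq_zero] at h'
      obtain ⟨b, hb⟩ := h'
      have : (⟨a, ha⟩ : K) = (b * d) • ⟨z, hz⟩ := by
        ext
        simp only [← hb, LinearMap.lsmul_apply, smul_eq_mul, SetLike.mk_smul_mk]
        ring
      rw [LinearMap.mem_ker, this, map_smul, mul_smul, hdf _ ⟨_, rfl⟩, smul_zero]
    obtain ⟨g, hg⟩ := exists_extension_of_length_hom_eq hsocle (hfin _ hdz)
      (length_hom_quotient_lsmul L hdz hinj) (Submodule.map W.mkQ K)
      ((LinearMap.ker p).liftQ f hpf ∘ₗ (p.quotKerEquivOfSurjective hp).symm.toLinearMap)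
    refine ⟨g ∘ₗ W.mkQ, fun a ha ↦ ?_⟩
    have h1 := LinearMap.congr_fun hg (p ⟨a, ha⟩)
    have h2 : (p.quotKerEquivOfSurjective hp).symm (p ⟨a, ha⟩) =
        (LinearMap.ker p).mkQ ⟨a, ha⟩ := by
      rw [LinearEquiv.symm_apply_eq]
      rfl
    simp only [LinearMap.comp_apply, LinearEquiv.coe_coe, h2] at h1
    rw [Submodule.mkQ_apply, Submodule.liftQ_apply] at h1
    exact h1
  intro I f
  -- The sum of `I` and `J` is direct and contains an element invertible in `L`; `f` is extended by
  -- zero on `J`.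
  obtain ⟨J, hIJ, z, hz, hzu⟩ := hideal I
  let c : I × J →ₗ[A] A := I.subtype.coprod J.subtype
  have hc : Function.Injective c := by
    rw [← LinearMap.ker_eq_bot, LinearMap.ker_coprod_of_disjoint_range]
    · simp
    · simpa using hIJ
  have hcr : LinearMap.range c = I ⊔ J := by simp [c, LinearMap.range_coprod]
  obtain ⟨g, hg⟩ := hreg (LinearMap.range c) z (hcr ▸ hz) hzu
    ((f ∘ₗ LinearMap.fst A I J) ∘ₗ (LinearEquiv.ofInjective c hc).symm.toLinearMap)
  refine ⟨g, fun a ha ↦ ?_⟩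
  have hca : c (⟨a, ha⟩, 0) = a := by simp [c]
  have := hg a ⟨_, hca⟩
  rw [this]
  have h3 : (LinearEquiv.ofInjective c hc).symm ⟨a, ⟨_, hca⟩⟩ = (⟨a, ha⟩, 0) := by
    rw [LinearEquiv.symm_apply_eq]
    ext
    exact hca.symm
  simp [h3]

omit [IsLocalRing A] in
-- `0 → A → L → L / A → 0` is an injective resolution.
lemma hasInjectiveDimensionLE_one_of_baer (hinj : Function.Injective (algebraMap A L))
    (hL : Module.Baer A L) (hE : Module.Baer A (L ⧸ imageIn A L)) :
    HasInjectiveDimensionLE (ModuleCat.of A A) 1 := by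
  have : Module.Injective A L := hL.injective
  have : Injective (ModuleCat.of A L) := Module.injective_object_of_injective_module A L
  have : Module.Injective A (L ⧸ imageIn A L) := hE.injective
  have h3 : Injective (ModuleCat.of A (L ⧸ imageIn A L)) :=
    Module.injective_object_of_injective_module A _
  let f := Algebra.linearMap A L
  let S := ModuleCat.shortComplexOfCompEqZero f (LinearMap.range f).mkQ
    f.exact_map_mkQ_range.linearMap_comp_eq_zero
  have hS : S.ShortExact := ModuleCat.shortComplex_shortExact S
    f.exact_map_mkQ_range hinj (Submodule.mkQ_surjective _)
  exact (hS.hasInjectiveDimensionLT_X₃_iff 0 ‹_›).mp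
    (injective_iff_hasInjectiveDimensionLT_one.mp h3)

end QuotientOfOverring

/-! ### Lengths of subquotients -/

section RelativeLength

variable {R M : Type*} [Ring R] [AddCommGroup M] [Module R M]

/-- The length of `Q / P` for submodules `P ≤ Q`. -/
def relLength (P Q : Submodule R M) : ℕ∞ := Module.length R (Q ⧸ P.submoduleOf Q)

@[simp] lemma relLength_self (P : Submodule R M) : relLength P P = 0 := by
  rw [relLength, Module.length_eq_zero_iff, Submodule.Quotient.subsingleton_iff]
  simp [Submodule.submoduleOf]

lemma relLength_add_relLength {P Q S : Submodule R M} (h₁ : P ≤ Q) (h₂ : Q ≤ S) :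
    relLength P Q + relLength Q S = relLength P S := by
  let f : (Q ⧸ P.submoduleOf Q) →ₗ[R] (S ⧸ P.submoduleOf S) :=
    Submodule.mapQ _ _ (Submodule.inclusion h₂) fun x hx ↦ hx
  let g : (S ⧸ P.submoduleOf S) →ₗ[R] (S ⧸ Q.submoduleOf S) :=
    Submodule.mapQ _ _ LinearMap.id fun x hx ↦ h₁ hx
  refine (Module.length_eq_add_of_exact f g ?_ ?_ ?_).symm
  · rw [← LinearMap.ker_eq_bot, eq_bot_iff]
    intro x hx
    obtain ⟨x, rfl⟩ := Submodule.mkQ_surjective _ x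
    have hx' : (P.submoduleOf S).mkQ (Submodule.inclusion h₂ x) = 0 := hx
    rw [Submodule.mkQ_apply, Submodule.Quotient.mk_eq_zero] at hx'
    rw [Submodule.mem_bot, Submodule.mkQ_apply, Submodule.Quotient.mk_eq_zero]
    exact hx'
  · intro x
    obtain ⟨x, rfl⟩ := Submodule.mkQ_surjective _ x
    exact ⟨Submodule.mkQ _ x, rfl⟩
  · intro x
    obtain ⟨x, rfl⟩ := Submodule.mkQ_surjective _ x
    have : g (Submodule.mkQ _ x) = Submodule.mkQ _ x := rfl
    rw [this, Submodule.mkQ_apply, Submodule.Quotient.mk_eq_zero]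
    constructor
    · intro h
      exact ⟨Submodule.mkQ _ ⟨x, h⟩, rfl⟩
    · rintro ⟨y, hy⟩
      obtain ⟨y, rfl⟩ := Submodule.mkQ_surjective _ y
      have hy' : (P.submoduleOf S).mkQ (Submodule.inclusion h₂ y) = Submodule.mkQ _ x := hy
      rw [← sub_eq_zero, ← map_sub, Submodule.mkQ_apply, Submodule.Quotient.mk_eq_zero] at hy'
      have hy'' : (y : M) - x ∈ P := hy'
      have := Q.sub_mem y.2 (h₁ hy'')
      rwa [sub_sub_cancel] at this

lemma relLength_top (P : Submodule R M) : relLength P ⊤ = Module.length R (M ⧸ P) :=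
  (Submodule.Quotient.equiv _ _ Submodule.topEquiv (by
    ext x
    simp [Submodule.submoduleOf])).length_eq

end RelativeLength

section RelativeLengthField

variable {k M : Type*} [Field k] [AddCommGroup M] [Module k M]

open Classical in
lemma relLength_inf_ker (Q : Submodule k M) (f : M →ₗ[k] k) :
    relLength (Q ⊓ LinearMap.ker f) Q = if ∃ x ∈ Q, f x ≠ 0 then 1 else 0 := by
  have h1 : (Q ⊓ LinearMap.ker f).submoduleOf Q = LinearMap.ker (f ∘ₗ Q.subtype) := by
    ext x
    simp [Submodule.submoduleOf]
  rw [relLength, h1]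
  split_ifs with h
  · obtain ⟨x, hx, hfx⟩ := h
    have hs : Function.Surjective (f ∘ₗ Q.subtype) :=
      LinearMap.surjective (fun h ↦ hfx (LinearMap.congr_fun h ⟨x, hx⟩))
    rw [((f ∘ₗ Q.subtype).quotKerEquivOfSurjective hs).length_eq, Module.length_eq_one]
  · push Not at h
    rw [Module.length_eq_zero_iff, Submodule.Quotient.subsingleton_iff, LinearMap.ker_eq_top]
    ext x
    exact h x x.2

end RelativeLengthField

/-! ### The filtration by order on each branch -/

section BranchFiltration

open PowerSeries

variable {k : Type u} [Field k] {r : ℕ}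

/-- The ideal of the elements of `k⟦t₁⟧ × … × k⟦t_r⟧` whose `j`-th component has order at least
`α j`. -/
def powIdeal (k : Type u) [Field k] {r : ℕ} (α : Fin r → ℕ) : Ideal (Fin r → k⟦X⟧) :=
  Ideal.span {fun j ↦ X ^ α j}

lemma mem_powIdeal {α : Fin r → ℕ} {f : Fin r → k⟦X⟧} :
    f ∈ powIdeal k α ↔ ∀ j, X ^ α j ∣ f j := by
  rw [powIdeal, Ideal.mem_span_singleton, pi_dvd_iff]

lemma powIdeal_anti {α β : Fin r → ℕ} (h : α ≤ β) : powIdeal k β ≤ powIdeal k α := by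
  intro f hf
  rw [mem_powIdeal] at *
  exact fun j ↦ (pow_dvd_pow X (h j)).trans (hf j)

@[simp] lemma powIdeal_zero : powIdeal k (0 : Fin r → ℕ) = ⊤ := by
  ext f
  simp [mem_powIdeal]

lemma mul_mem_powIdeal_add {α β : Fin r → ℕ} {f g : Fin r → k⟦X⟧} (hf : f ∈ powIdeal k α)
    (hg : g ∈ powIdeal k β) : f * g ∈ powIdeal k (α + β) := by
  rw [mem_powIdeal] at *
  exact fun j ↦ by simpa [pow_add] using mul_dvd_mul (hf j) (hg j)

/-- The coefficient of `t_j ^ m` in the `j`-th component. -/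
def branchCoeff (k : Type u) [Field k] {r : ℕ} (j : Fin r) (m : ℕ) :
    (Fin r → k⟦X⟧) →ₗ[k] k :=
  coeff m ∘ₗ LinearMap.proj j

@[simp] lemma branchCoeff_apply (j : Fin r) (m : ℕ) (f : Fin r → k⟦X⟧) :
    branchCoeff k j m f = coeff m (f j) := rfl

lemma coeff_add_mul_of_dvd {a b : ℕ} {f g : k⟦X⟧} (hf : X ^ a ∣ f) (hg : X ^ b ∣ g) :
    coeff (a + b) (f * g) = coeff a f * coeff b g := by
  obtain ⟨f, rfl⟩ := hf
  obtain ⟨g, rfl⟩ := hg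
  have : X ^ a * f * (X ^ b * g) = X ^ (a + b) * (f * g) := by ring
  rw [this]
  simp [coeff_X_pow_mul']

lemma X_pow_succ_dvd_iff {a : ℕ} {f : k⟦X⟧} :
    X ^ (a + 1) ∣ f ↔ X ^ a ∣ f ∧ coeff a f = 0 := by
  simp only [X_pow_dvd_iff]
  refine ⟨fun h ↦ ⟨fun m hm ↦ h m (by lia), h a (by lia)⟩, fun h m hm ↦ ?_⟩
  obtain h' | rfl : m < a ∨ m = a := by lia
  exacts [h.1 m h', h.2]

lemma mem_powIdeal_add_single {α : Fin r → ℕ} {j : Fin r} {f : Fin r → k⟦X⟧} :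
    f ∈ powIdeal k (α + Pi.single j 1) ↔ f ∈ powIdeal k α ∧ coeff (α j) (f j) = 0 := by
  simp only [mem_powIdeal]
  constructor
  · intro h
    refine ⟨fun i ↦ (pow_dvd_pow X (by simp)).trans (h i), ?_⟩
    have := h j
    simp only [Pi.add_apply, Pi.single_eq_same] at this
    exact (X_pow_succ_dvd_iff.mp this).2
  · rintro ⟨h, h'⟩ i
    obtain rfl | hij := eq_or_ne i j
    · simpa using X_pow_succ_dvd_iff.mpr ⟨h i, h'⟩
    · simpa [hij] using h i

/-- `powIdeal` as a `k`-subspace. -/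
noncomputable abbrev powSubmodule (k : Type u) [Field k] {r : ℕ} (α : Fin r → ℕ) :
    Submodule k (Fin r → k⟦X⟧) :=
  (powIdeal k α).restrictScalars k

lemma powSubmodule_zero : powSubmodule k (0 : Fin r → ℕ) = ⊤ := by
  simp

lemma inf_powSubmodule_add_single (V : Submodule k (Fin r → k⟦X⟧)) (α : Fin r → ℕ) (j : Fin r) :
    V ⊓ powSubmodule k (α + Pi.single j 1) =
      (V ⊓ powSubmodule k α) ⊓ LinearMap.ker (branchCoeff k j (α j)) := by
  ext f
  simp [mem_powIdeal_add_single, and_assoc]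

open Classical in
-- Raising one exponent by one imposes a single linear condition, so the filtration of `V` jumps by
-- zero or one.
lemma relLength_step (V : Submodule k (Fin r → k⟦X⟧)) (α : Fin r → ℕ) (j : Fin r) :
    relLength (V ⊓ powSubmodule k (α + Pi.single j 1)) (V ⊓ powSubmodule k α) =
      if ∃ f ∈ V ⊓ powSubmodule k α, coeff (α j) (f j) ≠ 0 then 1 else 0 := by
  rw [inf_powSubmodule_add_single, relLength_inf_ker]
  rfl

lemma exists_eq_add_single {α : Fin r → ℕ} (h : α ≠ 0) :
    ∃ (β : Fin r → ℕ) (j : Fin r), α = β + Pi.single j 1 := by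
  obtain ⟨j, hj⟩ := Function.ne_iff.mp h
  refine ⟨α - Pi.single j 1, j, (tsub_add_cancel_of_le ?_).symm⟩
  intro i
  obtain rfl | hij := eq_or_ne i j
  · simpa [Nat.one_le_iff_ne_zero] using hj
  · simp [hij]

lemma sum_add_single (β : Fin r → ℕ) (j : Fin r) :
    ∑ i, (β + Pi.single j 1 : Fin r → ℕ) i = (∑ i, β i) + 1 := by
  simp [Finset.sum_add_distrib]

lemma le_add_single (β : Fin r → ℕ) (j : Fin r) : β ≤ β + Pi.single j 1 :=
  le_self_add

lemma length_quotient_powIdeal (α : Fin r → ℕ) :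
    Module.length k ((Fin r → k⟦X⟧) ⧸ powSubmodule k α) = ∑ i, α i := by
  rw [← relLength_top]
  induction hn : ∑ i, α i generalizing α with
  | zero =>
    obtain rfl : α = 0 := by
      ext i
      simpa using (Finset.sum_eq_zero_iff.mp hn) i (Finset.mem_univ i)
    rw [powSubmodule_zero, relLength_self, Nat.cast_zero]
  | succ n ih =>
    obtain ⟨β, j, rfl⟩ := exists_eq_add_single (α := α) (by rintro rfl; simp at hn)
    rw [sum_add_single, add_left_inj] at hn
    rw [← relLength_add_relLength (Q := powSubmodule k β) (powIdeal_anti (le_add_single β j))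
      le_top, ih β hn]
    have := relLength_step ⊤ β j (k := k)
    rw [top_inf_eq, top_inf_eq, if_pos] at this
    · rw [this, add_comm]
      simp
    · refine ⟨fun i ↦ X ^ β i, ?_, by simp⟩
      exact mem_powIdeal.mpr fun i ↦ dvd_rfl

/-! ### Complementary jumps of the filtration below the conductor -/

section Conductor

variable {V : Subalgebra k (Fin r → k⟦X⟧)} {γ : Fin r → ℕ}
  (hγ : ∀ f ∈ powIdeal k γ, f ∈ V)
  (hmax : ∀ I : Ideal (Fin r → k⟦X⟧), (∀ f ∈ I, f ∈ V) → I ≤ powIdeal k γ)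

include hγ hmax

/-- Otherwise every element of `powIdeal k β` is a multiple of `g` plus an element of the conductor,
so `powIdeal k β` lies in `V`, against maximality. -/
lemma coeff_eq_zero_of_mem_of_conductor {β : Fin r → ℕ} {j : Fin r}
    (h : γ = β + Pi.single j 1) {g : Fin r → k⟦X⟧} (hg : g ∈ V) (hgβ : g ∈ powIdeal k β) :
    coeff (β j) (g j) = 0 := by
  by_contra hne
  have hβ : powIdeal k β ≤ powIdeal k γ := by
    refine hmax _ fun f hf ↦ ?_
    let c := coeff (β j) (f j) / coeff (β j) (g j)
    have : f - c • g ∈ powIdeal k γ := by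
      rw [h, mem_powIdeal_add_single]
      refine ⟨Ideal.sub_mem _ hf (Submodule.smul_of_tower_mem _ _ hgβ), ?_⟩
      simp [c, div_mul_cancel₀ _ hne]
    simpa using V.add_mem (hγ _ this) (V.smul_mem hg c)
  exact hne (mem_powIdeal_add_single.mp (h ▸ hβ hgβ)).2

/-- The product has order at least `γ - e_j`, and its coefficient there on branch `j` is the product
of the two coefficients. -/
lemma not_exists_of_conductor {α δ : Fin r → ℕ} {j : Fin r} (h : γ = α + δ + Pi.single j 1)
    {f g : Fin r → k⟦X⟧} (hfg : f * g ∈ V) (hf : f ∈ powIdeal k α) (hg : g ∈ powIdeal k δ) :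
    coeff (α j) (f j) = 0 ∨ coeff (δ j) (g j) = 0 := by
  have := coeff_eq_zero_of_mem_of_conductor hγ hmax h hfg (mul_mem_powIdeal_add hf hg)
  rw [Pi.mul_apply, Pi.add_apply, coeff_add_mul_of_dvd (mem_powIdeal.mp hf j)
    (mem_powIdeal.mp hg j)] at this
  exact mul_eq_zero.mp this

open Classical in
lemma relLength_step_add_le {α δ : Fin r → ℕ} {j : Fin r} (h : γ = α + δ + Pi.single j 1) :
    relLength (V.toSubmodule ⊓ powSubmodule k (α + Pi.single j 1))
        (V.toSubmodule ⊓ powSubmodule k α) +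
      relLength (V.toSubmodule ⊓ powSubmodule k (δ + Pi.single j 1))
        (V.toSubmodule ⊓ powSubmodule k δ) ≤ 1 := by
  rw [relLength_step, relLength_step]
  split_ifs with h1 h2
  · obtain ⟨f, ⟨hfV, hf⟩, hf0⟩ := h1
    obtain ⟨g, ⟨hgV, hg⟩, hg0⟩ := h2
    obtain h' | h' := not_exists_of_conductor hγ hmax h (V.mul_mem hfV hgV) hf hg
    exacts [absurd h' hf0, absurd h' hg0]
  all_goals simp

/-- Walk from `0` to `α` one coordinate at a time. The step at `β` is paired with the step at the
complementary exponent, and each pair contributes at most one. -/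
lemma relLength_add_relLength_le {α δ : Fin r → ℕ} (h : γ = α + δ) :
    relLength (V.toSubmodule ⊓ powSubmodule k α) V.toSubmodule +
      relLength (V.toSubmodule ⊓ powSubmodule k γ) (V.toSubmodule ⊓ powSubmodule k δ) ≤
        (∑ i, α i : ℕ) := by
  induction hn : ∑ i, α i generalizing α δ with
  | zero =>
    obtain rfl : α = 0 := by
      ext i
      simpa using (Finset.sum_eq_zero_iff.mp hn) i (Finset.mem_univ i)
    rw [h, zero_add, powSubmodule_zero, inf_top_eq, relLength_self, relLength_self, zero_add,
      Nat.cast_zero]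
  | succ n ih =>
    obtain ⟨β, j, rfl⟩ := exists_eq_add_single (α := α) (by rintro rfl; simp at hn)
    rw [sum_add_single, add_left_inj] at hn
    have h1 : γ = β + δ + Pi.single j 1 := by rw [h]; abel
    have h2 := ih (α := β) (δ := δ + Pi.single j 1) (by rw [h1]; abel) hn
    have h3 := relLength_step_add_le hγ hmax h1
    rw [← relLength_add_relLength (Q := V.toSubmodule ⊓ powSubmodule k β)
      (inf_le_inf_left _ (powIdeal_anti (le_add_single β j))) inf_le_left,
      ← relLength_add_relLength (Q := V.toSubmodule ⊓ powSubmodule k (δ + Pi.single j 1))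
      (P := V.toSubmodule ⊓ powSubmodule k γ) (S := V.toSubmodule ⊓ powSubmodule k δ)
      (inf_le_inf_left _ (powIdeal_anti ?_))
      (inf_le_inf_left _ (powIdeal_anti (le_add_single δ j)))]
    · push_cast
      calc _ = _ := by abel
        _ ≤ _ := add_le_add h2 h3
    · rw [h1, add_assoc]
      exact le_add_self

omit hmax in
lemma powSubmodule_le : powSubmodule k γ ≤ V.toSubmodule := hγ

/-- Equality holds in `relLength_add_relLength_le` if the conductor has the
maximal possible colength in `V`. -/
lemma relLength_add_relLength_eq (hV : 2 * relLength (powSubmodule k γ) V.toSubmodule = ∑ i, γ i)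
    {α δ : Fin r → ℕ} (h : γ = α + δ) :
    relLength (V.toSubmodule ⊓ powSubmodule k α) V.toSubmodule +
      relLength (V.toSubmodule ⊓ powSubmodule k γ) (V.toSubmodule ⊓ powSubmodule k δ) =
        (∑ i, α i : ℕ) := by
  -- The inequalities for `(α, δ)` and `(δ, α)` add up to the equality `hV`, so neither is strict.
  have h1 := relLength_add_relLength_le hγ hmax h
  have h2 := relLength_add_relLength_le hγ hmax (h.trans (add_comm α δ))
  have hαγ : V.toSubmodule ⊓ powSubmodule k γ ≤ V.toSubmodule ⊓ powSubmodule k α :=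
    inf_le_inf_left _ (powIdeal_anti (h ▸ le_self_add))
  have hδγ : V.toSubmodule ⊓ powSubmodule k γ ≤ V.toSubmodule ⊓ powSubmodule k δ :=
    inf_le_inf_left _ (powIdeal_anti (h ▸ le_add_self))
  have h3 := relLength_add_relLength hαγ inf_le_left
  have h4 := relLength_add_relLength hδγ inf_le_left
  have hs : ((∑ i, γ i : ℕ) : ℕ∞) = (∑ i, α i : ℕ) + (∑ i, δ i : ℕ) := by
    rw [h]
    simp [Finset.sum_add_distrib]
  rw [hs] at hV
  rw [inf_eq_right.mpr (powSubmodule_le hγ)] at *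
  generalize relLength (V.toSubmodule ⊓ powSubmodule k α) V.toSubmodule = a at *
  generalize relLength (V.toSubmodule ⊓ powSubmodule k δ) V.toSubmodule = b at *
  generalize relLength (powSubmodule k γ) (V.toSubmodule ⊓ powSubmodule k δ) = c at *
  generalize relLength (powSubmodule k γ) (V.toSubmodule ⊓ powSubmodule k α) = d at *
  generalize ∑ i, α i = m at *
  generalize ∑ i, δ i = n at *
  rw [two_mul] at hV
  nth_rw 1 [← h3] at hV
  rw [← h4] at hV
  have ha : a ≠ ⊤ := by rintro rfl; simp at h1
  have hb : b ≠ ⊤ := by rintro rfl; simp at h2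
  have hc : c ≠ ⊤ := by rintro rfl; simp at h1
  have hd : d ≠ ⊤ := by rintro rfl; simp at h2
  lift a to ℕ using ha
  lift b to ℕ using hb
  lift c to ℕ using hc
  lift d to ℕ using hd
  norm_cast at *
  lia

open Classical in
-- Without a jump at either place, the equalities for `(α, δ + e_j)` and `(α + e_j, δ)` have the
-- same left side, but right sides differing by one.
lemma exists_of_symmetric (hV : 2 * relLength (powSubmodule k γ) V.toSubmodule = ∑ i, γ i)
    {α δ : Fin r → ℕ} {j : Fin r} (h : γ = α + δ + Pi.single j 1) :
    (∃ f ∈ V, f ∈ powIdeal k α ∧ coeff (α j) (f j) ≠ 0) ∨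
      ∃ f ∈ V, f ∈ powIdeal k δ ∧ coeff (δ j) (f j) ≠ 0 := by
  by_contra! hcon
  have h1 := relLength_add_relLength_eq hγ hmax hV (α := α) (δ := δ + Pi.single j 1)
    (by rw [h]; abel)
  have h2 := relLength_add_relLength_eq hγ hmax hV (α := α + Pi.single j 1) (δ := δ)
    (by rw [h]; abel)
  rw [← relLength_add_relLength (Q := V.toSubmodule ⊓ powSubmodule k α)
      (inf_le_inf_left _ (powIdeal_anti (le_add_single α j))) inf_le_left,
      ← relLength_add_relLength (Q := V.toSubmodule ⊓ powSubmodule k (δ + Pi.single j 1))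
      (P := V.toSubmodule ⊓ powSubmodule k γ) (S := V.toSubmodule ⊓ powSubmodule k δ)
      (inf_le_inf_left _ (powIdeal_anti ?_))
      (inf_le_inf_left _ (powIdeal_anti (le_add_single δ j))),
      relLength_step, relLength_step, if_neg, if_neg, zero_add, add_zero, h1, sum_add_single] at h2
  · norm_cast at h2
    lia
  · rintro ⟨f, ⟨hfV, hf⟩, hf0⟩
    exact hf0 (hcon.2 f hfV hf)
  · rintro ⟨f, ⟨hfV, hf⟩, hf0⟩
    exact hf0 (hcon.1 f hfV hf)
  · rw [h, add_assoc]
    exact le_add_self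

/-- In the symmetric case the elements `y` with `𝔪 y ⊆ V` lie in `V + t^(γ - e_j)`. -/
lemma exists_sub_mem_powIdeal_of_symmetric
    (hV : 2 * relLength (powSubmodule k γ) V.toSubmodule = ∑ i, γ i)
    (hres : ∀ f ∈ V, ∀ i j, constantCoeff (f i) = constantCoeff (f j))
    {ε : Fin r → ℕ} {j : Fin r} (hε : γ = ε + Pi.single j 1) {y : Fin r → k⟦X⟧}
    (hy : ∀ f ∈ V, (∀ i, constantCoeff (f i) = 0) → f * y ∈ V) :
    ∃ v ∈ V, y - v ∈ powIdeal k ε := by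
  -- The order of `y - v` is raised one coordinate at a time until it reaches `ε`.
  suffices H : ∀ n ≤ ∑ i, ε i, ∃ α ≤ ε, ∑ i, α i = n ∧ ∃ v ∈ V, y - v ∈ powIdeal k α by
    obtain ⟨α, hα, hs, v, hv, hyv⟩ := H _ le_rfl
    have : α = ε := by
      by_contra hne
      exact (Finset.sum_lt_sum (fun i _ ↦ hα i)
        (by obtain ⟨i, hi⟩ := Function.ne_iff.mp hne
            exact ⟨i, Finset.mem_univ i, lt_of_le_of_ne (hα i) hi⟩)).ne hs
    exact ⟨v, hv, this ▸ hyv⟩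
  intro n
  induction n with
  | zero => exact fun _ ↦ ⟨0, zero_le, by simp, 0, V.zero_mem, by simp⟩
  | succ n ih =>
    intro hn
    obtain ⟨α, hα, hs, v, hv, hyv⟩ := ih (by lia)
    obtain ⟨δ', hδ'⟩ := exists_add_of_le hα
    obtain ⟨δ, i, rfl⟩ := exists_eq_add_single (α := δ') (by
      rintro rfl
      rw [hδ', add_zero, hs] at hn
      lia)
    refine ⟨α + Pi.single i 1, ?_, by rw [sum_add_single, hs], ?_⟩
    · rw [hδ', add_comm δ, ← add_assoc]
      exact le_self_add
    by_cases h0 : coeff (α i) ((y - v) i) = 0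
    · exact ⟨v, hv, mem_powIdeal_add_single.mpr ⟨hyv, h0⟩⟩
    have hγα : γ = α + (δ + Pi.single j 1) + Pi.single i 1 := by rw [hε, hδ']; abel
    -- Either `V` has an element that cancels the offending coefficient, or it has one at the
    -- complementary exponent; multiplying `y - v` by the latter contradicts the maximality of the
    -- conductor.
    obtain ⟨f, hfV, hf, hf0⟩ | ⟨f, hfV, hf, hf0⟩ := exists_of_symmetric hγ hmax hV hγα
    · set c := coeff (α i) ((y - v) i) / coeff (α i) (f i)
      refine ⟨v + c • f, V.add_mem hv (V.smul_mem hfV c), ?_⟩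
      rw [← sub_sub, mem_powIdeal_add_single]
      refine ⟨Ideal.sub_mem _ hyv (Submodule.smul_of_tower_mem _ _ hf), ?_⟩
      rw [Pi.sub_apply (y - v), map_sub, Pi.smul_apply, coeff_smul, smul_eq_mul,
        div_mul_cancel₀ _ hf0, sub_self]
    · exfalso
      -- The complementary exponent `δ + e_j` is positive at `j`, so `f` has no constant term on
      -- branch `j`, hence on no branch.
      have hfc (l) : constantCoeff (f l) = 0 := by
        rw [hres f hfV l j, ← X_dvd_iff]
        refine (dvd_pow_self X ?_).trans (mem_powIdeal.mp hf j)
        simp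
      have : (y - v) * f ∈ V := by
        rw [sub_mul, mul_comm y]
        exact V.sub_mem (hy f hfV hfc) (V.mul_mem hv hfV)
      obtain h' | h' := not_exists_of_conductor hγ hmax hγα this hyv hf
      exacts [h0 h', hf0 h']

end Conductor

end BranchFiltration

/-! ### Ideals of a product of power series rings -/

section PowIdeal

open PowerSeries

variable {k : Type u} [Field k] {r : ℕ}

lemma single_mem_powIdeal {α : Fin r → ℕ} {j : Fin r} {f : k⟦X⟧} (h : X ^ α j ∣ f) :
    Pi.single j f ∈ powIdeal k α := by
  rw [mem_powIdeal]
  intro i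
  obtain rfl | hij := eq_or_ne i j
  · simpa using h
  · simp [hij]

lemma exists_X_pow_mul_unit {f : k⟦X⟧} (hf : f ≠ 0) :
    ∃ (m : ℕ) (u : k⟦X⟧ˣ), f * (u : k⟦X⟧) = X ^ m :=
  IsDiscreteValuationRing.associated_pow_irreducible hf X_irreducible

open Classical in
-- Ideals of a finite product are products of ideals, and the nonzero ideals of `k⟦X⟧` are the
-- powers of `X`; `h` rules out zero factors.
lemma exists_eq_powIdeal (I : Ideal (Fin r → k⟦X⟧)) {β : Fin r → ℕ} (h : powIdeal k β ≤ I) :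
    ∃ γ, I = powIdeal k γ := by
  have hex (j : Fin r) : ∃ m, (Pi.single j (X ^ m) : Fin r → k⟦X⟧) ∈ I :=
    ⟨β j, h (single_mem_powIdeal dvd_rfl)⟩
  refine ⟨fun j ↦ Nat.find (hex j), le_antisymm (fun f hf ↦ ?_) fun f hf ↦ ?_⟩
  · rw [mem_powIdeal]
    intro j
    obtain h0 | h0 := eq_or_ne (f j) 0
    · simp [h0]
    obtain ⟨m, u, hu⟩ := exists_X_pow_mul_unit h0
    have : (Pi.single j (X ^ m) : Fin r → k⟦X⟧) ∈ I := by
      have := I.mul_mem_left (Pi.single j (u : k⟦X⟧)) hf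
      rwa [← Pi.single_mul_left, mul_comm, hu] at this
    rw [← u.isUnit.dvd_mul_right, hu]
    exact pow_dvd_pow _ (Nat.find_min' _ this)
  · rw [← Finset.univ_sum_single f]
    refine I.sum_mem fun j _ ↦ ?_
    obtain ⟨g, hg⟩ := mem_powIdeal.mp hf j
    rw [hg, Pi.single_mul]
    exact I.mul_mem_right _ (Nat.find_spec (hex j))

end PowIdeal

/-! ### Curve orders, their conductor, and the inequalities between `δ` and `c` -/

section CurveOrder

open PowerSeries

variable (k : Type u) [Field k] (r : ℕ) (A : Type u) [CommRing A] [Algebra k A]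
  [Algebra A (Fin r → k⟦X⟧)] [IsScalarTower k A (Fin r → k⟦X⟧)]

/-- `A` is a subalgebra of `k⟦t₁⟧ × … × k⟦t_r⟧` containing all elements of sufficiently high order,
and whose elements have the same constant term on all branches. -/
structure IsCurveOrder : Prop where
  pos : 0 < r
  injective : Function.Injective (algebraMap A (Fin r → k⟦X⟧))
  constantCoeff_eq : ∀ (a : A) (i j : Fin r), constantCoeff (algebraMap A (Fin r → k⟦X⟧) a i) =
    constantCoeff (algebraMap A (Fin r → k⟦X⟧) a j)
  exists_powIdeal_le : ∃ N : ℕ, ∀ f ∈ powIdeal k (fun _ : Fin r ↦ N),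
    f ∈ (algebraMap A (Fin r → k⟦X⟧)).range

/-- The image of `A` in `k⟦t₁⟧ × … × k⟦t_r⟧`. -/
abbrev branchImage : Subalgebra k (Fin r → k⟦X⟧) :=
  (IsScalarTower.toAlgHom k A (Fin r → k⟦X⟧)).range

/-- The largest ideal of `k⟦t₁⟧ × … × k⟦t_r⟧` contained in the image of `A`. -/
def branchConductor : Ideal (Fin r → k⟦X⟧) where
  carrier := {f | ∀ g, f * g ∈ branchImage k r A}
  add_mem' hf hg h := by
    rw [add_mul]
    exact add_mem (hf h) (hg h)
  zero_mem' h := by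
    rw [zero_mul]
    exact zero_mem _
  smul_mem' c f hf g := by
    rw [smul_eq_mul, mul_assoc, mul_left_comm]
    exact hf (c * g)

variable {k r A}

lemma mem_branchConductor {f : Fin r → k⟦X⟧} :
    f ∈ branchConductor k r A ↔ ∀ g, f * g ∈ branchImage k r A := Iff.rfl

lemma mem_branchImage {f : Fin r → k⟦X⟧} :
    f ∈ branchImage k r A ↔ ∃ a, algebraMap A (Fin r → k⟦X⟧) a = f := Iff.rfl

lemma le_branchConductor {I : Ideal (Fin r → k⟦X⟧)} (h : ∀ f ∈ I, f ∈ branchImage k r A) :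
    I ≤ branchConductor k r A :=
  fun _ hf g ↦ h _ (I.mul_mem_right g hf)

lemma mem_branchImage_of_mem_branchConductor {f : Fin r → k⟦X⟧}
    (hf : f ∈ branchConductor k r A) : f ∈ branchImage k r A := by
  simpa using hf 1

omit [Algebra k A] [IsScalarTower k A (Fin r → k⟦X⟧)] in
lemma mem_imageIn {f : Fin r → k⟦X⟧} :
    f ∈ imageIn A (Fin r → k⟦X⟧) ↔ ∃ a, algebraMap A (Fin r → k⟦X⟧) a = f := Iff.rfl

lemma mem_imageIn_iff_mem_branchImage {f : Fin r → k⟦X⟧} :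
    f ∈ imageIn A (Fin r → k⟦X⟧) ↔ f ∈ branchImage k r A := by
  rw [mem_imageIn, mem_branchImage]

variable (k) in
lemma mem_conductorIdeal {a : A} :
    a ∈ conductorIdeal A (Fin r → k⟦X⟧) ↔
      algebraMap A (Fin r → k⟦X⟧) a ∈ branchConductor k r A := by
  rw [conductorIdeal, Module.mem_annihilator, mem_branchConductor,
    (Submodule.mkQ_surjective _).forall]
  refine forall_congr' fun g ↦ ?_
  rw [← mem_imageIn_iff_mem_branchImage, ← Algebra.smul_def, ← map_smul, Submodule.mkQ_apply,
    Submodule.Quotient.mk_eq_zero]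

lemma map_conductorIdeal_restrictScalars :
    (Submodule.map (Algebra.linearMap A (Fin r → k⟦X⟧))
      (conductorIdeal A (Fin r → k⟦X⟧))).restrictScalars k =
        (branchConductor k r A).restrictScalars k := by
  ext f
  simp only [Submodule.restrictScalars_mem, Submodule.mem_map]
  constructor
  · rintro ⟨a, ha, rfl⟩
    exact (mem_conductorIdeal k).mp ha
  · intro hf
    obtain ⟨a, rfl⟩ := mem_branchImage_of_mem_branchConductor hf
    exact ⟨a, (mem_conductorIdeal k).mpr hf, rfl⟩

lemma imageIn_restrictScalars :
    (imageIn A (Fin r → k⟦X⟧)).restrictScalars k = (branchImage k r A).toSubmodule := by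
  ext f
  exact mem_imageIn_iff_mem_branchImage

lemma dimENat_eq_length (V : Type v) [AddCommGroup V] [Module k V] :
    dimENat k V = Module.length k V := by
  rw [Module.length_eq_rank]
  rfl

variable (k r A) in
lemma deltaOf_eq_relLength :
    deltaOf k A (Fin r → k⟦X⟧) = relLength (branchImage k r A).toSubmodule ⊤ := by
  rw [deltaOf, dimENat_eq_length, relLength_top, ← imageIn_restrictScalars]
  exact (Submodule.Quotient.restrictScalarsEquiv k _).symm.length_eq

variable (k r A) in
lemma conductorOf_eq_length :
    conductorOf k A (Fin r → k⟦X⟧) =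
      Module.length k ((Fin r → k⟦X⟧) ⧸ (branchConductor k r A).restrictScalars k) := by
  rw [conductorOf, dimENat_eq_length, ← map_conductorIdeal_restrictScalars]
  exact (Submodule.Quotient.restrictScalarsEquiv k _).symm.length_eq

namespace IsCurveOrder

variable (hA : IsCurveOrder k r A)
include hA

lemma exists_branchConductor_eq : ∃ γ, branchConductor k r A = powIdeal k γ := by
  obtain ⟨N, hN⟩ := hA.exists_powIdeal_le
  exact exists_eq_powIdeal (β := fun _ ↦ N) _ (le_branchConductor hN)

omit hA in
lemma restrictScalars_branchConductor_le :
    (branchConductor k r A).restrictScalars k ≤ (branchImage k r A).toSubmodule :=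
  fun _ hf ↦ mem_branchImage_of_mem_branchConductor hf

omit hA in
lemma conductorOf_eq_add :
    conductorOf k A (Fin r → k⟦X⟧) =
      relLength ((branchConductor k r A).restrictScalars k) (branchImage k r A).toSubmodule +
        deltaOf k A (Fin r → k⟦X⟧) := by
  rw [deltaOf_eq_relLength, conductorOf_eq_length, ← relLength_top,
    ← relLength_add_relLength restrictScalars_branchConductor_le le_top]

omit hA in
lemma deltaOf_le_conductorOf :
    deltaOf k A (Fin r → k⟦X⟧) ≤ conductorOf k A (Fin r → k⟦X⟧) := by
  rw [conductorOf_eq_add]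
  exact le_add_self

lemma conductorOf_ne_top : conductorOf k A (Fin r → k⟦X⟧) ≠ ⊤ := by
  obtain ⟨γ, hγ⟩ := hA.exists_branchConductor_eq
  rw [conductorOf_eq_length, hγ, length_quotient_powIdeal]
  exact_mod_cast ENat.natCast_ne_top _

/-- The path inequality with `α = γ` and `δ = 0`. -/
lemma two_mul_relLength_le :
    2 * relLength ((branchConductor k r A).restrictScalars k) (branchImage k r A).toSubmodule ≤
      conductorOf k A (Fin r → k⟦X⟧) := by
  obtain ⟨γ, hγ⟩ := hA.exists_branchConductor_eq
  have h1 : ∀ f ∈ powIdeal k γ, f ∈ branchImage k r A := fun f hf ↦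
    mem_branchImage_of_mem_branchConductor (hγ ▸ hf)
  have := relLength_add_relLength_le (V := branchImage k r A) h1
    (fun I hI ↦ hγ ▸ le_branchConductor hI) (add_zero γ).symm
  rw [powSubmodule_zero, inf_top_eq, inf_eq_right.mpr (powSubmodule_le h1)] at this
  rwa [conductorOf_eq_length, hγ, length_quotient_powIdeal, two_mul]

lemma conductorOf_le_two_mul_deltaOf :
    conductorOf k A (Fin r → k⟦X⟧) ≤ 2 * deltaOf k A (Fin r → k⟦X⟧) := by
  have h1 := conductorOf_eq_add (k := k) (r := r) (A := A)
  have h2 := hA.two_mul_relLength_le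
  have h3 := hA.conductorOf_ne_top
  generalize conductorOf k A (Fin r → k⟦X⟧) = c at *
  generalize deltaOf k A (Fin r → k⟦X⟧) = d at *
  generalize relLength ((branchConductor k r A).restrictScalars k) _ = e at *
  have he : e ≠ ⊤ := by rintro rfl; simp [h1] at h3
  rw [h1, two_mul] at h2
  rw [h1, two_mul]
  exact add_le_add_left ((ENat.add_le_add_iff_left he).mp h2) d

lemma conductorOf_eq_two_mul_deltaOf_iff :
    conductorOf k A (Fin r → k⟦X⟧) = 2 * deltaOf k A (Fin r → k⟦X⟧) ↔
      relLength ((branchConductor k r A).restrictScalars k) (branchImage k r A).toSubmodule =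
        deltaOf k A (Fin r → k⟦X⟧) := by
  have h1 := conductorOf_eq_add (k := k) (r := r) (A := A)
  have h3 := hA.conductorOf_ne_top
  generalize conductorOf k A (Fin r → k⟦X⟧) = c at *
  generalize deltaOf k A (Fin r → k⟦X⟧) = d at *
  generalize relLength ((branchConductor k r A).restrictScalars k) _ = e at *
  have hd : d ≠ ⊤ := by rintro rfl; simp [h1] at h3
  rw [h1, two_mul]
  exact (ENat.add_left_injective_of_ne_top hd).eq_iff

end IsCurveOrder

end CurveOrder

/-! ### The total quotient ring as a product of Laurent series fields -/

section TotalLaurent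

open PowerSeries

/-- The total quotient ring `k((t₁)) × … × k((t_r))` of `k⟦t₁⟧ × … × k⟦t_r⟧`. -/
def TotalLaurent (k : Type u) [Field k] (r : ℕ) : Type u := Fin r → LaurentSeries k

namespace TotalLaurent

variable {k : Type u} [Field k] {r : ℕ}

instance : CommRing (TotalLaurent k r) := inferInstanceAs (CommRing (Fin r → LaurentSeries k))

variable (k r) in
/-- The inclusion of `k⟦t₁⟧ × … × k⟦t_r⟧` into its total quotient ring. -/
def ofPowerSeries : (Fin r → k⟦X⟧) →+* TotalLaurent k r :=
  RingHom.pi fun j ↦ (algebraMap k⟦X⟧ (LaurentSeries k)).comp (Pi.evalRingHom _ j)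

lemma ofPowerSeries_apply (f : Fin r → k⟦X⟧) (j : Fin r) :
    ofPowerSeries k r f j = algebraMap k⟦X⟧ (LaurentSeries k) (f j) := rfl

lemma ofPowerSeries_injective : Function.Injective (ofPowerSeries k r) := by
  intro f g h
  ext1 j
  exact IsFractionRing.injective k⟦X⟧ (LaurentSeries k) (congrFun h j)

lemma isUnit_ofPowerSeries_iff {f : Fin r → k⟦X⟧} :
    IsUnit (ofPowerSeries k r f) ↔ ∀ j, f j ≠ 0 := by
  refine Pi.isUnit_iff.trans (forall_congr' fun j ↦ ?_)
  rw [isUnit_iff_ne_zero, ofPowerSeries_apply, Ne,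
    map_eq_zero_iff _ (IsFractionRing.injective k⟦X⟧ (LaurentSeries k))]

/-- The element `(t₁ ^ N, …, t_r ^ N)`. -/
def XPow (k : Type u) [Field k] (r N : ℕ) : Fin r → k⟦X⟧ := fun _ ↦ X ^ N

lemma XPow_add (M N : ℕ) : XPow k r (M + N) = XPow k r M * XPow k r N := by
  ext1 j
  simp [XPow, pow_add]

lemma isUnit_XPow (N : ℕ) : IsUnit (ofPowerSeries k r (XPow k r N)) :=
  isUnit_ofPowerSeries_iff.mpr fun _ ↦ pow_ne_zero _ X_ne_zero

lemma mem_powIdeal_const {N : ℕ} {f : Fin r → k⟦X⟧} :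
    f ∈ powIdeal k (fun _ ↦ N) ↔ ∃ g, f = XPow k r N * g := by
  rw [powIdeal, Ideal.mem_span_singleton]
  rfl

lemma exists_X_pow_mul_laurentSeries (y : LaurentSeries k) : ∃ (n : ℕ) (f : k⟦X⟧),
    algebraMap k⟦X⟧ (LaurentSeries k) (X ^ n) * y = algebraMap k⟦X⟧ (LaurentSeries k) f := by
  obtain ⟨⟨f, ⟨_, ⟨n, rfl⟩⟩⟩, h⟩ := IsLocalization.surj (Submonoid.powers (X : k⟦X⟧)) y
  exact ⟨n, f, by rw [mul_comm]; exact h⟩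

lemma exists_XPow_mul (y : TotalLaurent k r) :
    ∃ (N : ℕ) (f : Fin r → k⟦X⟧), ofPowerSeries k r (XPow k r N) * y = ofPowerSeries k r f := by
  choose n f hf using fun j ↦ exists_X_pow_mul_laurentSeries (y j)
  obtain ⟨N, hN⟩ : ∃ N, ∀ j, n j ≤ N :=
    ⟨∑ j, n j, fun j ↦ Finset.single_le_sum (fun _ _ ↦ Nat.zero_le _) (Finset.mem_univ j)⟩
  choose m hm using fun j ↦ Nat.exists_eq_add_of_le' (hN j)
  refine ⟨N, fun j ↦ X ^ m j * f j, funext fun j ↦ ?_⟩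
  have h : algebraMap k⟦X⟧ (LaurentSeries k) (X ^ N) * y j =
      algebraMap k⟦X⟧ (LaurentSeries k) (X ^ m j * f j) := by
    rw [hm j, pow_add, map_mul, mul_assoc, hf, ← map_mul]
  exact h

variable {A : Type v} [CommRing A] [Algebra A (Fin r → k⟦X⟧)]

instance : Algebra A (TotalLaurent k r) :=
  ((ofPowerSeries k r).comp (algebraMap A (Fin r → k⟦X⟧))).toAlgebra

lemma algebraMap_eq_ofPowerSeries (a : A) : algebraMap A (TotalLaurent k r) a =
    ofPowerSeries k r (algebraMap A (Fin r → k⟦X⟧) a) := rfl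

lemma smul_def (a : A) (y : TotalLaurent k r) :
    a • y = ofPowerSeries k r (algebraMap A (Fin r → k⟦X⟧) a) * y := Algebra.smul_def a y

instance [Algebra k A] [IsScalarTower k A (Fin r → k⟦X⟧)] :
    IsScalarTower k A (TotalLaurent k r) :=
  IsScalarTower.of_algebraMap_eq fun c ↦ by
    rw [algebraMap_eq_ofPowerSeries, algebraMap_eq_ofPowerSeries,
      ← IsScalarTower.algebraMap_apply k A (Fin r → k⟦X⟧)]

lemma ofPowerSeries_smul [Algebra k A] [IsScalarTower k A (Fin r → k⟦X⟧)] (a : A)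
    (f : Fin r → k⟦X⟧) : ofPowerSeries k r (a • f) = a • ofPowerSeries k r f := by
  rw [smul_def, Algebra.smul_def, map_mul]

end TotalLaurent

end TotalLaurent

/-! ### Injectivity of the total quotient ring and finiteness over a curve order -/

namespace IsCurveOrder

open PowerSeries TotalLaurent

variable {k : Type u} [Field k] {r : ℕ} {A : Type u} [CommRing A] [Algebra k A]
  [Algebra A (Fin r → k⟦X⟧)] [IsScalarTower k A (Fin r → k⟦X⟧)]

lemma mem_imageIn_totalLaurent {y : TotalLaurent k r} :
    y ∈ imageIn A (TotalLaurent k r) ↔ ∃ f ∈ branchImage k r A, ofPowerSeries k r f = y := by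
  constructor
  · rintro ⟨a, rfl⟩
    exact ⟨_, ⟨a, rfl⟩, rfl⟩
  · rintro ⟨_, ⟨a, rfl⟩, rfl⟩
    exact ⟨a, rfl⟩

lemma ofPowerSeries_mem_imageIn {f : Fin r → k⟦X⟧} :
    ofPowerSeries k r f ∈ imageIn A (TotalLaurent k r) ↔ f ∈ branchImage k r A := by
  rw [mem_imageIn_totalLaurent]
  exact ⟨fun ⟨g, hg, h⟩ ↦ ofPowerSeries_injective h ▸ hg, fun h ↦ ⟨f, h, rfl⟩⟩

variable (hA : IsCurveOrder k r A)
include hA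

lemma algebraMap_totalLaurent_injective :
    Function.Injective (algebraMap A (TotalLaurent k r)) :=
  ofPowerSeries_injective.comp hA.injective

/-- Elements of `A` supported on a single branch. -/
lemma exists_eq_single : ∃ N : ℕ, ∀ (j : Fin r) (f : k⟦X⟧),
    ∃ a : A, algebraMap A (Fin r → k⟦X⟧) a = Pi.single j (X ^ N * f) := by
  obtain ⟨N, hN⟩ := hA.exists_powIdeal_le
  exact ⟨N, fun j f ↦ hN _ (single_mem_powIdeal (dvd_mul_right _ _))⟩

/-- Linearity makes the ratio of `f a` to `a` on a branch independent of `a`, so `f` is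
multiplication by an element of `L`. -/
lemma baer_totalLaurent : Module.Baer A (TotalLaurent k r) := by
  classical
  obtain ⟨N, hN⟩ := hA.exists_eq_single
  let ι : A → Fin r → LaurentSeries k := fun a ↦ ofPowerSeries k r (algebraMap A _ a)
  intro I f
  have hf (a b : A) (ha : a ∈ I) (hb : b ∈ I) (j : Fin r) :
      ι a j * f ⟨b, hb⟩ j = ι b j * f ⟨a, ha⟩ j := by
    have h1 : a • f ⟨b, hb⟩ = b • f ⟨a, ha⟩ := by
      rw [← map_smul, ← map_smul]
      congr 1
      ext
      simp [mul_comm]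
    exact congrFun h1 j
  have hsupp (j : Fin r) (h : ∀ a ∈ I, ι a j = 0) (b : A) (hb : b ∈ I) : f ⟨b, hb⟩ j = 0 := by
    -- If `I` vanishes on branch `j`, an element `c` supported there kills `I`; it therefore kills
    -- the values of `f`, whose `j`-th component must be zero.
    obtain ⟨c, hc⟩ := hN j 1
    have hcb : c * b = 0 := by
      refine hA.algebraMap_totalLaurent_injective ?_
      refine funext fun i ↦ ?_
      rw [map_zero, map_mul]
      change ι c i * ι b i = 0
      obtain rfl | hij := eq_or_ne i j
      · rw [h b hb, mul_zero]
      · simp [ι, ofPowerSeries_apply, hc, hij]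
    have h1 : c • f ⟨b, hb⟩ = 0 := by
      rw [← map_smul]
      have : c • (⟨b, hb⟩ : I) = 0 := Subtype.ext hcb
      rw [this, map_zero]
    have h2 : ι c j * f ⟨b, hb⟩ j = 0 := congrFun h1 j
    refine (mul_eq_zero.mp h2).resolve_left ?_
    change algebraMap k⟦X⟧ (LaurentSeries k) (algebraMap A (Fin r → k⟦X⟧) c j) ≠ 0
    rw [Ne, map_eq_zero_iff _ (IsFractionRing.injective k⟦X⟧ (LaurentSeries k)), hc]
    simp [X_ne_zero]
  have hg (j : Fin r) : ∃ g : LaurentSeries k, ∀ a (ha : a ∈ I), f ⟨a, ha⟩ j = ι a j * g := by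
    by_cases h : ∀ a ∈ I, ι a j = 0
    · exact ⟨0, fun a ha ↦ by rw [hsupp j h a ha, mul_zero]⟩
    · push Not at h
      obtain ⟨b, hb, hb0⟩ := h
      refine ⟨f ⟨b, hb⟩ j / ι b j, fun a ha ↦ ?_⟩
      rw [← mul_div_assoc, hf a b ha hb j, mul_div_cancel_left₀ _ hb0]
  choose g hg using hg
  refine ⟨LinearMap.toSpanSingleton A (TotalLaurent k r) g, fun a ha ↦ ?_⟩
  refine funext fun j ↦ ?_
  exact (hg j a ha).symm

lemma exists_smul_mem_imageIn (y : TotalLaurent k r) :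
    ∃ x : A, IsUnit (algebraMap A (TotalLaurent k r) x) ∧ x • y ∈ imageIn A (TotalLaurent k r) := by
  obtain ⟨N, hN⟩ := hA.exists_powIdeal_le
  obtain ⟨M, f, hf⟩ := exists_XPow_mul y
  obtain ⟨x, hx⟩ := hN (XPow k r (N + M)) (mem_powIdeal_const.mpr ⟨_, XPow_add N M⟩)
  refine ⟨x, by rw [algebraMap_eq_ofPowerSeries, hx]; exact isUnit_XPow _, ?_⟩
  rw [smul_def, hx, XPow_add, map_mul, mul_assoc, hf, ← map_mul, ofPowerSeries_mem_imageIn]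
  exact hN _ (mem_powIdeal_const.mpr ⟨_, rfl⟩)

/-- `J` consists of the elements vanishing on every branch where `I` does not vanish identically. -/
lemma exists_disjoint_ideal (I : Ideal A) : ∃ J : Ideal A, Disjoint I J ∧
    ∃ x ∈ I ⊔ J, IsUnit (algebraMap A (TotalLaurent k r) x) := by
  classical
  obtain ⟨N, hN⟩ := hA.exists_eq_single
  let S : Set (Fin r) := {j | ∃ y ∈ I, algebraMap A (Fin r → k⟦X⟧) y j ≠ 0}
  let J : Ideal A :=
    { carrier := {a | ∀ j ∈ S, algebraMap A (Fin r → k⟦X⟧) a j = 0}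
      add_mem' := fun ha hb j hj ↦ by simp [ha j hj, hb j hj]
      zero_mem' := fun j _ ↦ by simp
      smul_mem' := fun c a ha j hj ↦ by simp [ha j hj] }
  refine ⟨J, disjoint_iff.mpr (eq_bot_iff.mpr fun a ha ↦ ?_), ?_⟩
  · refine hA.injective (funext fun j ↦ ?_)
    by_contra hne
    rw [map_zero] at hne
    exact hne (ha.2 j ⟨a, ha.1, hne⟩)
  · have h (j : Fin r) : ∃ z ∈ I ⊔ J, ∃ f : k⟦X⟧, f ≠ 0 ∧
        algebraMap A (Fin r → k⟦X⟧) z = Pi.single j f := by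
      obtain ⟨c, hc⟩ := hN j 1
      rw [mul_one] at hc
      by_cases hj : j ∈ S
      · obtain ⟨y, hy, hyj⟩ := hj
        refine ⟨c * y, Ideal.mem_sup_left (I.mul_mem_left c hy),
          X ^ N * algebraMap A (Fin r → k⟦X⟧) y j, mul_ne_zero (pow_ne_zero _ X_ne_zero) hyj, ?_⟩
        rw [map_mul, hc, Pi.single_mul_left]
      · refine ⟨c, Ideal.mem_sup_right fun i hi ↦ ?_, X ^ N, pow_ne_zero _ X_ne_zero, hc⟩
        rw [hc, Pi.single_eq_of_ne]
        rintro rfl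
        exact hj hi
    choose z hz f hf hzf using h
    refine ⟨∑ j, z j, Ideal.sum_mem _ fun j _ ↦ hz j, ?_⟩
    rw [algebraMap_eq_ofPowerSeries, isUnit_ofPowerSeries_iff]
    intro j
    simp only [map_sum, hzf]
    rw [Finset.univ_sum_single f]
    exact hf j

/-- Passing from `A` to `k` multiplies lengths by a nonzero factor. -/
lemma isFiniteLength_of_length_ne_top [IsLocalRing A] {M : Type u} [AddCommGroup M] [Module k M]
    [Module A M] [IsScalarTower k A M] (h : Module.length k M ≠ ⊤) : IsFiniteLength A M := by
  rw [← Module.length_ne_top_iff]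
  intro htop
  rw [IsLocalRing.length_restrictScalars k A M, htop, ENat.top_mul] at h
  · exact h rfl
  · rw [Ne, Module.length_eq_zero_iff]
    exact not_subsingleton _

/-- If `x` has orders `n`, then `xA` contains `x` times the conductor, hence all elements of `A` of
order at least `n + γ`. -/
lemma isFiniteLength_quotient_lsmul [IsLocalRing A] {x : A}
    (hx : IsUnit (algebraMap A (TotalLaurent k r) x)) :
    IsFiniteLength A (A ⧸ LinearMap.range (LinearMap.lsmul A A x)) := by
  obtain ⟨γ, hγ⟩ := hA.exists_branchConductor_eq
  rw [algebraMap_eq_ofPowerSeries, isUnit_ofPowerSeries_iff] at hx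
  set I : Ideal (Fin r → k⟦X⟧) :=
    Ideal.span {algebraMap A (Fin r → k⟦X⟧) x} * branchConductor k r A
  choose n u hu using fun j ↦ exists_X_pow_mul_unit (hx j)
  have hI : powIdeal k (n + γ) ≤ I := by
    intro f hf
    rw [Ideal.mem_span_singleton_mul]
    choose g hg using mem_powIdeal.mp hf
    refine ⟨fun j ↦ (u j : k⟦X⟧) * (X ^ γ j * g j), ?_, ?_⟩
    · rw [hγ, mem_powIdeal]
      exact fun j ↦ (dvd_mul_right _ _).mul_left _
    · ext1 j
      rw [Pi.mul_apply, ← mul_assoc, hu, hg, Pi.add_apply, pow_add, mul_assoc]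
  let f : A →ₗ[k] ((Fin r → k⟦X⟧) ⧸ powSubmodule k (n + γ)) :=
    (Submodule.mkQ _) ∘ₗ (IsScalarTower.toAlgHom k A (Fin r → k⟦X⟧)).toLinearMap
  have hf (a : A) (ha : f a = 0) : a ∈ LinearMap.range (LinearMap.lsmul A A x) := by
    have : algebraMap A (Fin r → k⟦X⟧) a ∈ powIdeal k (n + γ) := by
      simpa [f, Submodule.Quotient.mk_eq_zero] using ha
    obtain ⟨z, hz, hxz⟩ := Ideal.mem_span_singleton_mul.mp (hI this)
    obtain ⟨b, rfl⟩ := mem_branchImage_of_mem_branchConductor hz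
    refine ⟨b, hA.injective ?_⟩
    rw [← hxz]
    simp
  apply hA.isFiniteLength_of_length_ne_top
  have h1 : Module.length k (A ⧸ LinearMap.ker f) ≠ ⊤ := by
    have h2 : Module.length k (A ⧸ LinearMap.ker f) ≤
        Module.length k ((Fin r → k⟦X⟧) ⧸ powSubmodule k (n + γ)) :=
      Module.length_le_of_injective ((LinearMap.ker f).liftQ f le_rfl) (by
        rw [← LinearMap.ker_eq_bot, Submodule.ker_liftQ_eq_bot]
        exact le_rfl)
    rw [length_quotient_powIdeal] at h2
    exact ne_top_of_le_ne_top (by exact_mod_cast ENat.natCast_ne_top _) h2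
  refine ne_top_of_le_ne_top h1 (Module.length_le_of_surjective
    ((LinearMap.ker f).liftQ ((LinearMap.range (LinearMap.lsmul A A x)).mkQ.restrictScalars k)
      fun a ha ↦ ?_) fun y ↦ ?_)
  · rw [LinearMap.mem_ker]
    exact (Submodule.Quotient.mk_eq_zero _).mpr (hf a ha)
  · obtain ⟨y, rfl⟩ := Submodule.mkQ_surjective _ y
    exact ⟨Submodule.mkQ _ y, rfl⟩

/-- With `c` the constant term, `a - c` is never a unit. Were `a` a nonunit too, so would be `c` by
locality, forcing `c = 0`. -/
lemma isUnit_iff [IsLocalRing A] {a : A} (i : Fin r) :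
    IsUnit a ↔ constantCoeff (algebraMap A (Fin r → k⟦X⟧) a i) ≠ 0 := by
  constructor
  · intro h
    have := ((h.map (algebraMap A (Fin r → k⟦X⟧))).map (Pi.evalRingHom _ i)).map constantCoeff
    exact this.ne_zero
  · intro h
    by_contra hu
    set c := constantCoeff (algebraMap A (Fin r → k⟦X⟧) a i) with hc
    have h1 : ¬ IsUnit (a - algebraMap k A c) := by
      intro h
      have := ((h.map (algebraMap A (Fin r → k⟦X⟧))).map (Pi.evalRingHom _ i)).map constantCoeff
      rw [map_sub, ← IsScalarTower.algebraMap_apply k A (Fin r → k⟦X⟧)] at this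
      simp [← hc] at this
    have h2 : IsUnit (algebraMap k A c) := (IsUnit.mk0 c h).map _
    have := IsLocalRing.nonunits_add (show a ∈ nonunits A from hu)
      (show -(a - algebraMap k A c) ∈ nonunits A from fun h ↦ h1 (by simpa only [neg_neg] using h.neg))
    exact this (by simpa using h2)

lemma mem_maximalIdeal_iff [IsLocalRing A] {a : A} : a ∈ IsLocalRing.maximalIdeal A ↔
    ∀ i, constantCoeff (algebraMap A (Fin r → k⟦X⟧) a i) = 0 := by
  rw [IsLocalRing.mem_maximalIdeal, mem_nonunits_iff]
  constructor
  · intro h i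
    simpa [hA.isUnit_iff i] using h
  · intro h
    rw [hA.isUnit_iff ⟨0, hA.pos⟩, h, not_not]

end IsCurveOrder

/-! ### The Gorenstein criterion -/

namespace IsCurveOrder

open PowerSeries TotalLaurent

variable {k : Type u} [Field k] {r : ℕ} {A : Type u} [CommRing A] [Algebra k A]
  [Algebra A (Fin r → k⟦X⟧)] [IsScalarTower k A (Fin r → k⟦X⟧)]

/-- The inclusion of `k⟦t₁⟧ × … × k⟦t_r⟧` into its total quotient ring, as an `A`-linear map. -/
def ofPowerSeriesLinear (k : Type u) [Field k] (r : ℕ) (A : Type u) [CommRing A] [Algebra k A]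
    [Algebra A (Fin r → k⟦X⟧)] [IsScalarTower k A (Fin r → k⟦X⟧)] :
    (Fin r → k⟦X⟧) →ₗ[A] TotalLaurent k r where
  toFun := ofPowerSeries k r
  map_add' := map_add _
  map_smul' := ofPowerSeries_smul

variable (hA : IsCurveOrder k r A)
include hA

/-- The products `C y` lie in `A` and are stable under multiplication by power series, so they lie
in `C`. As `C` is generated by `f₀`, cancelling `f₀` shows that `y` is integral. -/
lemma exists_ofPowerSeries_eq {y : TotalLaurent k r}
    (hy : ∀ f ∈ branchConductor k r A, ofPowerSeries k r f * y ∈ imageIn A (TotalLaurent k r)) :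
    ∃ g, ofPowerSeries k r g = y := by
  obtain ⟨γ, hγ⟩ := hA.exists_branchConductor_eq
  let f₀ : Fin r → k⟦X⟧ := fun j ↦ X ^ γ j
  have hf₀ : f₀ ∈ branchConductor k r A := by
    rw [hγ, mem_powIdeal]
    exact fun j ↦ dvd_rfl
  obtain ⟨b, -, hb⟩ := mem_imageIn_totalLaurent.mp (hy f₀ hf₀)
  have hbC : b ∈ branchConductor k r A := by
    intro g
    rw [← ofPowerSeries_mem_imageIn (A := A), map_mul, hb, mul_right_comm, ← map_mul]
    exact hy _ (Ideal.mul_mem_right _ _ hf₀)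
  rw [hγ, powIdeal, Ideal.mem_span_singleton] at hbC
  obtain ⟨g, rfl⟩ := hbC
  refine ⟨g, ?_⟩
  have hu : IsUnit (ofPowerSeries k r f₀) :=
    isUnit_ofPowerSeries_iff.mpr fun j ↦ pow_ne_zero _ X_ne_zero
  rw [map_mul] at hb
  exact hu.mul_left_cancel hb

/-- An element of `L` multiplied into `A` by the conductor is already a power series on each branch,
so the torsion is `B / A`. -/
lemma length_torsionBySet_conductorIdeal :
    Module.length A (Submodule.torsionBySet A (TotalLaurent k r ⧸ imageIn A (TotalLaurent k r))
      (conductorIdeal A (Fin r → k⟦X⟧) : Set A)) =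
    Module.length A ((Fin r → k⟦X⟧) ⧸ imageIn A (Fin r → k⟦X⟧)) := by
  let p := (imageIn A (TotalLaurent k r)).mkQ ∘ₗ ofPowerSeriesLinear k r A
  have hp (f : Fin r → k⟦X⟧) : p f = (imageIn A (TotalLaurent k r)).mkQ (ofPowerSeries k r f) := rfl
  have hker : LinearMap.ker p = imageIn A (Fin r → k⟦X⟧) := by
    ext f
    rw [LinearMap.mem_ker, hp, Submodule.mkQ_apply, Submodule.Quotient.mk_eq_zero,
      ofPowerSeries_mem_imageIn, mem_imageIn_iff_mem_branchImage (k := k)]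
  have hrange : LinearMap.range p = Submodule.torsionBySet A _
      (conductorIdeal A (Fin r → k⟦X⟧) : Set A) := by
    ext y
    obtain ⟨y, rfl⟩ := Submodule.mkQ_surjective _ y
    rw [Submodule.mem_torsionBySet_iff]
    constructor
    · rintro ⟨f, hf⟩ ⟨a, ha⟩
      change a • (imageIn A (TotalLaurent k r)).mkQ y = 0
      rw [← hf, hp, ← map_smul, Submodule.mkQ_apply, Submodule.Quotient.mk_eq_zero, smul_def,
        ← map_mul, ofPowerSeries_mem_imageIn]
      exact (mem_conductorIdeal k).mp ha f
    · intro h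
      obtain ⟨g, rfl⟩ := hA.exists_ofPowerSeries_eq (y := y) fun f hf ↦ by
        obtain ⟨a, rfl⟩ := mem_branchImage_of_mem_branchConductor hf
        have : a • (imageIn A (TotalLaurent k r)).mkQ y = 0 :=
          h ⟨a, (mem_conductorIdeal k).mpr hf⟩
        rwa [← map_smul, Submodule.mkQ_apply, Submodule.Quotient.mk_eq_zero] at this
      exact ⟨g, rfl⟩
  rw [← hrange, ← hker]
  exact p.quotKerEquivRange.symm.length_eq

lemma length_quotient_conductorIdeal :
    Module.length k (A ⧸ (conductorIdeal A (Fin r → k⟦X⟧) : Submodule A A)) =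
      relLength ((branchConductor k r A).restrictScalars k) (branchImage k r A).toSubmodule := by
  let V := (branchImage k r A).toSubmodule
  let C := ((branchConductor k r A).restrictScalars k).submoduleOf V
  let g : A →ₗ[k] V := (IsScalarTower.toAlgHom k A (Fin r → k⟦X⟧)).toLinearMap.codRestrict V
    fun a ↦ ⟨a, rfl⟩
  have hg : Function.Surjective g := by
    rintro ⟨_, ⟨a, rfl⟩⟩
    exact ⟨a, rfl⟩
  have hker : LinearMap.ker (C.mkQ ∘ₗ g) =
      (conductorIdeal A (Fin r → k⟦X⟧) : Submodule A A).restrictScalars k := by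
    ext a
    rw [LinearMap.mem_ker, LinearMap.comp_apply, Submodule.mkQ_apply,
      Submodule.Quotient.mk_eq_zero]
    exact (mem_conductorIdeal k).symm
  rw [← (Submodule.Quotient.restrictScalarsEquiv k _).length_eq, ← hker]
  exact ((C.mkQ ∘ₗ g).quotKerEquivOfSurjective (C.mkQ_surjective.comp hg)).length_eq

lemma exists_isUnit_not_isUnit [IsLocalRing A] :
    ∃ x : A, IsUnit (algebraMap A (TotalLaurent k r) x) ∧ ¬ IsUnit x := by
  obtain ⟨N, hN⟩ := hA.exists_powIdeal_le
  obtain ⟨x, hx⟩ := hN (XPow k r (N + 1)) (mem_powIdeal_const.mpr ⟨_, XPow_add N 1⟩)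
  refine ⟨x, by rw [algebraMap_eq_ofPowerSeries, hx]; exact isUnit_XPow _, ?_⟩
  rw [hA.isUnit_iff ⟨0, hA.pos⟩, hx]
  simp [XPow]

open CategoryTheory in
-- Duality into `L / A` preserves the length of `A / C`, and the dual of `A / C` is `B / A`.
lemma relLength_eq_deltaOf_of_hasInjectiveDimensionLE [IsLocalRing A] (d : ℕ)
    [HasInjectiveDimensionLE (ModuleCat.of A A) d] :
    relLength ((branchConductor k r A).restrictScalars k) (branchImage k r A).toSubmodule =
      deltaOf k A (Fin r → k⟦X⟧) := by
  obtain ⟨x, hx, hxm⟩ := hA.exists_isUnit_not_isUnit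
  have hne : Module.length k (A ⧸ (conductorIdeal A (Fin r → k⟦X⟧) : Submodule A A)) ≠ ⊤ := by
    rw [hA.length_quotient_conductorIdeal]
    have h1 := conductorOf_eq_add (k := k) (r := r) (A := A)
    have h2 := hA.conductorOf_ne_top
    intro h
    simp [h1, h] at h2
  have h1 := length_hom_eq_of_hasInjectiveDimensionLE hA.algebraMap_totalLaurent_injective
    hA.baer_totalLaurent hx hxm (hA.isFiniteLength_quotient_lsmul hx) d
    (hA.isFiniteLength_of_length_ne_top hne)
  rw [(homQuotientEquivTorsionBySet _ _).length_eq, hA.length_torsionBySet_conductorIdeal] at h1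
  rw [← hA.length_quotient_conductorIdeal, deltaOf, dimENat_eq_length,
    IsLocalRing.length_restrictScalars k A, IsLocalRing.length_restrictScalars k A, h1]

/-- A zero exponent puts the idempotent of branch `j` into `A`, but elements of `A` have equal
constant terms on all branches. -/
lemma eq_zero_of_conductor_zero [IsLocalRing A] {γ : Fin r → ℕ}
    (hγ : branchConductor k r A = powIdeal k γ) {j : Fin r} (hj : γ j = 0) (i : Fin r) : i = j := by
  by_contra hij
  have : (Pi.single j 1 : Fin r → k⟦X⟧) ∈ branchImage k r A := by
    apply mem_branchImage_of_mem_branchConductor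
    rw [hγ]
    exact single_mem_powIdeal (by simp [hj])
  obtain ⟨a, ha⟩ := this
  have := hA.constantCoeff_eq a i j
  rw [show algebraMap A (Fin r → k⟦X⟧) a = Pi.single j 1 from ha] at this
  simp [hij] at this

/-- If the conductor has half the colength of `A`, then the socle of `L / A` is spanned by one
element. -/
lemma exists_socle_generator [IsLocalRing A]
    (h : relLength ((branchConductor k r A).restrictScalars k) (branchImage k r A).toSubmodule =
      deltaOf k A (Fin r → k⟦X⟧)) :
    ∃ e : TotalLaurent k r, ∀ y : TotalLaurent k r,
      (∀ a ∈ IsLocalRing.maximalIdeal A, a • y ∈ imageIn A (TotalLaurent k r)) →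
        ∃ c : k, y - c • e ∈ imageIn A (TotalLaurent k r) := by
  obtain ⟨γ, hγ⟩ := hA.exists_branchConductor_eq
  have hγV : ∀ f ∈ powIdeal k γ, f ∈ branchImage k r A := fun f hf ↦
    mem_branchImage_of_mem_branchConductor (hγ ▸ hf)
  have hmax (I : Ideal (Fin r → k⟦X⟧)) (hI : ∀ f ∈ I, f ∈ branchImage k r A) :
      I ≤ powIdeal k γ := hγ ▸ le_branchConductor hI
  by_cases h0 : ∃ j, γ j = 0
  -- Here there is one branch and `A` is all of `k⟦t⟧`; the socle of `k((t)) / k⟦t⟧` is spanned by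
  -- `t⁻¹`.
  · obtain ⟨j, hj⟩ := h0
    have hsub := hA.eq_zero_of_conductor_zero hγ hj
    have hγ0 : γ = 0 := funext fun i ↦ by rw [hsub i, hj, Pi.zero_apply]
    have hall (f : Fin r → k⟦X⟧) : f ∈ branchImage k r A := hγV f (by simp [hγ0])
    obtain ⟨u, hu⟩ := isUnit_XPow (k := k) (r := r) 1
    refine ⟨↑u⁻¹, fun y hy ↦ ?_⟩
    obtain ⟨x, hx⟩ := mem_branchImage.mp (hall (XPow k r 1))
    have hxm : x ∈ IsLocalRing.maximalIdeal A := by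
      rw [hA.mem_maximalIdeal_iff, hx]
      simp [XPow]
    have := hy x hxm
    rw [smul_def, hx, ← hu] at this
    obtain ⟨f, -, hf⟩ := mem_imageIn_totalLaurent.mp this
    have hyu : y = ↑u⁻¹ * ofPowerSeries k r f := by rw [hf, Units.inv_mul_cancel_left]
    obtain ⟨g, hg⟩ : ∃ g, f = algebraMap k _ (constantCoeff (f j)) + XPow k r 1 * g := by
      have : X ∣ f j - C (constantCoeff (f j)) := by simp [X_dvd_iff]
      obtain ⟨g, hg⟩ := this
      refine ⟨fun _ ↦ g, funext fun i ↦ ?_⟩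
      obtain rfl := hsub i
      simp [XPow, ← hg]
    refine ⟨constantCoeff (f j), mem_imageIn_totalLaurent.mpr ⟨g, hall g, ?_⟩⟩
    rw [hyu, smul_def]
    nth_rw 1 [hg]
    rw [map_add, map_mul, ← hu, mul_add, Units.inv_mul_cancel_left, mul_comm]
    ring
  -- Now the conductor lies in the maximal ideal, so socle elements are represented by power series,
  -- and `t ^ (γ - e_j)` spans the socle.
  · push Not at h0
    let j : Fin r := ⟨0, hA.pos⟩
    obtain ⟨ε, hε⟩ : ∃ ε : Fin r → ℕ, γ = ε + Pi.single j 1 := by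
      refine ⟨γ - Pi.single j 1, (tsub_add_cancel_of_le fun i ↦ ?_).symm⟩
      obtain rfl | hij := eq_or_ne i j
      · simpa [Nat.one_le_iff_ne_zero] using h0 j
      · simp [hij]
    have hV : 2 * relLength (powSubmodule k γ) (branchImage k r A).toSubmodule = ∑ i, γ i := by
      rw [← length_quotient_powIdeal (k := k), powSubmodule, ← hγ, ← conductorOf_eq_length,
        conductorOf_eq_add, two_mul, ← h]
    refine ⟨ofPowerSeries k r fun i ↦ X ^ ε i, fun y hy ↦ ?_⟩
    obtain ⟨y, rfl⟩ := hA.exists_ofPowerSeries_eq (y := y) fun f hf ↦ by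
      obtain ⟨a, rfl⟩ := mem_branchImage_of_mem_branchConductor hf
      refine hy a (hA.mem_maximalIdeal_iff.mpr fun i ↦ ?_)
      rw [hγ] at hf
      exact X_dvd_iff.mp ((dvd_pow_self X (h0 i)).trans (mem_powIdeal.mp hf i))
    obtain ⟨v, hv, hyv⟩ := exists_sub_mem_powIdeal_of_symmetric hγV hmax hV
      (by rintro _ ⟨a, rfl⟩ i j; exact hA.constantCoeff_eq a i j) hε (y := y) (by
        rintro _ ⟨a, rfl⟩ ha
        have := hy a (hA.mem_maximalIdeal_iff.mpr ha)
        rwa [smul_def, ← map_mul, ofPowerSeries_mem_imageIn] at this)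
    refine ⟨coeff (ε j) ((y - v) j), ?_⟩
    set c := coeff (ε j) ((y - v) j)
    have h1 : y - v - c • (fun i ↦ X ^ ε i : Fin r → k⟦X⟧) ∈ powIdeal k γ := by
      rw [hε, mem_powIdeal_add_single]
      refine ⟨Ideal.sub_mem _ hyv (Submodule.smul_of_tower_mem _ c
        (mem_powIdeal.mpr fun i ↦ dvd_rfl)), ?_⟩
      simp [c]
    have h2 := (branchImage k r A).add_mem (hγV _ h1) hv
    rw [sub_right_comm, sub_add_cancel] at h2
    rwa [← ofPowerSeries_smul, ← map_sub, ofPowerSeries_mem_imageIn]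

lemma length_socle_le_one [IsLocalRing A]
    (h : relLength ((branchConductor k r A).restrictScalars k) (branchImage k r A).toSubmodule =
      deltaOf k A (Fin r → k⟦X⟧)) :
    Module.length A (A ⧸ IsLocalRing.maximalIdeal A →ₗ[A]
      TotalLaurent k r ⧸ imageIn A (TotalLaurent k r)) ≤ 1 := by
  obtain ⟨e, he⟩ := hA.exists_socle_generator h
  refine (homQuotientEquivTorsionBySet _ _).length_eq.trans_le ?_
  refine (Submodule.length_le_length_restrictScalars k _).trans ?_
  set W := (Submodule.torsionBySet A (TotalLaurent k r ⧸ imageIn A (TotalLaurent k r))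
    (IsLocalRing.maximalIdeal A : Set A)).restrictScalars k
  have hW : W ≤ Submodule.span k {(imageIn A (TotalLaurent k r)).mkQ e} := by
    intro y hy
    obtain ⟨y, rfl⟩ := Submodule.mkQ_surjective _ y
    obtain ⟨c, hc⟩ := he y fun a ha ↦ by
      have : a • (imageIn A (TotalLaurent k r)).mkQ y = 0 :=
        (Submodule.mem_torsionBySet_iff _ _).mp hy ⟨a, ha⟩
      rwa [← map_smul, Submodule.mkQ_apply, Submodule.Quotient.mk_eq_zero] at this
    rw [Submodule.mem_span_singleton]
    refine ⟨c, ?_⟩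
    rw [← (Submodule.Quotient.mk_eq_zero _), Submodule.Quotient.mk_sub, sub_eq_zero] at hc
    exact hc.symm
  refine (Module.length_le_of_injective (Submodule.inclusion hW)
    (Submodule.inclusion_injective hW)).trans ?_
  rw [Module.length_eq_finrank]
  exact_mod_cast (finrank_span_le_card _).trans (by
    rw [Set.toFinset_card]
    exact Fintype.card_le_one_iff_subsingleton.mpr inferInstance)

open CategoryTheory in
lemma hasInjectiveDimensionLE_one [IsLocalRing A] [IsNoetherianRing A]
    (h : relLength ((branchConductor k r A).restrictScalars k) (branchImage k r A).toSubmodule =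
      deltaOf k A (Fin r → k⟦X⟧)) :
    HasInjectiveDimensionLE (ModuleCat.of A A) 1 :=
  hasInjectiveDimensionLE_one_of_baer hA.algebraMap_totalLaurent_injective hA.baer_totalLaurent
    (baer_quotient_imageIn hA.algebraMap_totalLaurent_injective
      (fun _ hx ↦ hA.isFiniteLength_quotient_lsmul hx) hA.exists_smul_mem_imageIn
      hA.exists_disjoint_ideal (hA.length_socle_le_one h))

/-- A curve singularity is Gorenstein if and only if `c = 2δ`. -/
lemma conductorOf_eq_two_mul_deltaOf_iff_isGorensteinLocal [IsLocalRing A] [IsNoetherianRing A] :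
    conductorOf k A (Fin r → k⟦X⟧) = 2 * deltaOf k A (Fin r → k⟦X⟧) ↔ IsGorensteinLocal A := by
  rw [hA.conductorOf_eq_two_mul_deltaOf_iff]
  constructor
  · intro h
    exact ⟨‹_›, ‹_›, 1, hA.hasInjectiveDimensionLE_one h⟩
  · rintro ⟨-, -, d, hd⟩
    exact hA.relLength_eq_deltaOf_of_hasInjectiveDimensionLE d

end IsCurveOrder

/-! ### Common denominators -/

section CommonDenominators

lemma exists_smul_mem_of_finite {A : Type u} {M : Type v} [CommRing A] [AddCommGroup M]
    [Module A M] [Module.Finite A M] (S : Submonoid A) (N : Submodule A M)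
    (h : ∀ m : M, ∃ s ∈ S, s • m ∈ N) : ∃ s ∈ S, ∀ m : M, s • m ∈ N := by
  classical
  obtain ⟨T, hT⟩ := Module.Finite.fg_top (R := A) (M := M)
  choose s hs hsN using h
  refine ⟨∏ m ∈ T, s m, S.prod_mem fun m _ ↦ hs m, fun m ↦ ?_⟩
  have hle : Submodule.span A (T : Set M) ≤
      N.comap (LinearMap.lsmul A M (∏ m ∈ T, s m)) := by
    rw [Submodule.span_le]
    intro m hm
    change (∏ m ∈ T, s m) • m ∈ N
    rw [← Finset.prod_erase_mul _ _ hm, mul_smul]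
    exact N.smul_mem _ (hsN m)
  exact hle (hT ▸ Submodule.mem_top : m ∈ Submodule.span A (T : Set M))

end CommonDenominators

/-! ### Separation of branches and criteria for being a curve order -/

section CurveAlgebra

open PowerSeries TotalLaurent

lemma exists_dvd_X_pow {k : Type u} [Field k] {f : k⟦X⟧} (hf : f ≠ 0) : ∃ m, f ∣ X ^ m := by
  obtain ⟨m, u, h⟩ := exists_X_pow_mul_unit hf
  exact ⟨m, _, h.symm⟩

variable (k : Type u) [Field k] (r : ℕ) (A : Type u) [CommRing A] [Algebra k A]
  [Algebra A (Fin r → k⟦X⟧)] [IsScalarTower k A (Fin r → k⟦X⟧)]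

/-- The kernel of the `j`-th component of `A → k⟦t₁⟧ × … × k⟦t_r⟧`. -/
abbrev branchIdeal (j : Fin r) : Ideal A :=
  (RingHom.ker (Pi.evalRingHom (fun _ : Fin r ↦ k⟦X⟧) j)).comap (algebraMap A (Fin r → k⟦X⟧))

/-- The coordinate ring of a parameterized reduced curve singularity with `r` branches: a local
`k`-subalgebra with residue field `k` of `k⟦t₁⟧ × … × k⟦t_r⟧`, over which the latter is finite,
with pairwise distinct branches, none of which is constant. -/
structure IsCurveAlgebra : Prop where
  pos : 0 < r
  injective : Function.Injective (algebraMap A (Fin r → k⟦X⟧))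
  constantCoeff_eq : ∀ (a : A) (i j : Fin r),
    constantCoeff (algebraMap A (Fin r → k⟦X⟧) a i) =
      constantCoeff (algebraMap A (Fin r → k⟦X⟧) a j)
  finite : Module.Finite A (Fin r → k⟦X⟧)
  exists_parameter : ∃ z : A, ∀ j, algebraMap A (Fin r → k⟦X⟧) z j ≠ 0 ∧
    constantCoeff (algebraMap A (Fin r → k⟦X⟧) z j) = 0
  branchIdeal_ne : ∀ i j, i ≠ j → branchIdeal k r A i ≠ branchIdeal k r A j

variable {k r A}

lemma mem_branchIdeal {j : Fin r} {a : A} :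
    a ∈ branchIdeal k r A j ↔ algebraMap A (Fin r → k⟦X⟧) a j = 0 := Iff.rfl

instance (j : Fin r) : (RingHom.ker (Pi.evalRingHom (fun _ : Fin r ↦ k⟦X⟧) j)).IsPrime :=
  RingHom.ker_isPrime _

lemma exists_ker_evalRingHom_le (P : Ideal (Fin r → k⟦X⟧)) [P.IsPrime] :
    ∃ j, RingHom.ker (Pi.evalRingHom (fun _ : Fin r ↦ k⟦X⟧) j) ≤ P := by
  have h : (Finset.univ.inf fun j ↦ RingHom.ker (Pi.evalRingHom (fun _ : Fin r ↦ k⟦X⟧) j)) ≤ P := by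
    intro f hf
    simp only [Submodule.mem_finsetInf, Finset.mem_univ, true_imp_iff] at hf
    rw [show f = 0 from funext fun j ↦ hf j]
    exact P.zero_mem
  simpa using (Ideal.IsPrime.inf_le' ‹_›).mp h

lemma ker_evalRingHom_le_iff {i j : Fin r} :
    RingHom.ker (Pi.evalRingHom (fun _ : Fin r ↦ k⟦X⟧) i) ≤
      RingHom.ker (Pi.evalRingHom (fun _ : Fin r ↦ k⟦X⟧) j) ↔ i = j := by
  refine ⟨fun h ↦ ?_, fun h ↦ h ▸ le_rfl⟩
  by_contra hij
  have h1 : Pi.single j 1 ∈ RingHom.ker (Pi.evalRingHom (fun _ : Fin r ↦ k⟦X⟧) i) := by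
    simp [RingHom.mem_ker, hij]
  have := h h1
  simp [RingHom.mem_ker] at this

lemma minimalPrimes_pi_powerSeries : minimalPrimes (Fin r → k⟦X⟧) =
    Set.range fun j ↦ RingHom.ker (Pi.evalRingHom (fun _ : Fin r ↦ k⟦X⟧) j) := by
  ext P
  rw [minimalPrimes_eq_minimals]
  constructor
  · intro hP
    have := hP.prop
    obtain ⟨j, hj⟩ := exists_ker_evalRingHom_le P
    exact ⟨j, le_antisymm hj (hP.le_of_le (inferInstance) hj)⟩
  · rintro ⟨j, rfl⟩
    refine ⟨inferInstanceAs (Ideal.IsPrime _), fun Q hQ hle ↦ ?_⟩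
    have : Q.IsPrime := hQ
    obtain ⟨i, hi⟩ := exists_ker_evalRingHom_le Q
    obtain rfl := ker_evalRingHom_le_iff.mp (hi.trans hle)
    exact hi

namespace IsCurveAlgebra

variable (hA : IsCurveAlgebra k r A)
include hA

/-- Given an inclusion, lying over yields a prime `P` of the product above the `j`-th branch ideal.
If `P` is the kernel of the `i`-th projection, the branch ideals agree; otherwise `P` contains a
power of the parameter, which is nonzero on branch `j`. -/
lemma branchIdeal_le_iff {i j : Fin r} : branchIdeal k r A i ≤ branchIdeal k r A j ↔ i = j := by
  refine ⟨fun h ↦ ?_, fun h ↦ h ▸ le_rfl⟩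
  by_contra hij
  have := hA.finite
  obtain ⟨P, hle, hP, hPj⟩ := Ideal.exists_ideal_over_prime_of_isIntegral (branchIdeal k r A j)
    (RingHom.ker (Pi.evalRingHom (fun _ : Fin r ↦ k⟦X⟧) i)) h
  obtain ⟨z, hz⟩ := hA.exists_parameter
  obtain ⟨f, hf, hf0⟩ : ∃ f ∈ P, f i ≠ 0 := by
    by_contra! hf
    have : P = RingHom.ker (Pi.evalRingHom (fun _ : Fin r ↦ k⟦X⟧) i) := le_antisymm hf hle
    rw [this] at hPj
    exact hA.branchIdeal_ne i j hij hPj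
  obtain ⟨m, g, hg⟩ := exists_dvd_X_pow hf0
  obtain ⟨h, hh⟩ := X_dvd_iff.mpr (hz i).2
  have h1 : algebraMap A (Fin r → k⟦X⟧) z ^ m - f * (fun _ ↦ g * h ^ m) ∈ P := by
    apply hle
    simp [RingHom.mem_ker, hh, mul_pow, hg, mul_assoc]
  have h2 : algebraMap A (Fin r → k⟦X⟧) z ^ m ∈ P :=
    (P.sub_mem_iff_left (P.mul_mem_right _ hf)).mp h1
  have h3 : z ∈ branchIdeal k r A j := by
    rw [← hPj]
    exact hP.mem_of_pow_mem _ h2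
  exact (hz j).1 h3

lemma minimalPrimes_eq : minimalPrimes A = Set.range (branchIdeal k r A) := by
  have key (P : Ideal A) [P.IsPrime] : ∃ j, branchIdeal k r A j ≤ P := by
    have h : (Finset.univ.inf fun j ↦ branchIdeal k r A j) ≤ P := by
      intro f hf
      simp only [Submodule.mem_finsetInf, Finset.mem_univ, true_imp_iff] at hf
      have : f = 0 := hA.injective (funext fun j ↦ by rw [map_zero]; exact hf j)
      rw [this]
      exact P.zero_mem
    simpa using (Ideal.IsPrime.inf_le' ‹_›).mp h
  ext P
  rw [minimalPrimes_eq_minimals]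
  constructor
  · intro hP
    have := hP.prop
    obtain ⟨j, hj⟩ := key P
    exact ⟨j, le_antisymm hj (hP.le_of_le (inferInstance) hj)⟩
  · rintro ⟨j, rfl⟩
    refine ⟨inferInstanceAs (Ideal.IsPrime _), fun Q hQ hle ↦ ?_⟩
    have : Q.IsPrime := hQ
    obtain ⟨i, hi⟩ := key Q
    obtain rfl := hA.branchIdeal_le_iff.mp (hi.trans hle)
    exact hi

lemma bijOn_minimalPrimes : Set.BijOn (Ideal.comap (algebraMap A (Fin r → k⟦X⟧)))
    (minimalPrimes (Fin r → k⟦X⟧)) (minimalPrimes A) := by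
  rw [minimalPrimes_pi_powerSeries, hA.minimalPrimes_eq]
  refine ⟨?_, ?_, ?_⟩
  · rintro _ ⟨j, rfl⟩
    exact ⟨j, rfl⟩
  · rintro _ ⟨i, rfl⟩ _ ⟨j, rfl⟩ h
    by_cases hij : i = j
    · rw [hij]
    · exact absurd h (hA.branchIdeal_ne i j hij)
  · rintro _ ⟨j, rfl⟩
    exact ⟨_, ⟨j, rfl⟩, rfl⟩

/-- For each branch there is an element of `A` supported on this branch. -/
lemma exists_eq_single_ne_zero (j : Fin r) : ∃ (a : A) (f : k⟦X⟧), f ≠ 0 ∧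
    algebraMap A (Fin r → k⟦X⟧) a = Pi.single j f := by
  classical
  have h : ¬ ((Finset.univ.erase j).inf fun i ↦ branchIdeal k r A i) ≤ branchIdeal k r A j := by
    rw [Ideal.IsPrime.inf_le' inferInstance]
    rintro ⟨i, hi, hle⟩
    exact (Finset.mem_erase.mp hi).1 (hA.branchIdeal_le_iff.mp hle)
  obtain ⟨a, ha, haj⟩ := SetLike.not_le_iff_exists.mp h
  refine ⟨a, algebraMap A (Fin r → k⟦X⟧) a j, haj, funext fun i ↦ ?_⟩
  obtain rfl | hij := eq_or_ne i j
  · simp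
  · rw [Pi.single_eq_of_ne hij]
    exact (Submodule.mem_finsetInf.mp ha) i (by simp [hij])

/-- It suffices to check the finiteness condition of a curve order on each branch. -/
lemma isCurveOrder_of_branch
    (h : ∀ j, ∃ f : k⟦X⟧, f ≠ 0 ∧ ∀ g, ∃ a : A, algebraMap A (Fin r → k⟦X⟧) a j = f * g) :
    IsCurveOrder k r A := by
  refine ⟨hA.pos, hA.injective, hA.constantCoeff_eq, ?_⟩
  have h1 (j : Fin r) : ∃ m : ℕ, ∀ g, ∃ a : A,
      algebraMap A (Fin r → k⟦X⟧) a = Pi.single j (X ^ m * g) := by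
    obtain ⟨f, hf, hfa⟩ := h j
    -- The hypothesis controls only the `j`-th component; multiplying by `e` kills the others.
    obtain ⟨e, e', he', he⟩ := hA.exists_eq_single_ne_zero j
    obtain ⟨m, c, hc⟩ := exists_dvd_X_pow (mul_ne_zero hf he')
    refine ⟨m, fun g ↦ ?_⟩
    obtain ⟨a, ha⟩ := hfa (c * g)
    refine ⟨a * e, ?_⟩
    rw [map_mul, he, ← Pi.single_mul_right, ha, hc]
    congr 1
    ring
  choose m hm using h1
  refine ⟨∑ j, m j, fun f hf ↦ ?_⟩
  rw [mem_powIdeal] at hf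
  have h2 (j : Fin r) : ∃ g, f j = X ^ m j * g :=
    (pow_dvd_pow X (Finset.single_le_sum (fun _ _ ↦ Nat.zero_le _) (Finset.mem_univ j))).trans (hf j)
  choose g hg using h2
  choose a ha using fun j ↦ hm j (g j)
  refine ⟨∑ j, a j, ?_⟩
  rw [map_sum]
  simp only [ha, ← hg]
  exact Finset.univ_sum_single f

lemma isCurveOrder_of_smul {s : A} (hs : ∀ j, algebraMap A (Fin r → k⟦X⟧) s j ≠ 0)
    (h : ∀ f : Fin r → k⟦X⟧, s • f ∈ imageIn A (Fin r → k⟦X⟧)) : IsCurveOrder k r A := by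
  refine hA.isCurveOrder_of_branch fun j ↦ ⟨_, hs j, fun g ↦ ?_⟩
  obtain ⟨a, ha⟩ := mem_imageIn.mp (h fun _ ↦ g)
  refine ⟨a, ?_⟩
  rw [ha, Algebra.smul_def]
  rfl

/-- An element `s` supported on branch `j` is invertible after localizing there. It kills whatever
vanishes on that branch, and expanding fractions by such elements brings numerators and denominators
into `A`. -/
lemma isBirationalExt_of_isCurveOrder (h : IsCurveOrder k r A) :
    IsBirationalExt A (Fin r → k⟦X⟧) := by
  refine ⟨hA.bijOn_minimalPrimes, fun P _ hP ↦ ?_⟩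
  rw [minimalPrimes_pi_powerSeries] at hP
  obtain ⟨j, rfl⟩ : ∃ j, RingHom.ker (Pi.evalRingHom (fun _ : Fin r ↦ k⟦X⟧) j) = P := hP
  obtain ⟨N, hN⟩ := h.exists_eq_single
  obtain ⟨s, hs⟩ := hN j 1
  have hsj : s ∉ branchIdeal k r A j := by
    rw [mem_branchIdeal, hs]
    simp [X_ne_zero]
  constructor
  · rw [injective_iff_map_eq_zero]
    intro x hx
    obtain ⟨a, t, rfl⟩ := IsLocalization.exists_mk'_eq (branchIdeal k r A j).primeCompl x
    rw [Localization.localRingHom_mk', IsLocalization.mk'_eq_zero_iff] at hx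
    obtain ⟨⟨c, hc⟩, hca⟩ := hx
    have haj : algebraMap A (Fin r → k⟦X⟧) a j = 0 :=
      (mul_eq_zero.mp (congrFun hca j)).resolve_left hc
    refine (IsLocalization.mk'_eq_zero_iff _ _).mpr ⟨⟨s, hsj⟩, hA.injective ?_⟩
    rw [map_mul, hs, map_zero, ← Pi.single_mul_left, haj]
    simp
  · intro y
    obtain ⟨b, ⟨c, hc⟩, rfl⟩ := IsLocalization.exists_mk'_eq
      (RingHom.ker (Pi.evalRingHom (fun _ : Fin r ↦ k⟦X⟧) j)).primeCompl y
    obtain ⟨b', hb'⟩ := hN j (b j)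
    obtain ⟨c', hc'⟩ := hN j (c j)
    have hc'j : c' ∉ branchIdeal k r A j := by
      rw [mem_branchIdeal, hc', Pi.single_eq_same]
      exact mul_ne_zero (pow_ne_zero _ X_ne_zero) hc
    refine ⟨IsLocalization.mk' _ b' (⟨c', hc'j⟩ : (branchIdeal k r A j).primeCompl), ?_⟩
    rw [Localization.localRingHom_mk', IsLocalization.mk'_eq_iff_eq]
    congr 1
    refine funext fun i ↦ ?_
    simp only [Pi.mul_apply, hb', hc']
    obtain rfl | hij := eq_or_ne i j
    · simp only [Pi.single_eq_same]
      ring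
    · simp [hij]

/-- Surjectivity of the local maps gives each element a denominator modulo the elements vanishing on
branch `j`; finiteness gives a common one. -/
lemma isCurveOrder_of_isBirationalExt (h : IsBirationalExt A (Fin r → k⟦X⟧)) :
    IsCurveOrder k r A := by
  have := hA.finite
  refine hA.isCurveOrder_of_branch fun j ↦ ?_
  have hsurj := (h.2 (RingHom.ker (Pi.evalRingHom (fun _ : Fin r ↦ k⟦X⟧) j))
    (by rw [minimalPrimes_pi_powerSeries]; exact ⟨j, rfl⟩)).2
  let N : Submodule A (Fin r → k⟦X⟧) := imageIn A (Fin r → k⟦X⟧) ⊔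
    (RingHom.ker (Pi.evalRingHom (fun _ : Fin r ↦ k⟦X⟧) j)).restrictScalars A
  obtain ⟨s, hs, hsN⟩ := exists_smul_mem_of_finite (branchIdeal k r A j).primeCompl N fun b ↦ by
    obtain ⟨x, hx⟩ := hsurj (algebraMap _ _ b)
    obtain ⟨a, ⟨s, hs⟩, rfl⟩ := IsLocalization.exists_mk'_eq (branchIdeal k r A j).primeCompl x
    rw [Localization.localRingHom_mk', IsLocalization.mk'_eq_iff_eq_mul, ← map_mul,
      IsLocalization.eq_iff_exists
        (RingHom.ker (Pi.evalRingHom (fun _ : Fin r ↦ k⟦X⟧) j)).primeCompl] at hx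
    obtain ⟨⟨c, hc⟩, hcb⟩ := hx
    have hab : algebraMap A (Fin r → k⟦X⟧) a j = b j * algebraMap A (Fin r → k⟦X⟧) s j :=
      mul_left_cancel₀ hc (congrFun hcb j)
    refine ⟨s, hs, Submodule.mem_sup.mpr ⟨_, ⟨a, rfl⟩, s • b - algebraMap A (Fin r → k⟦X⟧) a, ?_,
      by simp⟩⟩
    rw [Submodule.restrictScalars_mem, RingHom.mem_ker, Algebra.smul_def]
    simp [hab, mul_comm]
  refine ⟨_, hs, fun g ↦ ?_⟩
  obtain ⟨_, ⟨a, rfl⟩, c, hc, hac⟩ := Submodule.mem_sup.mp (hsN fun _ ↦ g)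
  refine ⟨a, ?_⟩
  have h1 := congrFun hac j
  rw [Algebra.smul_def] at h1
  have h2 : c j = 0 := hc
  simpa [h2] using h1

/-- By Cayley-Hamilton, a monic polynomial `p` in the parameter `z` kills the finite-dimensional
cokernel, so `p(z)` is a common denominator. -/
lemma isCurveOrder_of_deltaOf_lt_top (h : deltaOf k A (Fin r → k⟦X⟧) < ⊤) :
    IsCurveOrder k r A := by
  obtain ⟨z, hz⟩ := hA.exists_parameter
  set Q := (Fin r → k⟦X⟧) ⧸ imageIn A (Fin r → k⟦X⟧)
  have hQ : Module.Finite k Q := by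
    rw [deltaOf, dimENat] at h
    exact Module.rank_lt_aleph0_iff.mp (by simpa using h)
  let T : Module.End k Q := Algebra.lsmul k k Q z
  let p := T.charpoly
  have hp : p.Monic := T.charpoly_monic
  have hpz (q : Q) : (Polynomial.aeval z p) • q = 0 := by
    have h1 : Polynomial.aeval T p = 0 := T.aeval_self_charpoly
    have h2 : Polynomial.aeval T p = Algebra.lsmul k k Q (Polynomial.aeval z p) :=
      (Polynomial.aeval_algHom_apply (Algebra.lsmul k k Q) z p)
    rw [h2] at h1
    exact LinearMap.congr_fun h1 q
  refine hA.isCurveOrder_of_smul (s := Polynomial.aeval z p) (fun j h0 ↦ ?_) fun f ↦ ?_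
  · have h1 : Polynomial.aeval (algebraMap A (Fin r → k⟦X⟧) z j) p = 0 := by
      have h2 := Polynomial.aeval_algHom_apply
        ((Pi.evalAlgHom k (fun _ : Fin r ↦ k⟦X⟧) j).comp (IsScalarTower.toAlgHom k A (Fin r → k⟦X⟧)))
        z p
      exact h2.trans h0
    -- Split off the power of the variable from `p`: `z` is nonzero on branch `j`, and `q(z)` has
    -- constant term `q(0) ≠ 0`.
    obtain ⟨q, hq, hqX⟩ := Polynomial.exists_eq_pow_rootMultiplicity_mul_and_not_dvd p hp.ne_zero 0
    rw [hq, map_mul] at h1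
    rcases mul_eq_zero.mp h1 with h2 | h2
    · simp only [map_zero, sub_zero, map_pow, Polynomial.aeval_X] at h2
      exact (hz j).1 (pow_eq_zero_iff (by rintro h; simp [h] at h2) |>.mp h2)
    · apply hqX
      rw [Polynomial.dvd_iff_isRoot, Polynomial.IsRoot.def, ← Polynomial.coeff_zero_eq_eval_zero]
      have h3 := congrArg constantCoeff h2
      rw [Polynomial.aeval_def, Polynomial.hom_eval₂, (hz j).2, Polynomial.eval₂_at_zero] at h3
      simpa using h3
  · rw [← Submodule.Quotient.mk_eq_zero, Submodule.Quotient.mk_smul]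
    exact hpz _

end IsCurveAlgebra

end CurveAlgebra

/-! ### Invariance under isomorphism of the overring -/

section Transport

variable (k : Type u) {A B C : Type u} [Field k] [CommRing A] [CommRing B] [CommRing C]
  [Algebra k A] [Algebra k B] [Algebra k C] [Algebra A B] [Algebra A C]
  [IsScalarTower k A B] [IsScalarTower k A C]

lemma map_imageIn (e : B ≃ₐ[A] C) :
    (imageIn A B).map (e.toLinearEquiv : B →ₗ[A] C) = imageIn A C := by
  rw [imageIn, imageIn, ← LinearMap.range_comp]
  congr 1
  ext
  simp

/-- An isomorphism of `A`-algebras induces an isomorphism of the cokernels of their structure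
maps. -/
def quotientImageInEquiv (e : B ≃ₐ[A] C) : (B ⧸ imageIn A B) ≃ₗ[A] C ⧸ imageIn A C :=
  Submodule.Quotient.equiv _ _ e.toLinearEquiv (map_imageIn e)

lemma deltaOf_congr (e : B ≃ₐ[A] C) : deltaOf k A B = deltaOf k A C := by
  rw [deltaOf, deltaOf, dimENat, dimENat,
    ((quotientImageInEquiv e).restrictScalars k).rank_eq]

lemma conductorOf_congr (e : B ≃ₐ[A] C) : conductorOf k A B = conductorOf k A C := by
  have h1 : conductorIdeal A B = conductorIdeal A C := (quotientImageInEquiv e).annihilator_eq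
  have h2 : (Submodule.map (Algebra.linearMap A B) (conductorIdeal A B)).map
      (e.toLinearEquiv : B →ₗ[A] C) =
        Submodule.map (Algebra.linearMap A C) (conductorIdeal A C) := by
    rw [← Submodule.map_comp, h1]
    congr 1
    ext
    simp
  rw [conductorOf, conductorOf, dimENat, dimENat,
    ((Submodule.Quotient.equiv _ _ e.toLinearEquiv h2).restrictScalars k).rank_eq]

end Transport

/-! ### Normalization and the equivalence of the finiteness conditions -/

section Normalization

open PowerSeries TotalLaurent

variable {k : Type u} [Field k] {r : ℕ} {A : Type u} [CommRing A] [Algebra k A]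
  [Algebra A (Fin r → k⟦X⟧)] [IsScalarTower k A (Fin r → k⟦X⟧)]

/-- A nonzerodivisor of `A` vanishes on no branch, since it would kill the elements supported there.
-/
lemma IsCurveOrder.isFractionRing (hA : IsCurveOrder k r A) :
    IsFractionRing A (TotalLaurent k r) where
  map_units := by
    rintro ⟨s, hs⟩
    rw [algebraMap_eq_ofPowerSeries, isUnit_ofPowerSeries_iff]
    intro j hj
    obtain ⟨N, hN⟩ := hA.exists_eq_single
    obtain ⟨c, hc⟩ := hN j 1
    have h1 : c * s = 0 := by
      refine hA.injective ?_
      rw [map_mul, hc, ← Pi.single_mul_left, hj]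
      simp
    rw [(mem_nonZeroDivisors_iff.mp hs).2 c h1, map_zero] at hc
    have := congrFun hc j
    simp only [Pi.zero_apply, mul_one, Pi.single_eq_same] at this
    exact pow_ne_zero N X_ne_zero this.symm
  surj := by
    intro y
    obtain ⟨x, hx, a, ha⟩ := hA.exists_smul_mem_imageIn y
    refine ⟨⟨a, x, ?_⟩, ?_⟩
    · rw [mem_nonZeroDivisors_iff_right]
      intro b hb
      refine hA.algebraMap_totalLaurent_injective ?_
      have := congrArg (algebraMap A (TotalLaurent k r)) hb
      rw [map_mul, map_zero] at this
      rw [map_zero]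
      exact hx.mul_left_eq_zero.mp this
    · rw [mul_comm, ← Algebra.smul_def]
      exact ha.symm
  exists_of_eq := fun h ↦ ⟨1, by rw [hA.algebraMap_totalLaurent_injective h]⟩

instance : IsScalarTower A (Fin r → k⟦X⟧) (TotalLaurent k r) :=
  IsScalarTower.of_algebraMap_eq fun _ ↦ rfl

lemma isIntegralClosure_totalLaurent [Module.Finite A (Fin r → k⟦X⟧)] :
    IsIntegralClosure (Fin r → k⟦X⟧) A (TotalLaurent k r) where
  algebraMap_injective := ofPowerSeries_injective
  isIntegral_iff := by
    intro x
    constructor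
    · intro hx
      have h (j : Fin r) : ∃ f, algebraMap k⟦X⟧ (LaurentSeries k) f = x j := by
        have h1 : IsIntegral k⟦X⟧ (x j) := by
          let ev : TotalLaurent k r →+* LaurentSeries k :=
            Pi.evalRingHom (fun _ : Fin r ↦ LaurentSeries k) j
          exact hx.map_of_comp_eq
            ((Pi.evalRingHom (fun _ : Fin r ↦ k⟦X⟧) j).comp (algebraMap A (Fin r → k⟦X⟧))) ev rfl
        exact IsIntegrallyClosed.algebraMap_eq_of_integral h1
      choose f hf using h
      exact ⟨f, funext hf⟩
    · rintro ⟨f, rfl⟩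
      exact (Algebra.IsIntegral.isIntegral (R := A) f).algebraMap

namespace IsCurveAlgebra

variable (hA : IsCurveAlgebra k r A)
include hA

lemma isNormalizationExt_of_isCurveOrder (h : IsCurveOrder k r A) :
    IsNormalizationExt A (Fin r → k⟦X⟧) := by
  have := hA.finite
  have := h.isFractionRing
  have := isIntegralClosure_totalLaurent (k := k) (r := r) (A := A)
  exact ⟨(IsIntegralClosure.equiv A (Fin r → k⟦X⟧) (TotalLaurent k r)
    (integralClosure A (TotalLaurent k r))).trans
      (FractionRing.algEquiv A (TotalLaurent k r)).symm.mapIntegralClosure⟩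

/-- Finitely many fractions have a common denominator, which vanishes on no branch because it is a
nonzerodivisor. -/
lemma isCurveOrder_of_isNormalizationExt (h : IsNormalizationExt A (Fin r → k⟦X⟧)) :
    IsCurveOrder k r A := by
  have := hA.finite
  obtain ⟨e⟩ := h
  obtain ⟨s, hs, hsb⟩ := exists_smul_mem_of_finite (nonZeroDivisors A)
    (imageIn A (Fin r → k⟦X⟧)) fun b ↦ by
      obtain ⟨⟨a, s, hs⟩, h⟩ := IsLocalization.surj (nonZeroDivisors A) (e b : FractionRing A)
      refine ⟨s, hs, a, e.injective (Subtype.ext ?_)⟩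
      rw [map_smul, Algebra.linearMap_apply, AlgEquiv.commutes]
      change algebraMap A (FractionRing A) a = s • (e b : FractionRing A)
      rw [← h, Algebra.smul_def, mul_comm]
  refine hA.isCurveOrder_of_smul (fun j hj ↦ ?_) hsb
  obtain ⟨a, f, hf, ha⟩ := hA.exists_eq_single_ne_zero j
  have h1 : a * s = 0 := by
    refine hA.injective ?_
    rw [map_mul, ha, ← Pi.single_mul_left, hj]
    simp
  rw [(mem_nonZeroDivisors_iff.mp hs).2 a h1, map_zero] at ha
  have := congrFun ha j
  simp [hf.symm] at this

theorem tfae : List.TFAE [IsCurveOrder k r A, deltaOf k A (Fin r → k⟦X⟧) < ⊤,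
    conductorOf k A (Fin r → k⟦X⟧) < ⊤, IsBirationalExt A (Fin r → k⟦X⟧),
    IsNormalizationExt A (Fin r → k⟦X⟧)] := by
  tfae_have 1 → 3 := fun h ↦ lt_top_iff_ne_top.mpr h.conductorOf_ne_top
  tfae_have 3 → 2 := IsCurveOrder.deltaOf_le_conductorOf.trans_lt
  tfae_have 2 → 1 := hA.isCurveOrder_of_deltaOf_lt_top
  tfae_have 1 → 4 := hA.isBirationalExt_of_isCurveOrder
  tfae_have 4 → 1 := hA.isCurveOrder_of_isBirationalExt
  tfae_have 1 → 5 := hA.isNormalizationExt_of_isCurveOrder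
  tfae_have 5 → 1 := hA.isCurveOrder_of_isNormalizationExt
  tfae_finish

lemma deltaInvariant_eq (h : IsCurveOrder k r A) :
    deltaInvariant k A = deltaOf k A (Fin r → k⟦X⟧) := by
  obtain ⟨e⟩ := hA.isNormalizationExt_of_isCurveOrder h
  exact (deltaOf_congr k e).symm

lemma conductorInvariant_eq (h : IsCurveOrder k r A) :
    conductorInvariant k A = conductorOf k A (Fin r → k⟦X⟧) := by
  obtain ⟨e⟩ := hA.isNormalizationExt_of_isCurveOrder h
  exact (conductorOf_congr k e).symm

end IsCurveAlgebra

end Normalization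

/-! ### Permanence of adic precompleteness -/

section AdicCompleteness

lemma IsPrecomplete.pi_of_fintype {S : Type u} [CommRing S] (I : Ideal S) [IsPrecomplete I S]
    (ι : Type v) [Fintype ι] : IsPrecomplete I (ι → S) := by
  classical
  refine ⟨fun f hf ↦ ?_⟩
  have h (i : ι) : ∃ L : S, ∀ n, f n i ≡ L [SMOD (I ^ n • ⊤ : Submodule S S)] := by
    refine IsPrecomplete.prec ‹_› (f := fun n ↦ f n i) fun {m n} hmn ↦ ?_
    exact ((hf hmn).map (LinearMap.proj i)).mono
      ((Submodule.map_smul'' _ _ _).le.trans (Submodule.smul_mono le_rfl le_top))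
  choose L hL using h
  refine ⟨L, fun n ↦ ?_⟩
  rw [SModEq.sub_mem, ← Finset.univ_sum_single (f n - L)]
  refine Submodule.sum_mem _ fun i _ ↦ ?_
  have h1 := SModEq.sub_mem.mp (hL i n)
  have h2 := Submodule.mem_map_of_mem (f := LinearMap.single S (fun _ : ι ↦ S) i) h1
  rw [Submodule.map_smul''] at h2
  exact Submodule.smul_mono le_rfl le_top h2

lemma IsPrecomplete.of_surjective_linearMap {S : Type u} [CommRing S] {I : Ideal S} {M N : Type v}
    [AddCommGroup M] [Module S M] [AddCommGroup N] [Module S N] [IsPrecomplete I M]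
    {f : M →ₗ[S] N} (hf : Function.Surjective f) : IsPrecomplete I N := by
  rw [← AdicCompletion.of_surjective_iff]
  intro y
  obtain ⟨x, rfl⟩ := AdicCompletion.map_surjective I hf y
  obtain ⟨x, rfl⟩ := AdicCompletion.of_surjective I M x
  exact ⟨f x, by rw [AdicCompletion.map_of]⟩

end AdicCompleteness

/-! ### Finiteness over a complete subring -/

section Finiteness

open PowerSeries TotalLaurent

variable {k : Type u} [Field k] {r : ℕ}

lemma X_pow_dvd_sub_sum (f : k⟦X⟧) (m : ℕ) :
    X ^ m ∣ f - ∑ i : Fin m, coeff i f • (X : k⟦X⟧) ^ (i : ℕ) := by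
  rw [X_pow_dvd_iff]
  intro e he
  rw [map_sub, map_sum, Finset.sum_eq_single ⟨e, he⟩]
  · simp [coeff_X_pow]
  · intro i _ hi
    have : e ≠ i := fun h ↦ hi (Fin.ext h.symm)
    simp [coeff_X_pow, this]
  · simp

/-- The complete form of Nakayama: generators modulo `s` generate a separated module over a complete
ring. -/
lemma finite_of_isPrecomplete {S : Type u} [CommRing S] [Algebra k S] [Algebra S (Fin r → k⟦X⟧)]
    [IsScalarTower k S (Fin r → k⟦X⟧)] (s : S) [IsPrecomplete (Ideal.span {s}) S]
    (h : ∀ j, algebraMap S (Fin r → k⟦X⟧) s j ≠ 0 ∧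
      constantCoeff (algebraMap S (Fin r → k⟦X⟧) s j) = 0) :
    Module.Finite S (Fin r → k⟦X⟧) := by
  have hpow (n : ℕ) (f : Fin r → k⟦X⟧) :
      f ∈ (Ideal.span {s} ^ n • ⊤ : Submodule S (Fin r → k⟦X⟧)) ↔ ∃ g, s ^ n • g = f := by
    rw [Ideal.span_singleton_pow, Submodule.ideal_span_singleton_smul,
      Submodule.mem_smul_pointwise_iff_exists]
    simp
  have : IsHausdorff (Ideal.span {s}) (Fin r → k⟦X⟧) := by
    refine ⟨fun f hf ↦ funext fun j ↦ ?_⟩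
    by_contra hne
    obtain ⟨m, hm⟩ := exists_dvd_X_pow hne
    obtain ⟨g, hg⟩ := (hpow _ _).mp (SModEq.zero.mp (hf (m + 1)))
    have h1 : X ^ (m + 1) ∣ f j := by
      rw [← hg, Algebra.smul_def, map_pow, Pi.mul_apply, Pi.pow_apply]
      exact (pow_dvd_pow_of_dvd (X_dvd_iff.mpr (h j).2) _).mul_right _
    have := (pow_dvd_pow_iff (X_ne_zero (R := k)) PowerSeries.X_prime.not_isUnit).mp (h1.trans hm)
    omega
  choose m hm using fun j ↦ exists_dvd_X_pow (h j).1
  -- With this exponent `s` divides `X ^ M` on every branch, so the monomials of degree below `M`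
  -- generate modulo `s`.
  let M := ∑ j, m j
  have hM (j : Fin r) : algebraMap S (Fin r → k⟦X⟧) s j ∣ X ^ M :=
    (hm j).trans (pow_dvd_pow X (Finset.single_le_sum (fun _ _ ↦ Nat.zero_le _) (Finset.mem_univ j)))
  have := IsPrecomplete.pi_of_fintype (Ideal.span {s}) (Fin r × Fin M)
  let F : (Fin r × Fin M → S) →ₗ[S] (Fin r → k⟦X⟧) :=
    Fintype.linearCombination S fun p ↦ Pi.single p.1 (X ^ (p.2 : ℕ))
  have hF : Function.Surjective F := by
    refine surjective_of_mkQ_comp_surjective (I := Ideal.span {s}) fun q ↦ ?_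
    obtain ⟨f, rfl⟩ := Submodule.mkQ_surjective _ q
    have h1 (j : Fin r) : algebraMap S (Fin r → k⟦X⟧) s j ∣
        f j - ∑ i : Fin M, coeff i (f j) • (X : k⟦X⟧) ^ (i : ℕ) :=
      (hM j).trans (X_pow_dvd_sub_sum _ _)
    choose g hg using h1
    refine ⟨fun p ↦ algebraMap k S (coeff p.2 (f p.1)), ?_⟩
    rw [LinearMap.comp_apply, eq_comm, ← sub_eq_zero, ← map_sub, Submodule.mkQ_apply,
      Submodule.Quotient.mk_eq_zero, ← pow_one (Ideal.span {s}), hpow]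
    refine ⟨g, funext fun j ↦ ?_⟩
    rw [pow_one, Algebra.smul_def, Pi.mul_apply, ← hg, Pi.sub_apply]
    congr 1
    simp only [F, Fintype.linearCombination_apply, algebraMap_smul, Fintype.sum_prod_type,
      Finset.sum_apply, Pi.smul_apply]
    rw [Finset.sum_eq_single j]
    · simp
    · intro i _ hij
      simp [hij.symm]
    · simp
  exact Module.Finite.of_surjective F hF

end Finiteness

/-! ### Power series in several variables and their morphisms to `k⟦t⟧` -/

section MvPowerSeriesBasics

open MvPowerSeries

variable {k : Type u} [Field k] {n : ℕ}

/-- A power series without constant term is a combination of the variables. -/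
lemma MvPowerSeries.exists_eq_sum_X_mul {f : MvPowerSeries (Fin n) k}
    (hf : constantCoeff f = 0) : ∃ g : Fin n → MvPowerSeries (Fin n) k, f = ∑ i, X i * g i := by
  classical
  have h1 (d : Fin n →₀ ℕ) : ∃ i : Option (Fin n), (d = 0 ∧ i = none) ∨ ∃ j, i = some j ∧ d j ≠ 0 := by
    by_cases hd : d = 0
    · exact ⟨none, Or.inl ⟨hd, rfl⟩⟩
    · obtain ⟨j, hj⟩ := Finsupp.ne_iff.mp hd
      exact ⟨some j, Or.inr ⟨j, rfl, hj⟩⟩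
  -- `c` assigns to each nonconstant monomial one variable dividing it, which splits `f` into pieces
  -- divisible by single variables.
  choose c hc using h1
  let F : Fin n → MvPowerSeries (Fin n) k := fun i d ↦ if c d = some i then coeff d f else 0
  have hF (i : Fin n) (d : Fin n →₀ ℕ) : coeff d (F i) = if c d = some i then coeff d f else 0 := rfl
  have hdvd (i : Fin n) : X i ∣ F i := by
    rw [X_dvd_iff]
    intro d hd
    rw [hF, if_neg]
    intro h
    rcases hc d with ⟨-, h2⟩ | ⟨j, h2, h3⟩
    · simp [h2] at h
    · rw [h2, Option.some_inj] at h
      exact h3 (h ▸ hd)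
  choose g hg using hdvd
  refine ⟨g, ?_⟩
  simp only [← hg]
  ext d
  simp only [map_sum, hF]
  rcases hc d with ⟨rfl, h2⟩ | ⟨j, h2, h3⟩
  · simpa [h2] using hf
  · simp [h2]

lemma MvPowerSeries.mem_maximalIdeal_iff {f : MvPowerSeries (Fin n) k} :
    f ∈ IsLocalRing.maximalIdeal (MvPowerSeries (Fin n) k) ↔ constantCoeff f = 0 := by
  rw [IsLocalRing.mem_maximalIdeal, mem_nonunits_iff, isUnit_iff_constantCoeff, isUnit_iff_ne_zero,
    not_not]

lemma MvPowerSeries.span_range_X : Ideal.span (Set.range X) =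
    IsLocalRing.maximalIdeal (MvPowerSeries (Fin n) k) := by
  apply le_antisymm
  · rw [Ideal.span_le]
    rintro _ ⟨i, rfl⟩
    exact mem_maximalIdeal_iff.mpr (constantCoeff_X i)
  · intro f hf
    obtain ⟨g, rfl⟩ := exists_eq_sum_X_mul (mem_maximalIdeal_iff.mp hf)
    exact Ideal.sum_mem _ fun i _ ↦ Ideal.mul_mem_right _ _ (Ideal.subset_span ⟨i, rfl⟩)

/-- Otherwise subtracting the constant term of `ψ f` from `f` leaves a unit whose image has no
constant term. -/
lemma constantCoeff_algHom (ψ : MvPowerSeries (Fin n) k →ₐ[k] PowerSeries k)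
    (f : MvPowerSeries (Fin n) k) :
    PowerSeries.constantCoeff (ψ f) = constantCoeff f := by
  by_contra h
  have h1 : IsUnit (f - algebraMap k _ (PowerSeries.constantCoeff (ψ f))) := by
    rw [isUnit_iff_constantCoeff, isUnit_iff_ne_zero, map_sub, sub_ne_zero]
    simpa [MvPowerSeries.algebraMap_apply] using Ne.symm h
  have h2 := (h1.map ψ).map PowerSeries.constantCoeff
  simp at h2

/-- A morphism of `k`-algebras from a ring of formal power series to `k⟦t⟧` is determined by the
images of the variables. -/
lemma algHom_ext_of_X {ψ ψ' : MvPowerSeries (Fin n) k →ₐ[k] PowerSeries k}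
    (h : ∀ i, ψ (X i) = ψ' (X i)) : ψ = ψ' := by
  -- No continuity is assumed: each variable maps into `(t)`, so writing `f` as a constant plus a
  -- combination of variables gains one order of agreement.
  have key (N : ℕ) (f : MvPowerSeries (Fin n) k) : PowerSeries.X ^ N ∣ ψ f - ψ' f := by
    induction N generalizing f with
    | zero => simp
    | succ N ih =>
      obtain ⟨g, hg⟩ := exists_eq_sum_X_mul (f := f - algebraMap k _ (constantCoeff f))
        (by simp [MvPowerSeries.algebraMap_apply])
      have h1 : ψ f - ψ' f = ∑ i, ψ (X i) * (ψ (g i) - ψ' (g i)) := by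
        rw [eq_add_of_sub_eq hg]
        simp only [map_add, map_sum, map_mul, AlgHom.commutes, add_sub_add_right_eq_sub,
          ← Finset.sum_sub_distrib, ← h, mul_sub]
      rw [h1]
      refine Finset.dvd_sum fun i _ ↦ ?_
      rw [pow_succ']
      exact mul_dvd_mul (PowerSeries.X_dvd_iff.mpr (by rw [constantCoeff_algHom, constantCoeff_X]))
        (ih _)
  ext1 f
  rw [← sub_eq_zero]
  ext e
  exact PowerSeries.X_pow_dvd_iff.mp (key (e + 1) f) e (Nat.lt_succ_self e)

end MvPowerSeriesBasics

/-! ### Dimension and Noetherianity -/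

section CurveAlgebraRing

open PowerSeries TotalLaurent

variable {k : Type u} [Field k] {r : ℕ}

/-- `P` contains a power of the uniformizer, hence the uniformizer, hence the kernel of evaluation
at the closed point, which is maximal. -/
lemma isMaximal_of_ker_evalRingHom_lt {P : Ideal (Fin r → k⟦X⟧)} [P.IsPrime] {j : Fin r}
    (h : RingHom.ker (Pi.evalRingHom (fun _ : Fin r ↦ k⟦X⟧) j) < P) : P.IsMaximal := by
  obtain ⟨f, hf, hf0⟩ := SetLike.exists_of_lt h
  obtain ⟨m, g, hg⟩ := exists_dvd_X_pow (f := f j) hf0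
  have h1 : (fun _ ↦ X : Fin r → k⟦X⟧) ∈ P := by
    refine ‹P.IsPrime›.mem_of_pow_mem m ((P.sub_mem_iff_left (y := f * fun _ ↦ g)
      (P.mul_mem_right _ hf)).mp (h.le ?_))
    simp [RingHom.mem_ker, hg]
  let ev : (Fin r → k⟦X⟧) →+* k :=
    (constantCoeff (R := k)).comp (Pi.evalRingHom (fun _ : Fin r ↦ k⟦X⟧) j)
  have hev : Function.Surjective ev := fun c ↦ ⟨fun _ ↦ C c, by simp [ev]⟩
  have hmax : (RingHom.ker ev).IsMaximal := RingHom.ker_isMaximal_of_surjective ev hev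
  have hle : RingHom.ker ev ≤ P := by
    intro a ha
    obtain ⟨b, hb⟩ := X_dvd_iff.mpr (show constantCoeff (a j) = 0 from ha)
    refine (P.sub_mem_iff_left (y := (fun _ ↦ X) * fun _ ↦ b) (P.mul_mem_right _ h1)).mp
      (h.le ?_)
    simp [RingHom.mem_ker, hb]
  exact hmax.eq_of_le ‹P.IsPrime›.ne_top hle ▸ hmax

variable {A : Type u} [CommRing A] [Algebra k A]
  [Algebra A (Fin r → k⟦X⟧)] [IsScalarTower k A (Fin r → k⟦X⟧)]

lemma IsCurveAlgebra.ringKrullDim_eq_one (hA : IsCurveAlgebra k r A) : ringKrullDim A = 1 := by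
  have := hA.finite
  have hbranch (P : Ideal A) [P.IsPrime] : ∃ j, branchIdeal k r A j ≤ P := by
    obtain ⟨Q, hQ, hle⟩ := Ideal.exists_minimalPrimes_le (bot_le : ⊥ ≤ P)
    have hQ' : Q ∈ minimalPrimes A := hQ
    rw [hA.minimalPrimes_eq] at hQ'
    obtain ⟨j, rfl⟩ := hQ'
    exact ⟨j, hle⟩
  apply le_antisymm
  · have : Ring.KrullDimLE 1 A := by
      refine Ring.KrullDimLE.mk₁ fun P hP ↦ ?_
      obtain ⟨j, hj⟩ := hbranch P
      obtain ⟨P', hle, hP', rfl⟩ := Ideal.exists_ideal_over_prime_of_isIntegral P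
        (RingHom.ker (Pi.evalRingHom (fun _ : Fin r ↦ k⟦X⟧) j)) hj
      rcases hle.eq_or_lt with rfl | hlt
      · left
        rw [hA.minimalPrimes_eq]
        exact ⟨j, rfl⟩
      · right
        have := isMaximal_of_ker_evalRingHom_lt hlt
        exact Ideal.isMaximal_comap_of_isIntegral_of_isMaximal P'
    exact_mod_cast (Order.krullDimLE_iff 1 _).mp this
  · obtain ⟨z, hz⟩ := hA.exists_parameter
    let j : Fin r := ⟨0, hA.pos⟩
    let ev : A →+* k := ((constantCoeff (R := k)).comp
      (Pi.evalRingHom (fun _ : Fin r ↦ k⟦X⟧) j)).comp (algebraMap A (Fin r → k⟦X⟧))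
    have hle : branchIdeal k r A j ≤ RingHom.ker ev := by
      intro a ha
      have ha' : algebraMap A (Fin r → k⟦X⟧) a j = 0 := ha
      simp [RingHom.mem_ker, ev, ha']
    have hev : z ∈ RingHom.ker ev := (hz j).2
    exact Order.one_le_krullDim_iff.mpr ⟨⟨branchIdeal k r A j, inferInstance⟩,
      ⟨RingHom.ker ev, RingHom.ker_isPrime ev⟩, lt_of_le_not_ge hle fun h ↦ (hz j).1 (h hev)⟩

/-- `A` embeds as an `S`-submodule in a finite module over the Noetherian ring `S`. -/
lemma finite_and_isNoetherianRing {S : Type u} [CommRing S] [IsNoetherianRing S] [Algebra k S]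
    (s : S) [IsPrecomplete (Ideal.span {s}) S] (σ : S →ₐ[k] A)
    (hinj : Function.Injective (algebraMap A (Fin r → k⟦X⟧)))
    (h : ∀ j, algebraMap A (Fin r → k⟦X⟧) (σ s) j ≠ 0 ∧
      constantCoeff (algebraMap A (Fin r → k⟦X⟧) (σ s) j) = 0) :
    Module.Finite A (Fin r → k⟦X⟧) ∧ IsNoetherianRing A := by
  let _ : Algebra S A := σ.toRingHom.toAlgebra
  let _ : Algebra S (Fin r → k⟦X⟧) := ((algebraMap A (Fin r → k⟦X⟧)).comp σ.toRingHom).toAlgebra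
  have : IsScalarTower S A (Fin r → k⟦X⟧) := .of_algebraMap_eq fun _ ↦ rfl
  have : IsScalarTower k S (Fin r → k⟦X⟧) := .of_algebraMap_eq fun c ↦ by
    change _ = algebraMap A (Fin r → k⟦X⟧) (σ (algebraMap k S c))
    rw [AlgHom.commutes, ← IsScalarTower.algebraMap_apply k A]
  have : Module.Finite S (Fin r → k⟦X⟧) := finite_of_isPrecomplete (k := k) s h
  refine ⟨Module.Finite.of_restrictScalars_finite S A _, ?_⟩
  have : IsNoetherian S (Fin r → k⟦X⟧) := isNoetherian_of_isNoetherianRing_of_finite S _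
  have : IsNoetherian S A := isNoetherian_of_injective
    (IsScalarTower.toAlgHom S A (Fin r → k⟦X⟧)).toLinearMap hinj
  exact isNoetherian_of_tower S this

end CurveAlgebraRing

/-! ### From parameterizations to complete curve algebras -/

section Parameterization

open MvPowerSeries

variable {k : Type u} [Field k] {n r : ℕ}
  {φ : MvPowerSeries (Fin n) k →ₐ[k] (Fin r → PowerSeries k)}

namespace IsParameterization

/-- Prime avoidance: no branch kernel contains all the variables, so their union does not contain
the maximal ideal. -/
lemma exists_parameter (hφ : IsParameterization φ) :
    ∃ z, constantCoeff z = 0 ∧ ∀ j, φ z j ≠ 0 := by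
  by_contra! h
  have hsub : (IsLocalRing.maximalIdeal (MvPowerSeries (Fin n) k) :
      Set (MvPowerSeries (Fin n) k)) ⊆
        ⋃ j ∈ ((Finset.univ : Finset (Fin r)) : Set (Fin r)), RingHom.ker (branch φ j) := by
    intro z hz
    obtain ⟨j, hj⟩ := h z (MvPowerSeries.mem_maximalIdeal_iff.mp hz)
    simp only [Set.mem_iUnion]
    exact ⟨j, Finset.mem_coe.mpr (Finset.mem_univ j), hj⟩
  have j₀ : Fin r := ⟨0, hφ.pos⟩
  obtain ⟨j, -, hj⟩ := (Ideal.subset_union_prime j₀ j₀ fun j _ _ _ ↦ RingHom.ker_isPrime _).mp hsub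
  obtain ⟨i, hi⟩ := (hφ.isBranch j).2
  exact hi (hj (MvPowerSeries.mem_maximalIdeal_iff.mpr (constantCoeff_X i)))

variable {A : Type u} [CommRing A] [Algebra k A] [Algebra A (Fin r → PowerSeries k)]
  [IsScalarTower k A (Fin r → PowerSeries k)] {π : MvPowerSeries (Fin n) k →ₐ[k] A}

lemma finite_and_isNoetherianRing (hφ : IsParameterization φ)
    (hinj : Function.Injective (algebraMap A (Fin r → PowerSeries k)))
    (hcomp : ∀ f, algebraMap A (Fin r → PowerSeries k) (π f) = φ f) :
    Module.Finite A (Fin r → PowerSeries k) ∧ IsNoetherianRing A := by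
  obtain ⟨z, hz, hzj⟩ := hφ.exists_parameter
  have hs := PowerSeries.HasSubst.of_constantCoeff_zero (S := k) hz
  refine _root_.finite_and_isNoetherianRing (PowerSeries.X : PowerSeries k)
    (π.comp (PowerSeries.substAlgHom (R := k) hs)) hinj fun j ↦ ?_
  rw [AlgHom.comp_apply, PowerSeries.substAlgHom_X, hcomp]
  refine ⟨hzj j, ?_⟩
  exact (constantCoeff_algHom (branch φ j) z).trans hz

lemma isCurveAlgebra (hφ : IsParameterization φ) (hπ : Function.Surjective π)
    (hinj : Function.Injective (algebraMap A (Fin r → PowerSeries k)))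
    (hcomp : ∀ f, algebraMap A (Fin r → PowerSeries k) (π f) = φ f) : IsCurveAlgebra k r A := by
  refine ⟨hφ.pos, hinj, fun a i j ↦ ?_, (hφ.finite_and_isNoetherianRing hinj hcomp).1, ?_,
    fun i j hij h ↦ hφ.distinct i j hij ?_⟩
  · obtain ⟨f, rfl⟩ := hπ a
    rw [hcomp]
    exact (constantCoeff_algHom (branch φ i) f).trans (constantCoeff_algHom (branch φ j) f).symm
  · obtain ⟨z, hz, hzj⟩ := hφ.exists_parameter
    refine ⟨π z, fun j ↦ ?_⟩
    rw [hcomp]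
    exact ⟨hzj j, (constantCoeff_algHom (branch φ j) z).trans hz⟩
  · ext f
    have h1 := SetLike.ext_iff.mp h (π f)
    rwa [mem_branchIdeal, mem_branchIdeal, hcomp] at h1

lemma isCompleteLocal [Nontrivial A] [IsNoetherianRing A] (hπ : Function.Surjective π) :
    IsCompleteLocal A := by
  have hloc : IsLocalRing A := IsLocalRing.of_surjective' π.toRingHom hπ
  refine ⟨hloc, ?_⟩
  let _ : Algebra (MvPowerSeries (Fin n) k) A := π.toRingHom.toAlgebra
  have hmap : IsLocalRing.maximalIdeal A = (Ideal.span (Set.range X)).map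
      (algebraMap (MvPowerSeries (Fin n) k) A) := by
    rw [MvPowerSeries.span_range_X]
    exact (IsLocalRing.map_maximalIdeal_of_surjective π.toRingHom hπ).symm
  have h1 : IsPrecomplete (Ideal.span (Set.range (X : Fin n → MvPowerSeries (Fin n) k))) A :=
    IsPrecomplete.of_surjective_linearMap (f := Algebra.linearMap (MvPowerSeries (Fin n) k) A) hπ
  have h2 : IsPrecomplete (IsLocalRing.maximalIdeal A) A := by
    rw [hmap]
    exact IsPrecomplete.map_algebraMap_iff.mpr h1
  -- Separatedness is Krull's intersection theorem.
  exact { }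

end IsParameterization

end Parameterization

/-! ### Quotients of elements of a subring of `k⟦t⟧` and their uniformizer -/

section FractionClosure

open PowerSeries

variable {k : Type u} [Field k]

/-- Iterating `g = g(0) + s g'` produces the coefficients of `h`. Equality follows from agreement
modulo every power of `X`. -/
lemma exists_subst_eq {V : Set k⟦X⟧} {s : k⟦X⟧} (hs : constantCoeff s = 0)
    (hV : ∀ g ∈ V, ∃ g' ∈ V, g = C (constantCoeff g) + s * g') {g : k⟦X⟧} (hg : g ∈ V) :
    ∃ h : k⟦X⟧, h.subst s = g ∧ constantCoeff h = constantCoeff g := by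
  have hsub : HasSubst s := HasSubst.of_constantCoeff_zero' hs
  choose! next hnext heq using hV
  let H : k⟦X⟧ → k⟦X⟧ := fun g ↦ PowerSeries.mk fun i ↦ constantCoeff (next^[i] g)
  have hH (g : k⟦X⟧) : H g = X * H (next g) + C (constantCoeff g) := by
    rw [PowerSeries.eq_X_mul_shift_add_const (H g)]
    congr 2
    ext
    simp [H]
  have hHsub (g : k⟦X⟧) : (H g).subst s = s * (H (next g)).subst s + C (constantCoeff g) := by
    conv_lhs => rw [hH g]
    rw [subst_add hsub, subst_mul hsub, subst_X hsub, subst_C]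
    rfl
  have key (N : ℕ) (g : k⟦X⟧) (hg : g ∈ V) : X ^ N ∣ g - (H g).subst s := by
    induction N generalizing g with
    | zero => simp
    | succ N ih =>
      have h1 : g - (H g).subst s = s * (next g - (H (next g)).subst s) := by
        rw [hHsub g]
        linear_combination heq g hg
      rw [h1, pow_succ']
      exact mul_dvd_mul (X_dvd_iff.mpr hs) (ih _ (hnext g hg))
  refine ⟨H g, ?_, by rw [hH]; simp⟩
  rw [eq_comm, ← sub_eq_zero]
  ext e
  exact X_pow_dvd_iff.mp (key (e + 1) g hg) e (Nat.lt_succ_self e)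

variable (k) (P : Type u) [CommRing P] [Algebra k P] [Algebra P k⟦X⟧] [IsScalarTower k P k⟦X⟧]

/-- The power series that are quotients of elements of the image of `P`. -/
def fractionClosure : Subalgebra P k⟦X⟧ where
  carrier := {g | ∃ a b : P, algebraMap P k⟦X⟧ b ≠ 0 ∧ algebraMap P k⟦X⟧ b * g = algebraMap P k⟦X⟧ a}
  mul_mem' := by
    rintro g g' ⟨a, b, hb, h⟩ ⟨a', b', hb', h'⟩
    refine ⟨a * a', b * b', ?_, ?_⟩
    · rw [map_mul]
      exact mul_ne_zero hb hb'
    · rw [map_mul, map_mul, ← h, ← h']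
      ring
  add_mem' := by
    rintro g g' ⟨a, b, hb, h⟩ ⟨a', b', hb', h'⟩
    refine ⟨a * b' + a' * b, b * b', ?_, ?_⟩
    · rw [map_mul]
      exact mul_ne_zero hb hb'
    · rw [map_add, map_mul, map_mul, map_mul, ← h, ← h']
      ring
  algebraMap_mem' p := ⟨p, 1, by simp, by simp⟩

variable {k P}

lemma mem_fractionClosure {g : k⟦X⟧} : g ∈ fractionClosure k P ↔
    ∃ a b : P, algebraMap P k⟦X⟧ b ≠ 0 ∧ algebraMap P k⟦X⟧ b * g = algebraMap P k⟦X⟧ a := Iff.rfl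

lemma mem_fractionClosure_of_mul_mem {s g : k⟦X⟧} (hs : s ∈ fractionClosure k P) (hs0 : s ≠ 0)
    (h : s * g ∈ fractionClosure k P) : g ∈ fractionClosure k P := by
  obtain ⟨a, b, hb, hab⟩ := hs
  obtain ⟨a', b', hb', hab'⟩ := h
  refine ⟨b * a', b' * a, ?_, ?_⟩
  · rw [map_mul, ← hab]
    exact mul_ne_zero hb' (mul_ne_zero hb hs0)
  · rw [map_mul, map_mul, ← hab, ← hab']
    ring

lemma C_mem_fractionClosure (c : k) : C c ∈ fractionClosure k P := by
  have h : C c = algebraMap P k⟦X⟧ (algebraMap k P c) := by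
    rw [← IsScalarTower.algebraMap_apply k P k⟦X⟧]
    rfl
  rw [h]
  exact (fractionClosure k P).algebraMap_mem _

/-- The fraction closure has a uniformizer. -/
lemma exists_uniformizer_fractionClosure
    (h : ∃ p : P, algebraMap P k⟦X⟧ p ≠ 0 ∧ constantCoeff (algebraMap P k⟦X⟧ p) = 0) :
    ∃ s ∈ fractionClosure k P, s ≠ 0 ∧ constantCoeff s = 0 ∧
      ∀ g ∈ fractionClosure k P, ∃ g' ∈ fractionClosure k P, g = C (constantCoeff g) + s * g' := by
  classical
  have hne {g u : k⟦X⟧} {m : ℕ} (hg : constantCoeff g = 0) (h : g * u = X ^ m) : m ≠ 0 := by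
    rintro rfl
    simpa [hg] using congrArg constantCoeff h
  -- The uniformizer is an element of least positive order.
  have hex : ∃ m : ℕ, m ≠ 0 ∧ ∃ s ∈ fractionClosure k P, ∃ u : k⟦X⟧ˣ, s * (u : k⟦X⟧) = X ^ m := by
    obtain ⟨p, hp, hp0⟩ := h
    obtain ⟨m, u, hu⟩ := exists_X_pow_mul_unit hp
    exact ⟨m, hne hp0 hu, _, (fractionClosure k P).algebraMap_mem p, u, hu⟩
  obtain ⟨hm, s, hs, u, hu⟩ := Nat.find_spec hex
  have hs0 : s ≠ 0 := by
    rintro rfl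
    rw [zero_mul] at hu
    exact pow_ne_zero _ X_ne_zero hu.symm
  have hsc : constantCoeff s = 0 := by
    have h1 := congrArg constantCoeff hu
    rw [map_mul, map_pow, constantCoeff_X, zero_pow hm] at h1
    exact (mul_eq_zero.mp h1).resolve_right (u.isUnit.map constantCoeff).ne_zero
  refine ⟨s, hs, hs0, hsc, fun g hg ↦ ?_⟩
  have hmem : g - C (constantCoeff g) ∈ fractionClosure k P := sub_mem hg (C_mem_fractionClosure _)
  have hdvd : s ∣ g - C (constantCoeff g) := by
    by_cases h0 : g - C (constantCoeff g) = 0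
    · rw [h0]
      exact dvd_zero s
    obtain ⟨m', u', hu'⟩ := exists_X_pow_mul_unit h0
    have hle := Nat.find_min' hex ⟨hne (by simp) hu', _, hmem, u', hu'⟩
    have h1 := ((Dvd.intro _ hu).trans (pow_dvd_pow X hle)).trans hu'.symm.dvd
    exact (Units.isUnit u').dvd_mul_right.mp h1
  obtain ⟨g', hg'⟩ := hdvd
  exact ⟨g', mem_fractionClosure_of_mul_mem hs hs0 (hg' ▸ hmem), by rw [← hg']; ring⟩

/-- An element of order one approximates any series to any order. Past the order of some `p` in the
maximal ideal, the error lies in the maximal ideal times `k⟦t⟧`, and Nakayama applies. -/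
lemma fractionClosure_eq_top [IsLocalRing P] [Module.Finite P k⟦X⟧]
    (h : ∃ p ∈ IsLocalRing.maximalIdeal P, algebraMap P k⟦X⟧ p ≠ 0) {s : k⟦X⟧}
    (hs : s ∈ fractionClosure k P)
    (hsc : constantCoeff s = 0) (hs1 : s ∣ X) : fractionClosure k P = ⊤ := by
  have key (N : ℕ) (g : k⟦X⟧) : ∃ v ∈ fractionClosure k P, X ^ N ∣ g - v := by
    obtain ⟨t, ht⟩ := hs1
    induction N generalizing g with
    | zero => exact ⟨0, zero_mem _, by simp⟩
    | succ N ih =>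
      obtain ⟨g', hg'⟩ := X_dvd_iff.mpr (show constantCoeff (g - C (constantCoeff g)) = 0 by simp)
      obtain ⟨v, hv, hdvd⟩ := ih (t * g')
      refine ⟨C (constantCoeff g) + s * v, add_mem (C_mem_fractionClosure _) (mul_mem hs hv), ?_⟩
      have h1 : g - (C (constantCoeff g) + s * v) = s * (t * g' - v) := by
        rw [← sub_sub, hg', mul_sub, ← mul_assoc, ← ht]
      rw [h1, pow_succ']
      exact mul_dvd_mul (X_dvd_iff.mpr hsc) hdvd
  obtain ⟨p, hp, hp0⟩ := h
  obtain ⟨N, hN⟩ := exists_dvd_X_pow hp0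
  have hle : (⊤ : Submodule P k⟦X⟧) ≤ Subalgebra.toSubmodule (fractionClosure k P) := by
    refine Submodule.le_of_le_smul_of_le_jacobson_bot Module.Finite.fg_top
      (IsLocalRing.maximalIdeal_le_jacobson ⊥) fun g _ ↦ ?_
    obtain ⟨v, hv, hdvd⟩ := key N g
    obtain ⟨c, hc⟩ := hN.trans hdvd
    refine Submodule.mem_sup.mpr ⟨v, hv, p • c, Submodule.smul_mem_smul hp Submodule.mem_top, ?_⟩
    rw [Algebra.smul_def, ← hc]
    ring
  exact eq_top_iff.mpr fun g _ ↦ hle (Submodule.mem_top : g ∈ ⊤)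

lemma exists_mul_mem_range_of_fractionClosure_eq_top [Module.Finite P k⟦X⟧]
    (h : fractionClosure k P = ⊤) :
    ∃ f : k⟦X⟧, f ≠ 0 ∧ ∀ g, ∃ p : P, algebraMap P k⟦X⟧ p = f * g := by
  have : (RingHom.ker (algebraMap P k⟦X⟧)).IsPrime := RingHom.ker_isPrime _
  obtain ⟨b, hb, hbg⟩ := exists_smul_mem_of_finite (M := k⟦X⟧)
    (RingHom.ker (algebraMap P k⟦X⟧)).primeCompl (imageIn P k⟦X⟧) fun g ↦ by
      obtain ⟨a, b, hb, hab⟩ := mem_fractionClosure.mp (h ▸ Algebra.mem_top : g ∈ fractionClosure k P)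
      exact ⟨b, hb, a, by rw [Algebra.smul_def, hab]; rfl⟩
  refine ⟨_, hb, fun g ↦ ?_⟩
  obtain ⟨p, hp⟩ := hbg g
  exact ⟨p, by rw [← Algebra.smul_def, ← hp]; rfl⟩

end FractionClosure

/-! ### Primitive branches -/

section Primitive

open PowerSeries

variable {k : Type u} [Field k]

lemma exists_order_subst {τ : k⟦X⟧} (hτ : constantCoeff τ = 0) {h : k⟦X⟧} (hh : h ≠ 0) :
    ∃ a : ℕ, PowerSeries.order (h.subst τ) = a * τ.order := by
  have hsub : HasSubst τ := HasSubst.of_constantCoeff_zero' hτ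
  obtain ⟨a, u, hu⟩ := exists_X_pow_mul_unit hh
  refine ⟨a, ?_⟩
  let S : k⟦X⟧ →ₐ[k] k⟦X⟧ := substAlgHom hsub
  have hS (f : k⟦X⟧) : S f = f.subst τ := congrFun (coe_substAlgHom hsub) f
  have h1 : S h * S u = τ ^ a := by
    rw [← map_mul, hu, map_pow]
    congr 1
    exact substAlgHom_X hsub
  have h2 : (S u).order = 0 := order_zero_of_unit (u.isUnit.map S)
  rw [← hS, ← nsmul_eq_mul, ← order_pow, ← h1, order_mul, h2, add_zero]

variable {n : ℕ} {ψ : MvPowerSeries (Fin n) k →ₐ[k] k⟦X⟧}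

/-- All orders of nonzero elements of the image are multiples of the order of `τ`; the image
contains `f` and `f X`, whose orders differ by one. -/
lemma IsBranchParameterization.isPrimitiveBranch (hψ : IsBranchParameterization ψ)
    (h : ∃ f : k⟦X⟧, f ≠ 0 ∧ ∀ g, ∃ p, ψ p = f * g) : IsPrimitiveBranch ψ := by
  intro ψ' τ hτ hX
  have hsub : HasSubst τ := HasSubst.of_constantCoeff_zero' hτ
  have heq (p : MvPowerSeries (Fin n) k) : ψ p = (ψ' p).subst τ := by
    let S : k⟦X⟧ →ₐ[k] k⟦X⟧ := substAlgHom hsub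
    have hS (f : k⟦X⟧) : S f = f.subst τ := congrFun (coe_substAlgHom hsub) f
    have : ψ = S.comp ψ' := algHom_ext_of_X fun i ↦ by
      rw [hX i, AlgHom.comp_apply, hS]
    rw [← hS, ← AlgHom.comp_apply, ← this]
  have hτ0 : τ ≠ 0 := by
    rintro rfl
    obtain ⟨i, hi⟩ := hψ.2
    apply hi
    have h1 : constantCoeff (ψ' (MvPowerSeries.X i)) = 0 := by
      rw [constantCoeff_algHom, MvPowerSeries.constantCoeff_X]
    rw [hX i]
    exact subst_zero_of_constantCoeff_zero h1
  have hord (p : MvPowerSeries (Fin n) k) (hp : ψ p ≠ 0) : ∃ a : ℕ, (ψ p).order = a * τ.order := by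
    rw [heq]
    refine exists_order_subst hτ fun h0 ↦ hp ?_
    rw [heq, h0]
    exact (congrFun (coe_substAlgHom hsub) 0).symm.trans (map_zero (substAlgHom (R := k) hsub))
  obtain ⟨f, hf, hfg⟩ := h
  obtain ⟨p, hp⟩ := hfg 1
  obtain ⟨q, hq⟩ := hfg X
  obtain ⟨a, ha⟩ := hord p (by rw [hp, mul_one]; exact hf)
  obtain ⟨b, hb⟩ := hord q (by rw [hq]; exact mul_ne_zero hf X_ne_zero)
  rw [hp, mul_one] at ha
  rw [hq, order_mul, order_X, ha] at hb
  have hfin : τ.order ≠ ⊤ := order_eq_top.not.mpr hτ0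
  obtain ⟨m, hm⟩ := ENat.ne_top_iff_exists.mp hfin
  rw [← hm] at hb ⊢
  have h1 : a * m + 1 = b * m := by exact_mod_cast hb
  have h2 : m ∣ 1 := (Nat.dvd_add_right (dvd_mul_left m a)).mp (h1 ▸ dvd_mul_left m b)
  exact_mod_cast Nat.dvd_one.mp h2

/-- With `s` a uniformizer of the fraction closure, `ψ` factors through substitution of `s`.
Primitivity makes `s` of order one, so every power series is a quotient of elements of the image,
and finiteness gives a common denominator. -/
lemma IsPrimitiveBranch.exists_mul_mem_range (hprim : IsPrimitiveBranch ψ)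
    (hψ : IsBranchParameterization ψ) (hfin : ψ.toRingHom.Finite) :
    ∃ f : k⟦X⟧, f ≠ 0 ∧ ∀ g, ∃ p, ψ p = f * g := by
  let _ : Algebra (MvPowerSeries (Fin n) k) k⟦X⟧ := ψ.toRingHom.toAlgebra
  have : IsScalarTower k (MvPowerSeries (Fin n) k) k⟦X⟧ :=
    .of_algebraMap_eq fun c ↦ (ψ.commutes c).symm
  have : Module.Finite (MvPowerSeries (Fin n) k) k⟦X⟧ := hfin
  obtain ⟨i, hi⟩ := hψ.2
  obtain ⟨s, hs, hs0, hsc, hexp⟩ := exists_uniformizer_fractionClosure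
    (k := k) (P := MvPowerSeries (Fin n) k) ⟨MvPowerSeries.X i, hi, hψ.1 i⟩
  have h1 (i : Fin n) : ∃ h : k⟦X⟧, h.subst s = ψ (MvPowerSeries.X i) ∧
      constantCoeff h = constantCoeff (ψ (MvPowerSeries.X i)) :=
    exists_subst_eq (V := fractionClosure k (MvPowerSeries (Fin n) k)) hsc hexp
      ((fractionClosure k (MvPowerSeries (Fin n) k)).algebraMap_mem _)
  choose h hh hc using h1
  have hsub : MvPowerSeries.HasSubst (S := k) h :=
    MvPowerSeries.hasSubst_of_constantCoeff_zero fun i ↦ (hc i).trans (hψ.1 i)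
  have hord := hprim (MvPowerSeries.substAlgHom (R := k) hsub) s hsc fun i ↦ by
    rw [MvPowerSeries.substAlgHom_X, hh]
  have hsX : s ∣ X := by
    obtain ⟨m, u, hu⟩ := exists_X_pow_mul_unit hs0
    have h2 := congrArg order hu
    rw [order_mul, hord, order_zero_of_unit u.isUnit, add_zero, order_X_pow] at h2
    have h3 : m = 1 := by exact_mod_cast h2.symm
    rw [h3, pow_one] at hu
    exact Dvd.intro _ hu
  exact exists_mul_mem_range_of_fractionClosure_eq_top (fractionClosure_eq_top
    ⟨MvPowerSeries.X i, MvPowerSeries.mem_maximalIdeal_iff.mpr (MvPowerSeries.constantCoeff_X i), hi⟩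
    hs hsc hsX)

end Primitive

/-! ### The rings `R` and `φ(P)` of a parameterization -/

section CurveRing

open PowerSeries

variable {k : Type u} [Field k] {n r : ℕ}

namespace IsCurveAlgebra

variable {A : Type u} [CommRing A] [Algebra k A] [Algebra A (Fin r → k⟦X⟧)]
  [IsScalarTower k A (Fin r → k⟦X⟧)]

lemma isCurveOrder_iff (hA : IsCurveAlgebra k r A) : IsCurveOrder k r A ↔
    ∀ j, ∃ f : k⟦X⟧, f ≠ 0 ∧ ∀ g, ∃ a : A, algebraMap A (Fin r → k⟦X⟧) a j = f * g := by
  refine ⟨fun h j ↦ ?_, hA.isCurveOrder_of_branch⟩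
  obtain ⟨N, hN⟩ := h.exists_eq_single
  refine ⟨X ^ N, pow_ne_zero _ X_ne_zero, fun g ↦ ?_⟩
  obtain ⟨a, ha⟩ := hN j g
  exact ⟨a, by rw [ha, Pi.single_eq_same]⟩

end IsCurveAlgebra

lemma branchConductor_congr {A A' : Type u} [CommRing A] [Algebra k A] [Algebra A (Fin r → k⟦X⟧)]
    [IsScalarTower k A (Fin r → k⟦X⟧)] [CommRing A'] [Algebra k A'] [Algebra A' (Fin r → k⟦X⟧)]
    [IsScalarTower k A' (Fin r → k⟦X⟧)] (h : branchImage k r A = branchImage k r A') :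
    branchConductor k r A = branchConductor k r A' := by
  ext f
  rw [mem_branchConductor, mem_branchConductor, h]

variable {φ : MvPowerSeries (Fin n) k →ₐ[k] (Fin r → k⟦X⟧)}

instance curveRing.algebra : Algebra (curveRing φ) (Fin r → k⟦X⟧) :=
  (Ideal.Quotient.lift (RingHom.ker φ) φ.toRingHom fun _ h ↦ h).toAlgebra

instance curveRing.isScalarTower : IsScalarTower k (curveRing φ) (Fin r → k⟦X⟧) :=
  IsScalarTower.of_algebraMap_eq (R := k) (S := curveRing φ) (A := Fin r → k⟦X⟧)
    fun c ↦ (φ.commutes c).symm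

lemma curveRing.algebraMap_injective :
    Function.Injective (algebraMap (curveRing φ) (Fin r → k⟦X⟧)) := by
  rw [injective_iff_map_eq_zero]
  intro a ha
  obtain ⟨f, rfl⟩ := Ideal.Quotient.mk_surjective a
  exact Ideal.Quotient.eq_zero_iff_mem.mpr ha

lemma branchImage_curveRing : branchImage k r (curveRing φ) = branchImage k r φ.range := by
  ext f
  rw [mem_branchImage, mem_branchImage]
  constructor
  · rintro ⟨a, rfl⟩
    obtain ⟨p, rfl⟩ := Ideal.Quotient.mk_surjective a
    exact ⟨⟨φ p, p, rfl⟩, rfl⟩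
  · rintro ⟨⟨_, p, rfl⟩, rfl⟩
    exact ⟨Ideal.Quotient.mk _ p, rfl⟩

namespace IsParameterization

lemma isCurveAlgebra_range (hφ : IsParameterization φ) : IsCurveAlgebra k r φ.range :=
  hφ.isCurveAlgebra (π := φ.rangeRestrict) φ.rangeRestrict_surjective Subtype.val_injective
    fun _ ↦ rfl

lemma isCurveAlgebra_curveRing (hφ : IsParameterization φ) : IsCurveAlgebra k r (curveRing φ) :=
  hφ.isCurveAlgebra (π := Ideal.Quotient.mkₐ k _) (Ideal.Quotient.mkₐ_surjective k _)
    curveRing.algebraMap_injective fun _ ↦ rfl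

lemma isNoetherianRing_range (hφ : IsParameterization φ) : IsNoetherianRing φ.range :=
  (hφ.finite_and_isNoetherianRing (π := φ.rangeRestrict) Subtype.val_injective fun _ ↦ rfl).2

lemma isNoetherianRing_curveRing (hφ : IsParameterization φ) : IsNoetherianRing (curveRing φ) :=
  (hφ.finite_and_isNoetherianRing (π := Ideal.Quotient.mkₐ k _) curveRing.algebraMap_injective
    fun _ ↦ rfl).2

lemma finite (hφ : IsParameterization φ) : φ.toRingHom.Finite := by
  have h1 : (algebraMap φ.range (Fin r → k⟦X⟧)).Finite :=
    RingHom.finite_algebraMap.mpr hφ.isCurveAlgebra_range.finite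
  exact h1.comp (RingHom.Finite.of_surjective φ.rangeRestrict.toRingHom φ.rangeRestrict_surjective)

lemma finite_branch (hφ : IsParameterization φ) (j : Fin r) : (branch φ j).toRingHom.Finite :=
  (RingHom.Finite.of_surjective (Pi.evalRingHom (fun _ : Fin r ↦ k⟦X⟧) j)
    (Function.surjective_eval j)).comp hφ.finite

lemma isPrimitiveParameterization_iff (hφ : IsParameterization φ) :
    IsPrimitiveParameterization φ ↔ ∀ j, ∃ f : k⟦X⟧, f ≠ 0 ∧ ∀ g, ∃ p, φ p j = f * g :=
  forall_congr' fun j ↦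
    ⟨fun h ↦ h.exists_mul_mem_range (hφ.isBranch j) (hφ.finite_branch j),
      (hφ.isBranch j).isPrimitiveBranch⟩

lemma isPrimitiveParameterization_iff_range (hφ : IsParameterization φ) :
    IsPrimitiveParameterization φ ↔ IsCurveOrder k r φ.range := by
  rw [hφ.isPrimitiveParameterization_iff, hφ.isCurveAlgebra_range.isCurveOrder_iff]
  refine forall_congr' fun j ↦ exists_congr fun f ↦ and_congr_right fun _ ↦ forall_congr' fun g ↦ ?_
  exact (φ.rangeRestrict_surjective.exists (p := fun a ↦ algebraMap φ.range (Fin r → k⟦X⟧) a j = f * g)).symm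

lemma isPrimitiveParameterization_iff_curveRing (hφ : IsParameterization φ) :
    IsPrimitiveParameterization φ ↔ IsCurveOrder k r (curveRing φ) := by
  rw [hφ.isPrimitiveParameterization_iff, hφ.isCurveAlgebra_curveRing.isCurveOrder_iff]
  refine forall_congr' fun j ↦ exists_congr fun f ↦ and_congr_right fun _ ↦ forall_congr' fun g ↦ ?_
  exact ((Ideal.Quotient.mk_surjective (I := RingHom.ker φ)).exists
    (p := fun a ↦ algebraMap (curveRing φ) (Fin r → k⟦X⟧) a j = f * g)).symm

lemma isCompleteLocal_range (hφ : IsParameterization φ) : IsCompleteLocal φ.range := by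
  have := hφ.isNoetherianRing_range
  have : Nonempty (Fin r) := ⟨0, hφ.pos⟩
  exact isCompleteLocal φ.rangeRestrict_surjective

lemma isCompleteLocal_curveRing (hφ : IsParameterization φ) : IsCompleteLocal (curveRing φ) := by
  have := hφ.isNoetherianRing_curveRing
  have : Nonempty (Fin r) := ⟨0, hφ.pos⟩
  have : Nontrivial (curveRing φ) :=
    Ideal.Quotient.nontrivial_iff.mpr (RingHom.ker_ne_top φ.toRingHom)
  exact isCompleteLocal (Ideal.Quotient.mkₐ_surjective k (RingHom.ker φ))

end IsParameterization

/-- The invariant depends only on the image in the product, which `R` and `φ(P)` share. -/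
lemma deltaOf_curveRing : deltaOf k (curveRing φ) (Fin r → k⟦X⟧) = deltaParam φ := by
  rw [deltaParam, deltaOf_eq_relLength, deltaOf_eq_relLength, branchImage_curveRing]

lemma conductorOf_curveRing : conductorOf k (curveRing φ) (Fin r → k⟦X⟧) = conductorParam φ := by
  rw [conductorParam, conductorOf_eq_length, conductorOf_eq_length,
    branchConductor_congr (branchImage_curveRing (φ := φ))]

end CurveRing

end

theorem mainTheorem4 {k : Type*} [Field k] {n r : ℕ}
    (φ : MvPowerSeries (Fin n) k →ₐ[k] (Fin r → PowerSeries k))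
    (hφ : IsParameterization φ) :
    -- `φ` is finite
    φ.toRingHom.Finite ∧
    -- `R ≅ φ(P)` is a Noetherian reduced complete local ring of dimension `1`
    Nonempty (curveRing φ ≃ₐ[k] φ.range) ∧
    (IsNoetherianRing φ.range ∧ IsReduced φ.range ∧ IsCompleteLocal φ.range ∧
      ringKrullDim φ.range = 1) ∧
    (IsNoetherianRing (curveRing φ) ∧ IsReduced (curveRing φ) ∧ IsCompleteLocal (curveRing φ) ∧
      ringKrullDim (curveRing φ) = 1) ∧
    -- the five equivalent conditions
    List.TFAE
      [IsPrimitiveParameterization φ,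
       deltaParam φ < ⊤,
       conductorParam φ < ⊤,
       IsBirationalExt φ.range (Fin r → PowerSeries k),
       IsNormalizationExt φ.range (Fin r → PowerSeries k)] ∧
    -- the consequences
    (IsPrimitiveParameterization φ →
      deltaInvariant k (curveRing φ) = deltaParam φ ∧
      conductorInvariant k (curveRing φ) = conductorParam φ ∧
      deltaInvariant k (curveRing φ) ≤ conductorInvariant k (curveRing φ) ∧
      conductorInvariant k (curveRing φ) ≤ 2 * deltaInvariant k (curveRing φ) ∧
      (conductorInvariant k (curveRing φ) = 2 * deltaInvariant k (curveRing φ) ↔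
        IsGorensteinLocal (curveRing φ))) := by
  have hc := hφ.isCurveAlgebra_curveRing
  have hr := hφ.isCurveAlgebra_range
  refine ⟨hφ.finite, ⟨Ideal.quotientKerEquivRange φ⟩,
    ⟨hφ.isNoetherianRing_range, isReduced_of_injective _ hr.injective,
      hφ.isCompleteLocal_range, hr.ringKrullDim_eq_one⟩,
    ⟨hφ.isNoetherianRing_curveRing, isReduced_of_injective _ hc.injective,
      hφ.isCompleteLocal_curveRing, hc.ringKrullDim_eq_one⟩, ?_, fun hprim ↦ ?_⟩
  · rw [hφ.isPrimitiveParameterization_iff_range]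
    exact hr.tfae
  · have ho := hφ.isPrimitiveParameterization_iff_curveRing.mp hprim
    have := hφ.isNoetherianRing_curveRing
    obtain ⟨_, -⟩ := hφ.isCompleteLocal_curveRing
    rw [hc.deltaInvariant_eq ho, hc.conductorInvariant_eq ho]
    exact ⟨deltaOf_curveRing, conductorOf_curveRing, IsCurveOrder.deltaOf_le_conductorOf,
      ho.conductorOf_le_two_mul_deltaOf,
      ho.conductorOf_eq_two_mul_deltaOf_iff_isGorensteinLocal⟩
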